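/- Let $N\in\mathbb N$, let $\Omega\subseteq\mathbb R^N$ be a measurable set with Lebesgue measure, let $p\in(1,\infty)$ and consider the complex space $X=L^p(\Omega)$. For $\varphi\in(0,\pi)$ let $\Sigma_\varphi=\{z\in\mathbb C\setminus\{0\}:|\arg z|<\varphi\}$. A closed densely defined operator $A$ on $X$ with dense range is called sectorial if there is $\varphi\in(0,\frac\pi2)$ such that $\sigma(A)\subseteq\overline{\Sigma_\varphi}$ and $\sup_{\lambda\notin\overline{\Sigma_\varphi}}\|\lambda R(\lambda,A)\|<\infty$, where $R(\lambda,A)=(\lambda-A)^{-1}$. A set $\mathcal T$ of bounded operators on $X$ is called $\mathcal R$-bounded if there is $K\ge 0$ such that $\mathbb E\|\sum_{k=1}^n\epsilon_kT_kx_k\|\le K\,\mathbb E\|\sum_{k=1}^n\epsilon_kx_k\|$ for all $n\in\mathbb N$, $T_1,\dots,T_n\in\mathcal T$, $x_1,\dots,x_n\in X$, where $\epsilon_1,\dots,\epsilon_n$ are independent Rademacher variables. Let $(A(t))_{t\in[0,T]}$ be a family of sectorial operators on $L^p(\Omega)$, and denote by $(e^{-sA(t)})_{s\ge0}$ the $C_0$-semigroup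 generated by $-A(t)$. Suppose that: (i) there is $\varphi\in(0,\frac\pi2)$ such that $\sigma(A(t))\subseteq\overline{\Sigma_\varphi}$ for all $t\in[0,T]$ and $\sup_{t\in[0,T]}\sup_{\lambda\notin\overline{\Sigma_\varphi}}\|\lambda R(\lambda,A(t))\|<\infty$; (ii) for all $t\in[0,T]$ and $s>0$ the operator $e^{-sA(t)}$ is given by a measurable kernel $k_t(\cdot,\cdot,s)$, i.e. $(e^{-sA(t)}f)(x)=\int_\Omega k_t(x,y,s)f(y)\,dy$ for every $f\in L^p(\Omega)$ and almost every $x\in\Omega$ (with absolutely convergent integral), and there are constants $C\ge0$, $\beta>0$, $\omega_1\in\mathbb R$ such that for all $t\in[0,T]$ and $s>0$ $$|k_t(x,y,s)|\le C s^{-N/2}e^{\omega_1 s}\exp\Bigl(-\frac{|x-y|^2}{4\beta s}\Bigr)\qquad\text{for almost every }(x,y)\in\Omega\times\Omega.$$ Then there is $\theta\in(\varphi,\frac\pi2)$ such that for every $\omega\ge\max\{\omega_1,0\}$ one has $\sigma(A(t)+\omega)\subseteq\overline{\Sigma_\theta}$ for all $t\in[0,T]$ and the set $$\{\lambda R(\lambda,A(t)+\omega):\lambda\notin\overline{\Sigma_\theta},\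 t\in[0,T]\}$$ is $\mathcal R$-bounded. -/

import Mathlib

open MeasureTheory Filter Topology Set
open scoped ENNReal Real

noncomputable section

namespace KernelRBound

/-- The open sector `Σ_φ = {z ≠ 0 : |arg z| < φ}`. -/
def sector (φ : ℝ) : Set ℂ := {z | z ≠ 0 ∧ |Complex.arg z| < φ}

section Operators

variable {X : Type*} [NormedAddCommGroup X] [NormedSpace ℂ X]

/-- `R` is a bounded two-sided inverse of `z - A : D(A) → X`. -/
def IsResolventAt (A : X →ₗ.[ℂ] X) (z : ℂ) (R : X →L[ℂ] X) : Prop :=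
  (∀ x : X, ∃ h : R x ∈ A.domain, z • R x - A ⟨R x, h⟩ = x) ∧
    ∀ y : A.domain, R (z • (y : X) - A y) = y

/-- The resolvent set `ρ(A)` of a possibly unbounded operator. -/
def resolventSet (A : X →ₗ.[ℂ] X) : Set ℂ := {z | ∃ R : X →L[ℂ] X, IsResolventAt A z R}

/-- The spectrum `σ(A) = ℂ \ ρ(A)`. -/
def spectrum (A : X →ₗ.[ℂ] X) : Set ℂ := (resolventSet A)ᶜ

open Classical in
/-- The resolvent `R(z, A) = (z - A)⁻¹` for `z ∈ ρ(A)` (and the value `0` on the spectrum). -/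
def resolvent (A : X →ₗ.[ℂ] X) (z : ℂ) : X →L[ℂ] X :=
  if h : ∃ R : X →L[ℂ] X, IsResolventAt A z R then h.choose else 0

/-- The operator `A + ω` with domain `D(A)`. -/
def addScalar (A : X →ₗ.[ℂ] X) (ω : ℝ) : X →ₗ.[ℂ] X :=
  ((ω : ℂ) • (LinearMap.id : X →ₗ[ℂ] X)) +ᵥ A

/-- A sectorial operator: closed, densely defined, with dense range, and with spectrum in
a closed sector of half-angle `φ < π / 2` outside of which `‖z R(z, A)‖` is bounded. -/
def IsSectorial (A : X →ₗ.[ℂ] X) : Prop :=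
  A.IsClosed ∧ Dense (A.domain : Set X) ∧ DenseRange (fun y : A.domain => A y) ∧
    ∃ φ ∈ Ioo 0 (π / 2), spectrum A ⊆ closure (sector φ) ∧
      ∃ M : ℝ, ∀ z ∉ closure (sector φ), ‖z • resolvent A z‖ ≤ M

/-- `(S s)_{s ≥ 0}` is a `C₀`-semigroup (the values at negative times play no role). -/
def IsC0Semigroup (S : ℝ → X →L[ℂ] X) : Prop :=
  S 0 = ContinuousLinearMap.id ℂ X ∧
    (∀ s r : ℝ, 0 ≤ s → 0 ≤ r → S (s + r) = (S s).comp (S r)) ∧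
    ∀ x : X, Tendsto (fun s => S s x) (𝓝[>] 0) (𝓝 x)

/-- `G` is the infinitesimal generator of `S`: its graph consists of the pairs `(x, y)` such
that `(S s x - x) / s` converges to `y` as `s → 0+`. -/
def IsGeneratorOf (G : X →ₗ.[ℂ] X) (S : ℝ → X →L[ℂ] X) : Prop :=
  ∀ x y : X, (x, y) ∈ G.graph ↔
    Tendsto (fun s : ℝ => (s : ℂ)⁻¹ • (S s x - x)) (𝓝[>] 0) (𝓝 y)

/-- The expectation of `F (ε₁, …, εₙ)` for independent Rademacher variables `ε₁, …, εₙ`,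
i.e. the mean over all choices of signs. -/
def rademacherMean {n : ℕ} (F : (Fin n → ℤˣ) → ℝ) : ℝ := (∑ ε, F ε) / 2 ^ n

/-- `𝓡`-boundedness of a set of bounded operators. -/
def IsRBounded (𝒯 : Set (X →L[ℂ] X)) : Prop :=
  ∃ C : ℝ, 0 ≤ C ∧ ∀ (n : ℕ) (T : Fin n → X →L[ℂ] X) (x : Fin n → X), (∀ k, T k ∈ 𝒯) →
    rademacherMean (fun ε => ‖∑ k, (ε k : ℤ) • T k (x k)‖) ≤
      C * rademacherMean (fun ε => ‖∑ k, (ε k : ℤ) • x k‖)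

end Operators

/-- The operator `B` on `L^p(α, μ)` is given by the measurable kernel `k`: for every `f` and
almost every `x`, `(B f)(x) = ∫ k(x, y) f(y) dμ(y)`, the integral being absolutely convergent. -/
def IsGivenByKernel {α : Type*} [MeasurableSpace α] {μ : Measure α} {p : ℝ≥0∞} [Fact (1 ≤ p)]
    (B : Lp ℂ p μ →L[ℂ] Lp ℂ p μ) (k : α → α → ℂ) : Prop :=
  AEStronglyMeasurable (Function.uncurry k) (μ.prod μ) ∧
    ∀ f : Lp ℂ p μ, ∀ᵐ x ∂μ,
      Integrable (fun y => k x y * f y) μ ∧ B f x = ∫ y, k x y * f y ∂μ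

end KernelRBound

end

noncomputable section

namespace KernelRBound

/-! ### Khintchine inequalities for complex coefficients. -/

section Khintchine

variable {n : ℕ}

/-! On `L^p` Khintchine's inequalities turn `𝓡`-boundedness into a square function estimate, and
square functions respect pointwise domination. Everything therefore rests on one family of positive
operators, the normalised Gaussian averages `gaussAvg b`, `b > 0`. Their square function estimate is
`exists_lintegral_sum_sq_gaussAvg_le`. For `p > 2` one pairs with a weight, moves the averages onto
it by Jensen and symmetry, and applies the maximal inequality `exists_lintegral_iSup_gaussAvg_le`;
the case `p < 2` is dual, and `p = 2` is contractivity. Hence the operators dominated by `K` times a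
Gaussian average, for one `K` and all widths, form an `𝓡`-bounded set (`isRBounded_gaussClass`).

Write `A` for `A(t) + ω` and `U(s) = e^{-ωs} e^{-sA(t)}`. The kernel bound and `ω ≥ ω₁` give
Gaussian domination of `U(s)`, uniformly in `s`, `t`, `ω` (`gaussDom_rescale`). To reach resolvents
beyond a half-plane, the same is needed for `s A U(s)`. The resolvent bound on the right half-plane
and Fourier inversion give `‖s A U(s)‖ ≤ C` (`exists_graph_norm_le`). This norm bound is upgraded by
a Landau-type argument (`gaussDom_of_second_order`), with no kernels at complex times: `h s A U(s)`
equals `U(s) - U(s + hs)` up to `U(s/3) D U(s/3)` with `‖D‖ = O(h²)`. The difference has a Gaussian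
bound and the sandwiched remainder maps `L¹` to `L^∞` with the scaling of a kernel. Dividing by `h`
and choosing `h` of the size of the square root of the Gaussian leaves a wider Gaussian.

Finally, for `R = (z + A)⁻¹` and `t = m / |z|`, `z R x = z ∫₀ᵗ e^{-zs} U(s) x ds + e^{-zt} U(t) x -
e^{-zt} z⁻¹ A U(t) (z R x)`. If `Re z ≥ -|z| / m`, the exponentials are at most `e`. The first term
then lies in a closed convex hull of values of Gaussian dominated operators, the second is Gaussian
dominated, and the third is `e / m` times an operator from an `𝓡`-bounded set applied to `z R x`
itself. For large `m` it is absorbed on the left (`isRBounded_of_absorb`). With `cos θ ≤ 1 / m`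
every `z = -λ`, `λ` outside the closed sector of angle `θ`, is admissible. No constant depends on
`ω`, so neither does `θ`. -/

theorem sum_units_exp (a : Fin n → ℝ) :
    ∑ ε : Fin n → ℤˣ, Real.exp (∑ k, ((ε k : ℤ) : ℝ) * a k) = 2 ^ n * ∏ k, Real.cosh (a k) := by
  have h1 : ∀ k, ∑ u : ℤˣ, Real.exp (((u : ℤ) : ℝ) * a k) = 2 * Real.cosh (a k) := by
    intro k
    rw [show (Finset.univ : Finset ℤˣ) = {1, -1} from rfl, Finset.sum_pair (by decide), Real.cosh_eq]
    simp
    ring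
  calc _ = ∑ ε : Fin n → ℤˣ, ∏ k, Real.exp (((ε k : ℤ) : ℝ) * a k) := by
        simp_rw [Real.exp_sum]
    _ = ∏ k, ∑ u : ℤˣ, Real.exp (((u : ℤ) : ℝ) * a k) := by
        rw [Finset.prod_univ_sum, Fintype.piFinset_univ]
    _ = _ := by simp_rw [h1, Finset.prod_mul_distrib]; simp

theorem sum_units_exp_le (a : Fin n → ℝ) :
    ∑ ε : Fin n → ℤˣ, Real.exp (∑ k, ((ε k : ℤ) : ℝ) * a k) ≤
      2 ^ n * Real.exp ((∑ k, a k ^ 2) / 2) := by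
  rw [sum_units_exp, Finset.sum_div, Real.exp_sum]
  gcongr with k
  exact Real.cosh_le_exp_half_sq _

/-- The factor 2 in the exponent leaves room to bound `|Re| + |Im|` by twice the larger of the two
when passing to complex coefficients. -/
theorem sum_units_exp_two_abs_le (a : Fin n → ℝ) (ha : ∑ k, a k ^ 2 ≤ 1) :
    ∑ ε : Fin n → ℤˣ, Real.exp (2 * |∑ k, ((ε k : ℤ) : ℝ) * a k|) ≤
      2 ^ n * (2 * Real.exp 2) := by
  have key : ∀ c : ℝ, c ^ 2 = 4 →
      ∑ ε : Fin n → ℤˣ, Real.exp (c * ∑ k, ((ε k : ℤ) : ℝ) * a k) ≤ 2 ^ n * Real.exp 2 := by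
    intro c hc
    have := sum_units_exp_le (fun k => c * a k)
    simp_rw [mul_pow, ← Finset.mul_sum, hc] at this
    calc _ = ∑ ε : Fin n → ℤˣ, Real.exp (∑ k, ((ε k : ℤ) : ℝ) * (c * a k)) := by
          refine Finset.sum_congr rfl fun ε _ => ?_
          rw [Finset.mul_sum]; congr 1
          exact Finset.sum_congr rfl fun k _ => by ring
      _ ≤ _ := this
      _ ≤ _ := by gcongr; linarith
  calc _ ≤ ∑ ε : Fin n → ℤˣ, (Real.exp (2 * ∑ k, ((ε k : ℤ) : ℝ) * a k) +
        Real.exp (-2 * ∑ k, ((ε k : ℤ) : ℝ) * a k)) := by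
        refine Finset.sum_le_sum fun ε _ => ?_
        rcases abs_cases (∑ k, ((ε k : ℤ) : ℝ) * a k) with h | h <;> rw [h.1]
        · exact le_add_of_nonneg_right (Real.exp_pos _).le
        · rw [show ∀ x : ℝ, 2 * -x = -2 * x by intro x; ring]
          exact le_add_of_nonneg_left (Real.exp_pos _).le
    _ ≤ 2 ^ n * Real.exp 2 + 2 ^ n * Real.exp 2 := by
        rw [Finset.sum_add_distrib]
        exact add_le_add (key 2 (by norm_num)) (key (-2) (by norm_num))
    _ = _ := by ring

theorem rpow_le_rpow_mul_exp {r x : ℝ} (hr : 0 < r) (hx : 0 ≤ x) :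
    x ^ r ≤ r ^ r * Real.exp x := by
  have h1 : x ≤ r * Real.exp (x / r) := by
    have := Real.add_one_le_exp (x / r)
    calc x = r * (x / r) := by field_simp
      _ ≤ _ := by gcongr; linarith
  calc x ^ r ≤ (r * Real.exp (x / r)) ^ r := by gcongr
    _ = _ := by
        rw [Real.mul_rpow hr.le (Real.exp_pos _).le, ← Real.exp_mul]
        congr 2; field_simp

theorem re_sum_units (ε : Fin n → ℤˣ) (z : Fin n → ℂ) :
    (∑ k, (ε k : ℤ) • z k).re = ∑ k, ((ε k : ℤ) : ℝ) * (z k).re := by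
  simp [Complex.re_sum]

theorem im_sum_units (ε : Fin n → ℤˣ) (z : Fin n → ℂ) :
    (∑ k, (ε k : ℤ) • z k).im = ∑ k, ((ε k : ℤ) : ℝ) * (z k).im := by
  simp [Complex.im_sum]

/-- Rademacher sums are sub-Gaussian, so exponential moments are bounded, and these control every
power; real and imaginary parts are treated separately. -/
theorem khintchine_upper_of_le_one {r : ℝ} (hr : 0 < r) (z : Fin n → ℂ)
    (hz : ∑ k, ‖z k‖ ^ 2 ≤ 1) :
    ∑ ε : Fin n → ℤˣ, ‖∑ k, (ε k : ℤ) • z k‖ ^ r ≤ 2 ^ n * (r ^ r * (4 * Real.exp 2)) := by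
  have hre : ∑ k, (z k).re ^ 2 ≤ 1 := by
    refine le_trans (Finset.sum_le_sum fun k _ => ?_) hz
    rw [← sq_abs]; gcongr; exact Complex.abs_re_le_norm _
  have him : ∑ k, (z k).im ^ 2 ≤ 1 := by
    refine le_trans (Finset.sum_le_sum fun k _ => ?_) hz
    rw [← sq_abs]; gcongr; exact Complex.abs_im_le_norm _
  have h1 := sum_units_exp_two_abs_le _ hre
  have h2 := sum_units_exp_two_abs_le _ him
  have hrr : 0 < r ^ r := Real.rpow_pos_of_pos hr _
  calc _ ≤ ∑ ε : Fin n → ℤˣ, r ^ r * (Real.exp (2 * |∑ k, ((ε k : ℤ) : ℝ) * (z k).re|) +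
        Real.exp (2 * |∑ k, ((ε k : ℤ) : ℝ) * (z k).im|)) := by
        refine Finset.sum_le_sum fun ε _ => (rpow_le_rpow_mul_exp hr (norm_nonneg _)).trans ?_
        gcongr
        have := Complex.norm_le_abs_re_add_abs_im (∑ k, (ε k : ℤ) • z k)
        rw [re_sum_units, im_sum_units] at this
        rcases le_total (|∑ k, ((ε k : ℤ) : ℝ) * (z k).re|) (|∑ k, ((ε k : ℤ) : ℝ) * (z k).im|)
          with h | h
        · refine (Real.exp_le_exp.2 (?_ : _ ≤ 2 * |∑ k, ((ε k : ℤ) : ℝ) * (z k).im|)).trans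
            (le_add_of_nonneg_left (Real.exp_pos _).le)
          linarith
        · refine (Real.exp_le_exp.2 (?_ : _ ≤ 2 * |∑ k, ((ε k : ℤ) : ℝ) * (z k).re|)).trans
            (le_add_of_nonneg_right (Real.exp_pos _).le)
          linarith
    _ ≤ r ^ r * (2 ^ n * (2 * Real.exp 2) + 2 ^ n * (2 * Real.exp 2)) := by
        rw [← Finset.mul_sum, Finset.sum_add_distrib]
        gcongr
    _ = _ := by ring

/-- The upper Khintchine inequality for complex coefficients. -/
theorem khintchine_upper {r : ℝ} (hr : 0 < r) (z : Fin n → ℂ) :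
    ∑ ε : Fin n → ℤˣ, ‖∑ k, (ε k : ℤ) • z k‖ ^ r ≤
      2 ^ n * (r ^ r * (4 * Real.exp 2)) * (∑ k, ‖z k‖ ^ 2) ^ (r / 2) := by
  set σ := √(∑ k, ‖z k‖ ^ 2) with hσ
  have hs0 : 0 ≤ ∑ k, ‖z k‖ ^ 2 := Finset.sum_nonneg fun k _ => by positivity
  have hσr : (∑ k, ‖z k‖ ^ 2) ^ (r / 2) = σ ^ r := by
    rw [hσ, Real.sqrt_eq_rpow, ← Real.rpow_mul hs0]; congr 1; ring
  rw [hσr]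
  rcases (Real.sqrt_nonneg (∑ k, ‖z k‖ ^ 2)).eq_or_lt with h0 | hpos
  · have hz : ∀ k, z k = 0 := by
      intro k
      have h := (Real.sqrt_eq_zero hs0).1 h0.symm
      rw [Finset.sum_eq_zero_iff_of_nonneg fun k _ => by positivity] at h
      simpa using h k (Finset.mem_univ k)
    simp only [hz, smul_zero, Finset.sum_const_zero, norm_zero, Real.zero_rpow hr.ne']
    positivity
  · have hpos' : 0 < σ := hpos
    have := khintchine_upper_of_le_one hr (fun k => ((σ⁻¹ : ℝ) : ℂ) * z k) (by
      simp only [norm_mul, mul_pow, Complex.norm_real, Real.norm_eq_abs, sq_abs,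
        ← Finset.mul_sum]
      rw [← Real.sq_sqrt hs0, ← hσ]
      field_simp; rfl)
    have h2 : ∀ ε : Fin n → ℤˣ, ‖∑ k, (ε k : ℤ) • (((σ⁻¹ : ℝ) : ℂ) * z k)‖ ^ r =
        (σ ^ r)⁻¹ * ‖∑ k, (ε k : ℤ) • z k‖ ^ r := by
      intro ε
      have : ∑ k, (ε k : ℤ) • (((σ⁻¹ : ℝ) : ℂ) * z k) =
          ((σ⁻¹ : ℝ) : ℂ) * ∑ k, (ε k : ℤ) • z k := by
        rw [Finset.mul_sum]
        exact Finset.sum_congr rfl fun k _ => by simp only [zsmul_eq_mul]; ring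
      rw [this, norm_mul, Real.mul_rpow (norm_nonneg _) (norm_nonneg _), Complex.norm_real,
        Real.norm_of_nonneg (by positivity), Real.inv_rpow hpos'.le]
    simp_rw [h2, ← Finset.mul_sum] at this
    rwa [inv_mul_le_iff₀ (by positivity), mul_comm] at this

/-- Flipping the sign of `ε j` is a bijection of the sign choices that negates the summand. -/
theorem sum_units_mul {j k : Fin n} (hjk : j ≠ k) :
    ∑ ε : Fin n → ℤˣ, ((ε j : ℤ) : ℝ) * ((ε k : ℤ) : ℝ) = 0 := by
  have h := Fintype.sum_equiv (Equiv.mulLeft (Pi.mulSingle j (-1) : Fin n → ℤˣ))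
    (fun ε : Fin n → ℤˣ => -(((ε j : ℤ) : ℝ) * ((ε k : ℤ) : ℝ)))
    (fun ε : Fin n → ℤˣ => ((ε j : ℤ) : ℝ) * ((ε k : ℤ) : ℝ)) (by
      intro ε
      simp [Pi.mulSingle_eq_of_ne hjk.symm])
  rw [Finset.sum_neg_distrib] at h
  linarith

theorem sum_units_sq_real (a : Fin n → ℝ) :
    ∑ ε : Fin n → ℤˣ, (∑ k, ((ε k : ℤ) : ℝ) * a k) ^ 2 = 2 ^ n * ∑ k, a k ^ 2 := by
  have h1 : ∀ ε : Fin n → ℤˣ, (∑ k, ((ε k : ℤ) : ℝ) * a k) ^ 2 =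
      ∑ j, ∑ k, (a j * a k) * (((ε j : ℤ) : ℝ) * ((ε k : ℤ) : ℝ)) := by
    intro ε
    rw [sq, Finset.sum_mul_sum]
    exact Finset.sum_congr rfl fun j _ => Finset.sum_congr rfl fun k _ => by ring
  simp_rw [h1]
  rw [Finset.sum_comm, Finset.mul_sum]
  refine Finset.sum_congr rfl fun j _ => ?_
  rw [Finset.sum_comm, Finset.sum_eq_single j]
  · rw [← Finset.mul_sum]
    have : ∀ ε : Fin n → ℤˣ, ((ε j : ℤ) : ℝ) * ((ε j : ℤ) : ℝ) = 1 := by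
      intro ε; rcases Int.units_eq_one_or (ε j) with h | h <;> simp [h]
    simp [this]; ring
  · intro k _ hk
    rw [← Finset.mul_sum, sum_units_mul hk.symm, mul_zero]
  · simp

theorem sum_units_sq (z : Fin n → ℂ) :
    ∑ ε : Fin n → ℤˣ, ‖∑ k, (ε k : ℤ) • z k‖ ^ 2 = 2 ^ n * ∑ k, ‖z k‖ ^ 2 := by
  simp_rw [Complex.sq_norm, Complex.normSq_apply, re_sum_units, im_sum_units, ← sq,
    Finset.sum_add_distrib, sum_units_sq_real]
  ring

/-- The lower Khintchine inequality for complex coefficients and the first moment. -/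
theorem khintchine_lower (z : Fin n → ℂ) :
    2 ^ n * √(∑ k, ‖z k‖ ^ 2) ≤
      (2 * √(2 * (4 ^ 4 * (4 * Real.exp 2)))) * ∑ ε : Fin n → ℤˣ, ‖∑ k, (ε k : ℤ) • z k‖ := by
  set K : ℝ := 4 ^ 4 * (4 * Real.exp 2) with hK
  have hKpos : 0 < K := by positivity
  set σ := √(∑ k, ‖z k‖ ^ 2) with hσ
  have hs0 : 0 ≤ ∑ k, ‖z k‖ ^ 2 := Finset.sum_nonneg fun k _ => by positivity
  have hσ2 : σ ^ 2 = ∑ k, ‖z k‖ ^ 2 := Real.sq_sqrt hs0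
  rcases (Real.sqrt_nonneg (∑ k, ‖z k‖ ^ 2)).eq_or_lt with h0 | hpos
  · rw [hσ, ← h0]
    simp only [mul_zero]
    exact mul_nonneg (by positivity) (Finset.sum_nonneg fun _ _ => norm_nonneg _)
  have hpos' : 0 < σ := hpos
  have h4 : ∑ ε : Fin n → ℤˣ, ‖∑ k, (ε k : ℤ) • z k‖ ^ 4 ≤ 2 ^ n * K * σ ^ 4 := by
    have := khintchine_upper (r := 4) (by norm_num) z
    rw [show (4 : ℝ) / 2 = (2 : ℕ) by norm_num, Real.rpow_natCast, ← hσ2, ← pow_mul] at this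
    have h44 : (4 : ℝ) ^ (4 : ℝ) = 4 ^ 4 := by norm_num
    have h44' : ∀ t : ℝ, t ^ (4 : ℝ) = t ^ 4 := fun t => by norm_cast
    simp_rw [h44, h44'] at this
    refine le_trans this (le_of_eq ?_)
    rw [hK]
  have h2 := sum_units_sq z
  rw [← hσ2] at h2
  -- With this `L` the fourth moment term in `t² ≤ L t + t⁴ / L²` amounts to at most half of the
  -- second moment and can be absorbed.
  set L := √(2 * K) * σ with hL
  have hLpos : 0 < L := by positivity
  have hL2 : L ^ 2 = 2 * K * σ ^ 2 := by rw [hL, mul_pow, Real.sq_sqrt (by positivity)]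
  have hpt : ∀ t : ℝ, 0 ≤ t → t ^ 2 ≤ L * t + t ^ 4 / L ^ 2 := by
    intro t ht
    rcases le_total t L with h | h
    · have : t ^ 2 ≤ L * t := by nlinarith
      have : 0 ≤ t ^ 4 / L ^ 2 := by positivity
      linarith
    · have : t ^ 2 ≤ t ^ 4 / L ^ 2 := by
        rw [le_div_iff₀ (by positivity)]
        have : L ^ 2 ≤ t ^ 2 := by gcongr
        nlinarith [sq_nonneg t]
      have : 0 ≤ L * t := by positivity
      linarith
  have h5 : 2 ^ n * σ ^ 2 ≤ L * ∑ ε : Fin n → ℤˣ, ‖∑ k, (ε k : ℤ) • z k‖ +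
      (2 ^ n * K * σ ^ 4) / L ^ 2 := by
    rw [← h2]
    calc _ ≤ ∑ ε : Fin n → ℤˣ, (L * ‖∑ k, (ε k : ℤ) • z k‖ +
          ‖∑ k, (ε k : ℤ) • z k‖ ^ 4 / L ^ 2) :=
          Finset.sum_le_sum fun ε _ => hpt _ (norm_nonneg _)
      _ ≤ _ := by
          rw [Finset.sum_add_distrib, ← Finset.mul_sum, ← Finset.sum_div]
          gcongr
  have h6 : (2 ^ n * K * σ ^ 4) / L ^ 2 = 2 ^ n * σ ^ 2 / 2 := by
    rw [hL2]; field_simp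
  rw [h6, hL] at h5
  have h7 : σ * (2 ^ n * σ) ≤
      σ * ((2 * √(2 * K)) * ∑ ε : Fin n → ℤˣ, ‖∑ k, (ε k : ℤ) • z k‖) := by nlinarith
  exact le_of_mul_le_mul_left h7 hpos'

end Khintchine

/-! ### Rademacher means in `L^p` versus square functions. -/

section SquareFunction

open scoped NNReal

variable {n : ℕ}

theorem exists_khintchine_upper_enorm {r : ℝ} (hr : 0 < r) :
    ∃ C : ℝ≥0, ∀ (n : ℕ) (z : Fin n → ℂ),
      ∑ ε : Fin n → ℤˣ, ‖∑ k, (ε k : ℤ) • z k‖ₑ ^ r ≤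
        2 ^ n * (C * (∑ k, ‖z k‖ₑ ^ 2) ^ (r / 2)) := by
  refine ⟨(r ^ r * (4 * Real.exp 2)).toNNReal, fun n z => ?_⟩
  have h := ENNReal.ofReal_le_ofReal (khintchine_upper hr z)
  have hs0 : 0 ≤ ∑ k, ‖z k‖ ^ 2 := Finset.sum_nonneg fun k _ => by positivity
  rw [ENNReal.ofReal_sum_of_nonneg fun _ _ => by positivity, mul_assoc,
    ENNReal.ofReal_mul (by positivity), ENNReal.ofReal_mul (by positivity),
    ← ENNReal.ofReal_rpow_of_nonneg hs0 (by positivity),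
    ENNReal.ofReal_sum_of_nonneg fun _ _ => by positivity,
    ENNReal.ofReal_pow (by norm_num)] at h
  simp_rw [← ENNReal.ofReal_rpow_of_nonneg (norm_nonneg _) hr.le,
    ENNReal.ofReal_pow (norm_nonneg _), ofReal_norm] at h
  rw [ENNReal.ofReal_ofNat] at h
  exact h

theorem exists_khintchine_lower_enorm :
    ∃ C : ℝ≥0, ∀ (n : ℕ) (z : Fin n → ℂ),
      (∑ k, ‖z k‖ₑ ^ 2) ^ (1 / 2 : ℝ) ≤
        C * ((2 ^ n)⁻¹ * ∑ ε : Fin n → ℤˣ, ‖∑ k, (ε k : ℤ) • z k‖ₑ) := by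
  refine ⟨(2 * √(2 * (4 ^ 4 * (4 * Real.exp 2)))).toNNReal, fun n z => ?_⟩
  have h := ENNReal.ofReal_le_ofReal (khintchine_lower z)
  have hs0 : 0 ≤ ∑ k, ‖z k‖ ^ 2 := Finset.sum_nonneg fun k _ => by positivity
  rw [ENNReal.ofReal_mul (by positivity), ENNReal.ofReal_mul (by positivity), Real.sqrt_eq_rpow,
    ← ENNReal.ofReal_rpow_of_nonneg hs0 (by positivity),
    ENNReal.ofReal_sum_of_nonneg fun _ _ => by positivity,
    ENNReal.ofReal_sum_of_nonneg fun _ _ => by positivity,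
    ENNReal.ofReal_pow (by norm_num)] at h
  simp_rw [ENNReal.ofReal_pow (norm_nonneg _), ofReal_norm] at h
  rw [mul_left_comm, ← ENNReal.div_eq_inv_mul, ENNReal.le_div_iff_mul_le (by simp) (by simp),
    mul_comm]
  rw [ENNReal.ofReal_ofNat] at h
  exact h

theorem ofReal_rademacherMean {X : Type*} [SeminormedAddCommGroup X] (Y : (Fin n → ℤˣ) → X) :
    ENNReal.ofReal (rademacherMean fun ε => ‖Y ε‖) = ∑ ε, (2 ^ n)⁻¹ * ‖Y ε‖ₑ := by
  rw [rademacherMean, ENNReal.ofReal_div_of_pos (by positivity),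
    ENNReal.ofReal_sum_of_nonneg fun _ _ => norm_nonneg _, ENNReal.ofReal_pow (by norm_num),
    ← Finset.mul_sum, ENNReal.div_eq_inv_mul]
  simp_rw [ofReal_norm]
  simp

theorem sum_inv_two_pow : ∑ _ε : Fin n → ℤˣ, ((2 : ℝ≥0∞) ^ n)⁻¹ = 1 := by
  simp only [Finset.sum_const, Finset.card_univ, Fintype.card_fun, Fintype.card_units_int,
    Fintype.card_fin, nsmul_eq_mul]
  push_cast
  exact ENNReal.mul_inv_cancel (by simp) (by simp)

variable {α : Type*} [MeasurableSpace α] {ν : Measure α} {p : ℝ≥0∞}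

theorem coeFn_sum_units (ε : Fin n → ℤˣ) (f : Fin n → Lp ℂ p ν) :
    ⇑(∑ k, (ε k : ℤ) • f k) =ᵐ[ν] fun x => ∑ k, (ε k : ℤ) • f k x := by
  have h1 : ⇑(∑ k, (ε k : ℤ) • f k) =ᵐ[ν] ∑ k, ⇑((ε k : ℤ) • f k) := by
    exact Lp.coeFn_finsetSum _ _
  have h2 : ∀ k, ⇑((ε k : ℤ) • f k) =ᵐ[ν] fun x => (ε k : ℤ) • f k x := by
    intro k
    rw [← Int.cast_smul_eq_zsmul ℂ]
    filter_upwards [Lp.coeFn_smul ((ε k : ℤ) : ℂ) (f k)] with x hx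
    rw [hx, Pi.smul_apply, Int.cast_smul_eq_zsmul ℂ]
  filter_upwards [h1, eventually_all.2 h2] with x hx hx2
  rw [hx, Finset.sum_apply]
  exact Finset.sum_congr rfl fun k _ => hx2 k

variable [Fact (1 ≤ p)]

/-- The `L^p` norm of the square function of `f`. -/
def sqNorm (p : ℝ≥0∞) (ν : Measure α) (f : Fin n → α → ℝ≥0∞) : ℝ≥0∞ :=
  (∫⁻ x, (∑ k, f k x ^ 2) ^ (p.toReal / 2) ∂ν) ^ (1 / p.toReal)

theorem enorm_rpow_toReal (hp : p ≠ ∞) (f : Lp ℂ p ν) :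
    ‖f‖ₑ ^ p.toReal = ∫⁻ x, ‖f x‖ₑ ^ p.toReal ∂ν := by
  have hp0 : p ≠ 0 := (lt_of_lt_of_le one_pos Fact.out).ne'
  rw [Lp.enorm_def, eLpNorm_eq_lintegral_rpow_enorm_toReal hp0 hp, ← ENNReal.rpow_mul,
    one_div_mul_cancel (ENNReal.toReal_pos hp0 hp).ne', ENNReal.rpow_one]

/-- Jensen over the signs replaces the first moment by the `p`-th one, which commutes with the
integral; Khintchine is then applied at each point. -/
theorem exists_rademacherMean_le_sqNorm (hp : p ≠ ∞) (ν : Measure α) :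
    ∃ C : ℝ≥0, ∀ (n : ℕ) (f : Fin n → Lp ℂ p ν),
      ENNReal.ofReal (rademacherMean fun ε => ‖∑ k, (ε k : ℤ) • f k‖) ≤
        C * sqNorm p ν (fun k x => ‖f k x‖ₑ) := by
  have hp0 : p ≠ 0 := (lt_of_lt_of_le one_pos Fact.out).ne'
  have hr : 0 < p.toReal := ENNReal.toReal_pos hp0 hp
  have hr1 : 1 ≤ p.toReal := by
    rw [← ENNReal.toReal_one]; exact ENNReal.toReal_mono hp Fact.out
  obtain ⟨C, hC⟩ := exists_khintchine_upper_enorm hr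
  refine ⟨C ^ (1 / p.toReal), fun n f => ?_⟩
  rw [sqNorm, ← ENNReal.rpow_le_rpow_iff hr, ofReal_rademacherMean,
    ENNReal.mul_rpow_of_nonneg _ _ hr.le, ← ENNReal.rpow_mul, ENNReal.coe_rpow_of_nonneg _ (by positivity),
    ← ENNReal.rpow_mul, one_div_mul_cancel hr.ne', ENNReal.rpow_one, ENNReal.rpow_one]
  refine (ENNReal.rpow_arith_mean_le_arith_mean_rpow _ _ _ sum_inv_two_pow hr1).trans ?_
  simp_rw [enorm_rpow_toReal hp]
  rw [← Finset.mul_sum, ← lintegral_finsetSum' _ fun ε _ =>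
    ((Lp.aestronglyMeasurable _).enorm.pow_const _)]
  have h2 : ∫⁻ x, ∑ ε : Fin n → ℤˣ, ‖(∑ k, (ε k : ℤ) • f k : Lp ℂ p ν) x‖ₑ ^ p.toReal ∂ν ≤
      ∫⁻ x, 2 ^ n * (C * (∑ k, ‖f k x‖ₑ ^ 2) ^ (p.toReal / 2)) ∂ν := by
    refine lintegral_mono_ae ?_
    filter_upwards [eventually_all.2 fun ε => coeFn_sum_units ε f] with x hx
    simp_rw [hx]
    exact hC n _
  have hmeas : AEMeasurable (fun x => (∑ k, ‖f k x‖ₑ ^ 2) ^ (p.toReal / 2)) ν :=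
    (Finset.aemeasurable_fun_sum _ fun k _ =>
      (Lp.aestronglyMeasurable _).enorm.pow_const _).pow_const _
  rw [lintegral_const_mul'' _ (hmeas.const_mul _), lintegral_const_mul'' _ hmeas] at h2
  refine (mul_le_mul' le_rfl h2).trans (le_of_eq ?_)
  rw [← mul_assoc, ENNReal.inv_mul_cancel (by simp) (by simp), one_mul]

/-- Here Khintchine for the first moment comes first, pointwise, and Minkowski's inequality takes
the mean over signs out of the `L^p` norm. -/
theorem exists_sqNorm_le_rademacherMean (hp : p ≠ ∞) (ν : Measure α) :
    ∃ C : ℝ≥0, ∀ (n : ℕ) (f : Fin n → Lp ℂ p ν),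
      sqNorm p ν (fun k x => ‖f k x‖ₑ) ≤
        C * ENNReal.ofReal (rademacherMean fun ε => ‖∑ k, (ε k : ℤ) • f k‖) := by
  have hp1 : 1 ≤ p := Fact.out
  have hp0 : p ≠ 0 := (lt_of_lt_of_le one_pos Fact.out).ne'
  have hr : 0 < p.toReal := ENNReal.toReal_pos hp0 hp
  obtain ⟨C, hC⟩ := exists_khintchine_lower_enorm
  refine ⟨C, fun n f => ?_⟩
  have hle : sqNorm p ν (fun k x => ‖f k x‖ₑ) ≤
      eLpNorm (fun x => C * ∑ ε : Fin n → ℤˣ,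
        (2 ^ n)⁻¹ * ‖(∑ k, (ε k : ℤ) • f k : Lp ℂ p ν) x‖ₑ) p ν := by
    rw [eLpNorm_eq_lintegral_rpow_enorm_toReal hp0 hp, sqNorm]
    gcongr ?_ ^ _
    refine lintegral_mono_ae ?_
    filter_upwards [eventually_all.2 fun ε => coeFn_sum_units ε f] with x hx
    simp_rw [hx, enorm_eq_self, ← Finset.mul_sum]
    calc _ = ((∑ k, ‖f k x‖ₑ ^ 2) ^ (1 / 2 : ℝ)) ^ p.toReal := by
          rw [← ENNReal.rpow_mul]; congr 1; ring
      _ ≤ _ := by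
          gcongr
          exact hC n _
  refine hle.trans ?_
  have hmeas : ∀ ε : Fin n → ℤˣ, AEStronglyMeasurable (fun x =>
      (C : ℝ≥0∞) * ((2 ^ n)⁻¹ * ‖(∑ k, (ε k : ℤ) • f k : Lp ℂ p ν) x‖ₑ)) ν := fun ε =>
    (((Lp.aestronglyMeasurable _).enorm.const_mul _).const_mul _).aestronglyMeasurable
  have hsum := eLpNorm_sum_le (s := Finset.univ) (fun ε _ => hmeas ε) hp1
  simp_rw [Finset.mul_sum]
  have heq : (fun x => ∑ ε : Fin n → ℤˣ, (C : ℝ≥0∞) *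
      ((2 ^ n)⁻¹ * ‖(∑ k, (ε k : ℤ) • f k : Lp ℂ p ν) x‖ₑ)) =
      ∑ ε : Fin n → ℤˣ, fun x => (C : ℝ≥0∞) *
      ((2 ^ n)⁻¹ * ‖(∑ k, (ε k : ℤ) • f k : Lp ℂ p ν) x‖ₑ) := by
    ext x; simp
  rw [heq, ofReal_rademacherMean, Finset.mul_sum]
  refine hsum.trans (Finset.sum_le_sum fun ε _ => ?_)
  rw [Lp.enorm_def, eLpNorm_eq_lintegral_rpow_enorm_toReal hp0 hp,
    eLpNorm_eq_lintegral_rpow_enorm_toReal hp0 hp]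
  simp_rw [enorm_eq_self, ENNReal.mul_rpow_of_nonneg _ _ hr.le]
  have hm : AEMeasurable (fun x => ‖(∑ k, (ε k : ℤ) • f k : Lp ℂ p ν) x‖ₑ ^ p.toReal) ν :=
    (Lp.aestronglyMeasurable _).enorm.pow_const _
  rw [lintegral_const_mul'' _ (hm.const_mul _), lintegral_const_mul'' _ hm,
    ENNReal.mul_rpow_of_nonneg _ _ (by positivity),
    ENNReal.mul_rpow_of_nonneg _ _ (by positivity), ← ENNReal.rpow_mul, ← ENNReal.rpow_mul,
    mul_one_div_cancel hr.ne', ENNReal.rpow_one, ENNReal.rpow_one]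

end SquareFunction

/-! ### The Rademacher seminorm and closed convex hulls. -/

section RBound

variable {X : Type*} [NormedAddCommGroup X] {n : ℕ}

theorem rademacherMean_mono {F G : (Fin n → ℤˣ) → ℝ} (h : ∀ ε, F ε ≤ G ε) :
    rademacherMean F ≤ rademacherMean G := by
  unfold rademacherMean
  gcongr with ε
  exact h ε

theorem rademacherMean_nonneg {F : (Fin n → ℤˣ) → ℝ} (h : ∀ ε, 0 ≤ F ε) :
    0 ≤ rademacherMean F :=
  div_nonneg (Finset.sum_nonneg fun ε _ => h ε) (by positivity)

theorem rademacherMean_add (F G : (Fin n → ℤˣ) → ℝ) :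
    rademacherMean (fun ε => F ε + G ε) = rademacherMean F + rademacherMean G := by
  simp only [rademacherMean, Finset.sum_add_distrib, add_div]

theorem rademacherMean_mul_left (c : ℝ) (F : (Fin n → ℤˣ) → ℝ) :
    rademacherMean (fun ε => c * F ε) = c * rademacherMean F := by
  simp only [rademacherMean, ← Finset.mul_sum, mul_div_assoc]

/-- The norm of the Rademacher sum `∑ εₖ xₖ` in `L¹`. -/
def radNorm (x : Fin n → X) : ℝ := rademacherMean fun ε => ‖∑ k, (ε k : ℤ) • x k‖

theorem radNorm_nonneg (x : Fin n → X) : 0 ≤ radNorm x :=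
  rademacherMean_nonneg fun _ => norm_nonneg _

theorem radNorm_add_le (x y : Fin n → X) : radNorm (x + y) ≤ radNorm x + radNorm y := by
  rw [radNorm, radNorm, radNorm, ← rademacherMean_add]
  refine rademacherMean_mono fun ε => ?_
  simp only [Pi.add_apply, smul_add, Finset.sum_add_distrib]
  exact norm_add_le _ _

theorem continuous_radNorm : Continuous (radNorm : (Fin n → X) → ℝ) := by
  unfold radNorm rademacherMean
  fun_prop

variable [NormedSpace ℂ X]

theorem radNorm_smul (c : ℝ) (x : Fin n → X) : radNorm (c • x) = |c| * radNorm x := by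
  rw [radNorm, radNorm, ← rademacherMean_mul_left]
  congr 1; ext ε
  rw [← Real.norm_eq_abs, ← norm_smul, Finset.smul_sum]
  simp only [Pi.smul_apply]
  congr 1
  exact Finset.sum_congr rfl fun k _ => smul_comm _ _ _

theorem convex_radNorm_le (C : ℝ) : Convex ℝ {y : Fin n → X | radNorm y ≤ C} := by
  intro y hy z hz a b ha hb hab
  simp only [mem_ofPred_eq] at *
  calc _ ≤ radNorm (a • y) + radNorm (b • z) := radNorm_add_le _ _
    _ = a * radNorm y + b * radNorm z := by
        rw [radNorm_smul, radNorm_smul, abs_of_nonneg ha, abs_of_nonneg hb]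
    _ ≤ a * C + b * C := by gcongr
    _ = C := by rw [← add_mul, hab, one_mul]

/-- Bounds for Rademacher sums pass to coordinatewise closed convex hulls. -/
theorem radNorm_le_of_mem_closure_convexHull {C : ℝ} {s : Fin n → Set X}
    (hs : ∀ y : Fin n → X, (∀ k, y k ∈ s k) → radNorm y ≤ C) {y : Fin n → X}
    (hy : ∀ k, y k ∈ closure (convexHull ℝ (s k))) : radNorm y ≤ C := by
  have h1 : closure (convexHull ℝ (univ.pi s)) ⊆ {y : Fin n → X | radNorm y ≤ C} :=
    closure_minimal (convexHull_min (fun y hy => hs y fun k => hy k trivial)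
      (convex_radNorm_le C)) (isClosed_le continuous_radNorm continuous_const)
  -- Closure and convex hull both commute with products, so one sublevel set in `Fin n → X` handles
  -- all coordinates at once.
  rw [convexHull_pi, closure_pi_set] at h1
  exact h1 fun k _ => hy k

end RBound

/-! ### Gaussian averages: symmetry, contractivity, weak type bound. -/

section GaussAverage

open scoped NNReal
open Metric

variable {E : Type*} [NormedAddCommGroup E]

/-- The Gaussian `exp (-|x|² / b)`. -/
def gauss (b : ℝ) (x : E) : ℝ≥0∞ := ENNReal.ofReal (Real.exp (-(‖x‖ ^ 2 / b)))

theorem gauss_neg (b : ℝ) (x : E) : gauss b (-x) = gauss b x := by simp [gauss]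

theorem gauss_sub_comm (b : ℝ) (x y : E) : gauss b (x - y) = gauss b (y - x) := by
  rw [← neg_sub, gauss_neg]

theorem gauss_le_one {b : ℝ} (hb : 0 < b) (x : E) : gauss b x ≤ 1 := by
  rw [gauss, ENNReal.ofReal_le_one, Real.exp_le_one_iff]
  have : 0 ≤ ‖x‖ ^ 2 / b := by positivity
  linarith

theorem gauss_mono {b c : ℝ} (hb : 0 < b) (hbc : b ≤ c) (x : E) : gauss b x ≤ gauss c x := by
  unfold gauss
  gcongr

variable [MeasurableSpace E] [BorelSpace E]

@[fun_prop]
theorem measurable_gauss (b : ℝ) : Measurable (gauss b : E → ℝ≥0∞) := by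
  unfold gauss
  fun_prop

variable [InnerProductSpace ℝ E] [FiniteDimensional ℝ E]

variable (E) in
/-- The total mass of the Gaussian `exp (-|x|² / b)`. -/
def gaussMass (b : ℝ) : ℝ≥0∞ := ∫⁻ x : E, gauss b x

variable (E) in
theorem gaussMass_eq {b : ℝ} (hb : 0 < b) :
    gaussMass E b = ENNReal.ofReal ((π * b) ^ (Module.finrank ℝ E / 2 : ℝ)) := by
  have h := GaussianFourier.integral_rexp_neg_mul_sq_norm (V := E) (b := b⁻¹) (by positivity)
  have h0 : (0 : ℝ) < (π / b⁻¹) ^ (Module.finrank ℝ E / 2 : ℝ) := by positivity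
  have hint : Integrable fun v : E => Real.exp (-b⁻¹ * ‖v‖ ^ 2) := by
    by_contra hc
    rw [integral_undef hc] at h
    exact h0.ne h
  rw [div_inv_eq_mul] at h
  rw [← h, ofReal_integral_eq_lintegral_ofReal hint (ae_of_all _ fun _ => (Real.exp_pos _).le)]
  unfold gaussMass gauss
  congr 1; ext x; congr 2; ring

variable (E) in
theorem gaussMass_ne_zero {b : ℝ} (hb : 0 < b) : gaussMass E b ≠ 0 := by
  rw [gaussMass_eq E hb, ENNReal.ofReal_ne_zero_iff]
  positivity

variable (E) in
theorem gaussMass_ne_top {b : ℝ} (hb : 0 < b) : gaussMass E b ≠ ∞ := by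
  rw [gaussMass_eq E hb]
  exact ENNReal.ofReal_ne_top

/-- The average of `F` around `x` with Gaussian weight `exp (-|x - y|² / b)`. -/
def gaussAvg (b : ℝ) (F : E → ℝ≥0∞) (x : E) : ℝ≥0∞ :=
  (gaussMass E b)⁻¹ * ∫⁻ y, gauss b (x - y) * F y

theorem lintegral_gauss_sub (b : ℝ) (x : E) : ∫⁻ y, gauss b (x - y) = gaussMass E b :=
  lintegral_sub_left_eq_self (gauss b) x

theorem gaussAvg_const {b : ℝ} (hb : 0 < b) (c : ℝ≥0∞) (x : E) :
    gaussAvg b (fun _ => c) x = c := by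
  rw [gaussAvg, lintegral_mul_const _ (by fun_prop), lintegral_gauss_sub, ← mul_assoc,
    ENNReal.inv_mul_cancel (gaussMass_ne_zero E hb) (gaussMass_ne_top E hb), one_mul]

theorem gaussAvg_mono {b : ℝ} {F G : E → ℝ≥0∞} (h : ∀ y, F y ≤ G y) (x : E) :
    gaussAvg b F x ≤ gaussAvg b G x := by
  unfold gaussAvg
  gcongr with y
  exact h y

theorem gaussAvg_add {b : ℝ} {F G : E → ℝ≥0∞} (hF : Measurable F) (x : E) :
    gaussAvg b (fun y => F y + G y) x = gaussAvg b F x + gaussAvg b G x := by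
  simp_rw [gaussAvg, mul_add]
  rw [lintegral_add_left (by fun_prop), mul_add]

@[fun_prop]
theorem measurable_gaussAvg {b : ℝ} {F : E → ℝ≥0∞} (hF : Measurable F) :
    Measurable (gaussAvg b F) := by
  unfold gaussAvg
  exact (Measurable.lintegral_prod_right' (f := fun z : E × E => gauss b (z.1 - z.2) * F z.2)
    (by fun_prop)).const_mul _

theorem lintegral_gaussAvg_mul {b : ℝ} {F G : E → ℝ≥0∞} (hF : Measurable F) (hG : Measurable G) :
    ∫⁻ x, gaussAvg b F x * G x = ∫⁻ x, F x * gaussAvg b G x := by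
  have h1 : ∀ F' G' : E → ℝ≥0∞, Measurable F' → Measurable G' →
      ∫⁻ x, gaussAvg b F' x * G' x =
        (gaussMass E b)⁻¹ * ∫⁻ x, ∫⁻ y, gauss b (x - y) * F' y * G' x := by
    intro F' G' hF' hG'
    have hm : Measurable fun z : E × E => gauss b (z.1 - z.2) * F' z.2 * G' z.1 := by fun_prop
    rw [← lintegral_const_mul _ hm.lintegral_prod_right']
    congr 1; ext x
    simp only
    rw [gaussAvg, lintegral_mul_const _ (by fun_prop), mul_assoc]
  have hm : Measurable fun z : E × E => gauss b (z.1 - z.2) * F z.2 * G z.1 := by fun_prop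
  simp_rw [mul_comm (F _)]
  rw [h1 F G hF hG, h1 G F hG hF, lintegral_lintegral_swap hm.aemeasurable]
  congr 1
  refine lintegral_congr fun x => lintegral_congr fun y => ?_
  rw [gauss_sub_comm]; ring

theorem lintegral_gaussAvg {b : ℝ} (hb : 0 < b) {F : E → ℝ≥0∞} (hF : Measurable F) :
    ∫⁻ x, gaussAvg b F x = ∫⁻ x, F x := by
  have := lintegral_gaussAvg_mul (b := b) hF (measurable_const (a := (1 : ℝ≥0∞)))
  simpa [gaussAvg_const hb] using this

/-- Jensen's inequality for Gaussian averages. -/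
theorem gaussAvg_rpow_le {b r : ℝ} (hb : 0 < b) (hr : 1 ≤ r) {F : E → ℝ≥0∞} (hF : Measurable F)
    (x : E) : gaussAvg b F x ^ r ≤ gaussAvg b (fun y => F y ^ r) x := by
  rcases hr.eq_or_lt with rfl | hr
  · simp
  have hr0 : 0 < r := by linarith
  have hpq := Real.HolderConjugate.conjExponent hr
  set q := Real.conjExponent r
  have hm0 := gaussMass_ne_zero E hb
  have hm1 := gaussMass_ne_top E hb
  have hq0 := hpq.symm.pos
  -- Hölder with the Gaussian weight split into its powers `1/r` and `1/q`.
  have h := ENNReal.lintegral_mul_le_Lp_mul_Lq volume hpq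
    (f := fun y => gauss b (x - y) ^ (1 / r) * F y) (g := fun y => gauss b (x - y) ^ (1 / q))
    (by fun_prop) (by fun_prop)
  have e1 : ∀ y, ((fun y => gauss b (x - y) ^ (1 / r) * F y) *
      (fun y => gauss b (x - y) ^ (1 / q))) y = gauss b (x - y) * F y := by
    intro y
    simp only [Pi.mul_apply]
    rw [mul_right_comm, ← ENNReal.rpow_add_of_nonneg _ _ (by positivity) (by positivity)]
    simp only [one_div, hpq.inv_add_inv_eq_one, ENNReal.rpow_one]
  simp_rw [e1, ENNReal.mul_rpow_of_nonneg _ _ hr0.le, ← ENNReal.rpow_mul,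
    one_div_mul_cancel hr0.ne', one_div_mul_cancel hq0.ne', ENNReal.rpow_one,
    lintegral_gauss_sub] at h
  rw [gaussAvg, ENNReal.mul_rpow_of_nonneg _ _ hr0.le]
  calc _ ≤ (gaussMass E b)⁻¹ ^ r * ((∫⁻ y, gauss b (x - y) * F y ^ r) ^ (1 / r) *
        gaussMass E b ^ (1 / q)) ^ r := by gcongr
    _ = _ := by
        rw [ENNReal.mul_rpow_of_nonneg _ _ hr0.le, ← ENNReal.rpow_mul,
          one_div_mul_cancel hr0.ne', ENNReal.rpow_one, ← ENNReal.rpow_mul, gaussAvg,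
          mul_comm (lintegral _ _), ← mul_assoc, ENNReal.inv_rpow, ← ENNReal.rpow_neg,
          ← ENNReal.rpow_add _ _ hm0 hm1, ← ENNReal.rpow_neg_one]
        congr 2
        have := hpq.inv_add_inv_eq_one
        have : 1 / q = 1 - r⁻¹ := by rw [one_div]; linarith
        rw [this]; field_simp; ring

theorem lintegral_gaussAvg_rpow_le {b r : ℝ} (hb : 0 < b) (hr : 1 ≤ r) {F : E → ℝ≥0∞}
    (hF : Measurable F) : ∫⁻ x, gaussAvg b F x ^ r ≤ ∫⁻ x, F x ^ r :=
  (lintegral_mono fun x => gaussAvg_rpow_le hb hr hF x).trans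
    (lintegral_gaussAvg hb (by fun_prop)).le

/-- Gaussian averages are superpositions of integrals over balls. -/
theorem lintegral_gauss_mul {b : ℝ} (hb : 0 < b) {F : E → ℝ≥0∞} (hF : Measurable F) (x : E) :
    ∫⁻ y, gauss b (x - y) * F y =
      ∫⁻ t in Ioi (0 : ℝ), ∫⁻ y in ball x √(b * -Real.log t), F y := by
  have h := lintegral_eq_lintegral_meas_lt (volume.withDensity F)
    (f := fun y => Real.exp (-(‖x - y‖ ^ 2 / b))) (ae_of_all _ fun _ => (Real.exp_pos _).le)
    (by fun_prop)
  rw [lintegral_withDensity_eq_lintegral_mul _ hF (by fun_prop)] at h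
  have e1 : ∀ y, (F * fun y => ENNReal.ofReal (Real.exp (-(‖x - y‖ ^ 2 / b)))) y =
      gauss b (x - y) * F y := fun y => mul_comm _ _
  simp_rw [e1] at h
  rw [h]
  refine setLIntegral_congr_fun measurableSet_Ioi fun t (ht : 0 < t) => ?_
  -- For `t ≥ 1` the square root is that of a nonpositive number, hence 0, and the empty ball agrees
  -- with the empty superlevel set.
  have : {a | t < Real.exp (-(‖x - a‖ ^ 2 / b))} = ball x √(b * -Real.log t) := by
    ext y
    rw [mem_ofPred_eq, mem_ball, dist_comm, dist_eq_norm, ← Real.log_lt_iff_lt_exp ht,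
      Real.lt_sqrt (norm_nonneg _), lt_neg, div_lt_iff₀ hb, mul_comm b]
  rw [this, withDensity_apply _ measurableSet_ball]

/-- If all averages over balls centred at `x` were at most `c`, integrating over the layers would
make the Gaussian average at most that of the constant `c`. -/
theorem exists_ball_of_lt_gaussAvg {b : ℝ} (hb : 0 < b) {F : E → ℝ≥0∞} (hF : Measurable F)
    {x : E} {c : ℝ≥0∞} (hc : c < gaussAvg b F x) :
    ∃ r > 0, c * volume (ball x r) < ∫⁻ y in ball x r, F y := by
  by_contra! hcon
  refine hc.not_ge ?_
  have h1 : ∫⁻ y, gauss b (x - y) * F y ≤ c * gaussMass E b := by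
    have h2 := lintegral_gauss_mul hb (measurable_const (a := c)) x
    rw [lintegral_mul_const _ (by fun_prop), lintegral_gauss_sub] at h2
    rw [lintegral_gauss_mul hb hF, mul_comm, h2]
    refine lintegral_mono fun t => ?_
    rw [setLIntegral_const]
    rcases (Real.sqrt_nonneg (b * -Real.log t)).eq_or_lt with h | h
    · rw [← h]; simp
    · exact hcon _ h
  calc _ ≤ (gaussMass E b)⁻¹ * (c * gaussMass E b) := by unfold gaussAvg; gcongr
    _ = c := by
      rw [mul_left_comm, ENNReal.inv_mul_cancel (gaussMass_ne_zero E hb) (gaussMass_ne_top E hb),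
        mul_one]

/-- Vitali's covering argument needs bounded radii, hence the cap `R`. The bound does not involve
`R`, so the cap can be removed by monotone convergence. -/
theorem volume_maximal_le_aux {F : E → ℝ≥0∞} {c : ℝ≥0∞} (hc0 : c ≠ 0) (hc : c ≠ ∞) (R : ℝ) :
    volume {x : E | ∃ r > 0, r ≤ R ∧ c * volume (ball x r) < ∫⁻ y in ball x r, F y} ≤
      4 ^ Module.finrank ℝ E * c⁻¹ * ∫⁻ x, F x := by
  set s := {x : E | ∃ r > 0, r ≤ R ∧ c * volume (ball x r) < ∫⁻ y in ball x r, F y}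
  choose! r hr0 hrR hr using fun (x : E) (hx : x ∈ s) => hx
  obtain ⟨u, hus, hdisj, hcov⟩ := Vitali.exists_disjoint_subfamily_covering_enlargement_ball
    s id r R hrR 4 (by norm_num)
  have hcount : u.Countable := PairwiseDisjoint.countable_of_isOpen (s := fun x => ball x (r x)) hdisj (fun _ _ => isOpen_ball)
    fun x hx => nonempty_ball.2 (hr0 x (hus hx))
  have hsub : s ⊆ ⋃ x ∈ u, ball x (4 * r x) := by
    intro x hx
    obtain ⟨y, hy, hxy⟩ := hcov x hx
    exact mem_biUnion hy (hxy (mem_ball_self (hr0 x hx)))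
  calc volume s ≤ ∑' x : u, volume (ball (x : E) (4 * r x)) :=
        (measure_mono hsub).trans (measure_biUnion_le _ hcount _)
    _ ≤ ∑' x : u, 4 ^ Module.finrank ℝ E * c⁻¹ * ∫⁻ y in ball (x : E) (r x), F y := by
        refine ENNReal.tsum_le_tsum fun x => ?_
        rw [Measure.addHaar_ball_mul_of_pos _ _ (by norm_num : (0 : ℝ) < 4), ENNReal.ofReal_pow (by norm_num),
          ENNReal.ofReal_ofNat, mul_assoc, ← Measure.addHaar_ball_center volume (x : E)]
        gcongr
        rw [← ENNReal.div_eq_inv_mul, ENNReal.le_div_iff_mul_le (Or.inl hc0) (Or.inl hc), mul_comm]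
        exact (hr x (hus x.2)).le
    _ = 4 ^ Module.finrank ℝ E * c⁻¹ * ∫⁻ y in ⋃ x ∈ u, ball x (r x), F y := by
        rw [ENNReal.tsum_mul_left, lintegral_biUnion hcount (fun _ _ => measurableSet_ball)
          (show u.PairwiseDisjoint fun x => ball x (r x) from hdisj)]
    _ ≤ _ := by
        gcongr
        exact Measure.restrict_le_self

/-- The weak type `(1, 1)` inequality for suprema of Gaussian averages. -/
theorem volume_lt_gaussAvg_le {n : ℕ} {b : Fin n → ℝ} (hb : ∀ k, 0 < b k) {F : E → ℝ≥0∞}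
    (hF : Measurable F) {c : ℝ≥0∞} (hc0 : c ≠ 0) (hc : c ≠ ∞) :
    volume {x : E | ∃ k, c < gaussAvg (b k) F x} ≤
      4 ^ Module.finrank ℝ E * c⁻¹ * ∫⁻ x, F x := by
  set s : ℕ → Set E := fun R =>
    {x : E | ∃ r > 0, r ≤ (R : ℝ) ∧ c * volume (ball x r) < ∫⁻ y in ball x r, F y}
  have hs : Monotone s := fun R R' h x ⟨r, hr, hrR, hx⟩ =>
    ⟨r, hr, hrR.trans (by exact_mod_cast h), hx⟩
  have hsub : {x : E | ∃ k, c < gaussAvg (b k) F x} ⊆ ⋃ R, s R := by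
    rintro x ⟨k, hk⟩
    obtain ⟨r, hr, h⟩ := exists_ball_of_lt_gaussAvg (hb k) hF hk
    obtain ⟨R, hR⟩ := exists_nat_ge r
    exact mem_iUnion.2 ⟨R, r, hr, hR, h⟩
  refine (measure_mono hsub).trans ?_
  rw [hs.measure_iUnion]
  exact iSup_le fun R => volume_maximal_le_aux hc0 hc _

end GaussAverage

/-! ### The layer cake formula for powers. -/

section LayerCake

theorem lintegral_Ioo_rpow {s r : ℝ} (hs : 0 ≤ s) (hr : 0 < r) :
    ∫⁻ t in Ioo 0 s, ENNReal.ofReal (t ^ (r - 1)) = ENNReal.ofReal s ^ r / ENNReal.ofReal r := by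
  rw [ENNReal.ofReal_rpow_of_nonneg hs hr.le, ← ENNReal.ofReal_div_of_pos hr,
    setLIntegral_congr Ioo_ae_eq_Ioc]
  have hi : IntervalIntegrable (fun t : ℝ => t ^ (r - 1)) volume 0 s :=
    intervalIntegral.intervalIntegrable_rpow' (by linarith)
  rw [intervalIntegrable_iff_integrableOn_Ioc_of_le hs] at hi
  rw [← ofReal_integral_eq_lintegral_ofReal hi
    (ae_restrict_of_forall_mem measurableSet_Ioc fun t ht => Real.rpow_nonneg ht.1.le _),
    ← intervalIntegral.integral_of_le hs, integral_rpow (Or.inl (by linarith))]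
  simp [Real.zero_rpow hr.ne']

/-- The value `a = ∞` has to be covered, because the suprema of averages to which this is applied
are not known to be finite. -/
theorem lintegral_indicator_lt_rpow (a : ℝ≥0∞) {r : ℝ} (hr : 0 < r) :
    ∫⁻ t in Ioi (0 : ℝ), {t : ℝ | ENNReal.ofReal t < a}.indicator
      (fun t => ENNReal.ofReal (t ^ (r - 1))) t = a ^ r / ENNReal.ofReal r := by
  have hm : MeasurableSet {t : ℝ | ENNReal.ofReal t < a} :=
    measurableSet_lt ENNReal.measurable_ofReal measurable_const
  rw [setLIntegral_indicator hm]
  induction a using ENNReal.recTopCoe with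
  | top =>
    rw [ENNReal.top_rpow_of_pos hr, ENNReal.top_div_of_ne_top ENNReal.ofReal_ne_top]
    simp only [ENNReal.ofReal_lt_top, ofPred_true, univ_inter]
    have hT : Tendsto (fun n : ℕ => ENNReal.ofReal ((n : ℝ) ^ r / r)) atTop (𝓝 ∞) :=
      ENNReal.tendsto_ofReal_atTop.comp (((tendsto_rpow_atTop hr).comp
        tendsto_natCast_atTop_atTop).atTop_div_const hr)
    refine top_le_iff.1 (le_of_tendsto' hT fun n => ?_)
    have h := lintegral_Ioo_rpow (s := n) (Nat.cast_nonneg _) hr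
    rw [ENNReal.ofReal_div_of_pos hr, ← ENNReal.ofReal_rpow_of_nonneg (Nat.cast_nonneg _) hr.le,
      ← h]
    exact lintegral_mono_set Ioo_subset_Ioi_self
  | coe a =>
    have : {t : ℝ | ENNReal.ofReal t < a} ∩ Ioi 0 = Ioo 0 (a : ℝ) := by
      ext t
      simp only [mem_inter_iff, mem_ofPred_eq, mem_Ioi, mem_Ioo]
      rw [and_comm]
      refine and_congr_right fun ht => ?_
      rw [ENNReal.ofReal_lt_iff_lt_toReal ht.le ENNReal.coe_ne_top, ENNReal.coe_toReal]
    rw [this, lintegral_Ioo_rpow a.coe_nonneg hr]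
    simp

end LayerCake

/-! ### Maximal inequality for Gaussian averages, by Marcinkiewicz interpolation. -/

section Maximal

open scoped NNReal

variable {E : Type*} [NormedAddCommGroup E] [InnerProductSpace ℝ E] [FiniteDimensional ℝ E]
  [MeasurableSpace E] [BorelSpace E]

/-- Weak type estimate with the function cut off at half the height. -/
theorem volume_lt_iSup_gaussAvg_le {n : ℕ} {b : Fin n → ℝ} (hb : ∀ k, 0 < b k) {g : E → ℝ≥0∞}
    (hg : Measurable g) {t : ℝ} (ht : 0 < t) :
    volume {x : E | ENNReal.ofReal t < ⨆ k, gaussAvg (b k) g x} ≤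
      4 ^ Module.finrank ℝ E * (2 * (ENNReal.ofReal t)⁻¹) *
        ∫⁻ x, {x | ENNReal.ofReal t < 2 * g x}.indicator g x := by
  set c := ENNReal.ofReal (t / 2)
  have hc2 : ENNReal.ofReal t = c + c := by
    rw [← ENNReal.ofReal_add (by positivity) (by positivity), add_halves]
  have hc2' : ENNReal.ofReal t = 2 * c := by rw [hc2, two_mul]
  have hc0 : c ≠ 0 := by simp [c, ht]
  have hct : c ≠ ∞ := ENNReal.ofReal_ne_top
  set s := {x | ENNReal.ofReal t < 2 * g x}
  have hs : MeasurableSet s := measurableSet_lt measurable_const (by fun_prop)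
  have hsub : {x : E | ENNReal.ofReal t < ⨆ k, gaussAvg (b k) g x} ⊆
      {x | ∃ k, c < gaussAvg (b k) (s.indicator g) x} := by
    intro x hx
    obtain ⟨k, hk⟩ := lt_iSup_iff.1 (show _ < ⨆ k, gaussAvg (b k) g x from hx)
    refine ⟨k, ?_⟩
    -- Off `s` the function is at most `c = t / 2`, and so is the average of that part; the part on
    -- `s` must account for the other half of the height.
    have h1 : gaussAvg (b k) g x ≤ gaussAvg (b k) (s.indicator g) x + c := by
      rw [← gaussAvg_const (hb k) c x, ← gaussAvg_add (hg.indicator hs)]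
      refine gaussAvg_mono (fun y => ?_) x
      by_cases hy : y ∈ s
      · simp [indicator_of_mem hy]
      · have : 2 * g y ≤ 2 * c := by rw [← hc2']; exact not_lt.1 hy
        rw [indicator_of_notMem hy, zero_add]
        exact (ENNReal.mul_le_mul_iff_right (by simp) (by simp)).1 this
    have h2 := hk.trans_le h1
    rw [hc2] at h2
    exact lt_of_add_lt_add_right h2
  refine (measure_mono hsub).trans ((volume_lt_gaussAvg_le hb (hg.indicator hs) hc0 hct).trans
    (le_of_eq ?_))
  congr 2
  rw [hc2', ENNReal.mul_inv (by simp) (by simp), ← mul_assoc, ENNReal.mul_inv_cancel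
    (by simp) (by simp), one_mul]

variable (E) in
/-- The strong type inequality for suprema of finitely many Gaussian averages. -/
theorem exists_lintegral_iSup_gaussAvg_le {q : ℝ} (hq : 1 < q) :
    ∃ C : ℝ≥0, ∀ (n : ℕ) (b : Fin n → ℝ) (_ : ∀ k, 0 < b k) (g : E → ℝ≥0∞) (_ : Measurable g),
      ∫⁻ x, (⨆ k, gaussAvg (b k) g x) ^ q ≤ C * ∫⁻ x, g x ^ q := by
  set K : ℝ≥0∞ := ENNReal.ofReal q * (4 ^ Module.finrank ℝ E * 2) *
    ((2 : ℝ≥0∞) ^ (q - 1) / ENNReal.ofReal (q - 1)) with hK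
  have hq0 : 0 < q := by linarith
  have hq1 : 0 < q - 1 := by linarith
  have hKt : K ≠ ∞ := by
    refine ENNReal.mul_ne_top (ENNReal.mul_ne_top ENNReal.ofReal_ne_top
      (ENNReal.mul_ne_top (by simp) (by simp))) (ENNReal.div_ne_top ?_ (by simpa using hq))
    exact ENNReal.rpow_ne_top_of_nonneg hq1.le (by simp)
  refine ⟨K.toNNReal, fun n b hb g hg => ?_⟩
  rw [ENNReal.coe_toNNReal hKt]
  set M : E → ℝ≥0∞ := fun x => ⨆ k, gaussAvg (b k) g x
  have hM : Measurable M := Measurable.iSup fun k => measurable_gaussAvg hg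
  have hMq : ∀ x, M x ^ q = ENNReal.ofReal q * ∫⁻ t in Ioi (0 : ℝ),
      {t : ℝ | ENNReal.ofReal t < M x}.indicator (fun t => ENNReal.ofReal (t ^ (q - 1))) t := by
    intro x
    rw [lintegral_indicator_lt_rpow _ hq0, ENNReal.mul_div_cancel (by simpa using hq0)
      ENNReal.ofReal_ne_top]
  have hm1 : Measurable fun z : E × ℝ => {t : ℝ | ENNReal.ofReal t < M z.1}.indicator
      (fun t => ENNReal.ofReal (t ^ (q - 1))) z.2 := by
    have : (fun z : E × ℝ => {t : ℝ | ENNReal.ofReal t < M z.1}.indicator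
        (fun t => ENNReal.ofReal (t ^ (q - 1))) z.2) =
        {z : E × ℝ | ENNReal.ofReal z.2 < M z.1}.indicator
          (fun z => ENNReal.ofReal (z.2 ^ (q - 1))) := rfl
    rw [this]
    exact Measurable.indicator (by fun_prop) (measurableSet_lt (by fun_prop) (by fun_prop))
  have hm2 : Measurable fun z : E × ℝ => {t : ℝ | ENNReal.ofReal t < 2 * g z.1}.indicator
      (fun t => ENNReal.ofReal (t ^ (q - 1 - 1))) z.2 := by
    have : (fun z : E × ℝ => {t : ℝ | ENNReal.ofReal t < 2 * g z.1}.indicator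
        (fun t => ENNReal.ofReal (t ^ (q - 1 - 1))) z.2) =
        {z : E × ℝ | ENNReal.ofReal z.2 < 2 * g z.1}.indicator
          (fun z => ENNReal.ofReal (z.2 ^ (q - 1 - 1))) := rfl
    rw [this]
    exact Measurable.indicator (by fun_prop) (measurableSet_lt (by fun_prop) (by fun_prop))
  -- The weak type bound costs one power of `t`. The remaining `t^(q-2)` is integrable at 0 since `q
  -- > 1`, and integrating in `t` first turns it into `(2 g)^(q-1)`.
  have step : ∀ t ∈ Ioi (0 : ℝ), ∫⁻ x, {t : ℝ | ENNReal.ofReal t < M x}.indicator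
        (fun t => ENNReal.ofReal (t ^ (q - 1))) t ≤
      (4 ^ Module.finrank ℝ E * 2) * ∫⁻ x, g x * {t : ℝ | ENNReal.ofReal t < 2 * g x}.indicator
        (fun t => ENNReal.ofReal (t ^ (q - 1 - 1))) t := by
    intro t ht
    have ht : 0 < t := ht
    have e1 : ∀ x, {t : ℝ | ENNReal.ofReal t < M x}.indicator
        (fun t => ENNReal.ofReal (t ^ (q - 1))) t =
        {x | ENNReal.ofReal t < M x}.indicator (fun _ => ENNReal.ofReal (t ^ (q - 1))) x :=
      fun x => rfl
    have e2 : ∀ x, g x * {t : ℝ | ENNReal.ofReal t < 2 * g x}.indicator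
        (fun t => ENNReal.ofReal (t ^ (q - 1 - 1))) t = ENNReal.ofReal (t ^ (q - 1 - 1)) *
        {x | ENNReal.ofReal t < 2 * g x}.indicator g x := by
      intro x
      by_cases hx : ENNReal.ofReal t < 2 * g x
      · rw [indicator_of_mem (show t ∈ {t : ℝ | ENNReal.ofReal t < 2 * g x} from hx),
          indicator_of_mem (show x ∈ {x | ENNReal.ofReal t < 2 * g x} from hx), mul_comm]
      · rw [indicator_of_notMem (show t ∉ {t : ℝ | ENNReal.ofReal t < 2 * g x} from hx),
          indicator_of_notMem (show x ∉ {x | ENNReal.ofReal t < 2 * g x} from hx)]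
        simp
    simp_rw [e1, e2]
    rw [lintegral_indicator (measurableSet_lt measurable_const hM), setLIntegral_const,
      lintegral_const_mul _ (hg.indicator (measurableSet_lt measurable_const (by fun_prop)))]
    have e3 : ENNReal.ofReal (t ^ (q - 1)) =
        ENNReal.ofReal t * ENNReal.ofReal (t ^ (q - 1 - 1)) := by
      rw [← ENNReal.ofReal_mul ht.le, ← Real.rpow_one_add' ht.le (by linarith)]
      congr 2; ring
    rw [e3]
    calc _ ≤ ENNReal.ofReal t * ENNReal.ofReal (t ^ (q - 1 - 1)) *
          (4 ^ Module.finrank ℝ E * (2 * (ENNReal.ofReal t)⁻¹) *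
        ∫⁻ x, {x | ENNReal.ofReal t < 2 * g x}.indicator g x) := by
          gcongr
          exact volume_lt_iSup_gaussAvg_le hb hg ht
      _ = (ENNReal.ofReal t * (ENNReal.ofReal t)⁻¹) * ((4 ^ Module.finrank ℝ E * 2) *
          (ENNReal.ofReal (t ^ (q - 1 - 1)) *
          ∫⁻ x, {x | ENNReal.ofReal t < 2 * g x}.indicator g x)) := by ring
      _ = _ := by
          rw [ENNReal.mul_inv_cancel (by simpa using ht) ENNReal.ofReal_ne_top, one_mul]
  have hm3 : Measurable fun z : ℝ × E => g z.2 *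
      {t : ℝ | ENNReal.ofReal t < 2 * g z.2}.indicator
        (fun t => ENNReal.ofReal (t ^ (q - 1 - 1))) z.1 :=
    (hg.comp measurable_snd).mul (hm2.comp measurable_swap)
  calc ∫⁻ x, M x ^ q = ENNReal.ofReal q * ∫⁻ t in Ioi (0 : ℝ), ∫⁻ x,
        {t : ℝ | ENNReal.ofReal t < M x}.indicator (fun t => ENNReal.ofReal (t ^ (q - 1))) t := by
        simp_rw [hMq]
        rw [lintegral_const_mul _ hm1.lintegral_prod_right',
          lintegral_lintegral_swap hm1.aemeasurable]
    _ ≤ ENNReal.ofReal q * ∫⁻ t in Ioi (0 : ℝ), (4 ^ Module.finrank ℝ E * 2) *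
        ∫⁻ x, g x * {t : ℝ | ENNReal.ofReal t < 2 * g x}.indicator
        (fun t => ENNReal.ofReal (t ^ (q - 1 - 1))) t := by
        gcongr 1
        exact setLIntegral_mono' measurableSet_Ioi step
    _ = ENNReal.ofReal q * ((4 ^ Module.finrank ℝ E * 2) * ∫⁻ x, g x *
        ((2 * g x) ^ (q - 1) / ENNReal.ofReal (q - 1))) := by
        rw [lintegral_const_mul _ hm3.lintegral_prod_right',
          lintegral_lintegral_swap hm3.aemeasurable]
        congr 3; ext x
        simp only
        rw [← lintegral_indicator_lt_rpow _ hq1, lintegral_const_mul]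
        exact hm2.comp measurable_prodMk_left
    _ = _ := by
        have e4 : ∀ x, g x * ((2 * g x) ^ (q - 1) / ENNReal.ofReal (q - 1)) =
            (2 : ℝ≥0∞) ^ (q - 1) / ENNReal.ofReal (q - 1) * g x ^ q := by
          intro x
          have : g x ^ q = g x * g x ^ (q - 1) := by
            conv_rhs => rw [← ENNReal.rpow_one (g x), ← ENNReal.rpow_mul, one_mul]
            rw [← ENNReal.rpow_add_of_nonneg _ _ zero_le_one hq1.le]
            congr 1; ring
          rw [ENNReal.mul_rpow_of_nonneg _ _ hq1.le, this, div_eq_mul_inv, div_eq_mul_inv]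
          ring
        simp_rw [e4]
        rw [lintegral_const_mul _ (by fun_prop), hK]
        ring

theorem sum_rpow_le_sum_mul_rpow {n : ℕ} (c : Fin n → ℝ≥0∞) {r : ℝ} (hr : 0 < r) :
    (∑ k, c k) ^ r ≤ ∑ k, (n * c k) ^ r := by
  rcases isEmpty_or_nonempty (Fin n) with h | h
  · simp [hr]
  obtain ⟨j, -, hj⟩ := Finset.exists_max_image Finset.univ c Finset.univ_nonempty
  calc _ ≤ (n * c j) ^ r := by
        gcongr
        simpa using Finset.sum_le_card_nsmul Finset.univ c (c j) fun k hk => hj k hk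
    _ ≤ _ := Finset.single_le_sum (f := fun k => (n * c k) ^ r) (fun _ _ => zero_le)
        (Finset.mem_univ j)

/-- Only qualitative: the implied bound grows with `n`, but finiteness is what permits division in
the self-improving estimates for the square function. -/
theorem lintegral_sum_sq_gaussAvg_ne_top {p : ℝ} (hp : 1 < p) {n : ℕ} {b : Fin n → ℝ}
    (hb : ∀ k, 0 < b k) {F : Fin n → E → ℝ≥0∞} (hF : ∀ k, Measurable (F k))
    (hfin : ∫⁻ x, (∑ k, F k x ^ 2) ^ (p / 2) ≠ ∞) :
    ∫⁻ x, (∑ k, gaussAvg (b k) (F k) x ^ 2) ^ (p / 2) ≠ ∞ := by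
  have e : ∀ a : ℝ≥0∞, (a ^ 2) ^ (p / 2) = a ^ p := by
    intro a
    rw [← ENNReal.rpow_natCast, ← ENNReal.rpow_mul]; congr 1; push_cast; ring
  have hk : ∀ k, ∫⁻ x, F k x ^ p ≠ ∞ := by
    intro k
    refine ne_top_of_le_ne_top hfin (lintegral_mono fun x => ?_)
    rw [← e]
    gcongr
    exact Finset.single_le_sum (f := fun k => F k x ^ 2) (fun _ _ => zero_le) (Finset.mem_univ k)
  have h1 : ∫⁻ x, (∑ k, gaussAvg (b k) (F k) x ^ 2) ^ (p / 2) ≤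
      ∑ k, (n : ℝ≥0∞) ^ (p / 2) * ∫⁻ x, gaussAvg (b k) (F k) x ^ p := by
    have hm : ∀ k, Measurable (gaussAvg (b k) (F k)) := fun k => measurable_gaussAvg (hF k)
    calc _ ≤ ∫⁻ x, ∑ k, (n : ℝ≥0∞) ^ (p / 2) * gaussAvg (b k) (F k) x ^ p := by
          refine lintegral_mono fun x => (sum_rpow_le_sum_mul_rpow _ (by linarith)).trans ?_
          refine Finset.sum_le_sum fun k _ => ?_
          rw [ENNReal.mul_rpow_of_nonneg _ _ (by linarith), e]
      _ = _ := by
          rw [lintegral_finsetSum _ fun k _ => by fun_prop]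
          refine Finset.sum_congr rfl fun k _ => ?_
          rw [lintegral_const_mul _ (by fun_prop)]
  refine ne_top_of_le_ne_top (ENNReal.sum_ne_top.2 fun k _ => ?_) h1
  refine ENNReal.mul_ne_top (ENNReal.rpow_ne_top_of_nonneg (by linarith) (by simp)) ?_
  exact ne_top_of_le_ne_top (hk k) (lintegral_gaussAvg_rpow_le (hb k) hp.le (hF k))

/-- Dividing by `D^(1/s)` leaves `D^(1/r) ≤ K`; without `D ≠ ∞` this would be false. -/
theorem le_rpow_of_le_mul_rpow {D K : ℝ≥0∞} {r s : ℝ} (hrs : r.HolderConjugate s) (hD : D ≠ ∞)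
    (h : D ≤ K * D ^ (1 / s)) : D ≤ K ^ r := by
  rcases eq_or_ne D 0 with rfl | h0
  · exact zero_le
  have hr := hrs.pos
  have h1 : D ^ (1 / r) ≤ K := by
    have e : D = D ^ (1 / r) * D ^ (1 / s) := by
      rw [← ENNReal.rpow_add _ _ h0 hD, one_div, one_div, hrs.inv_add_inv_eq_one,
        ENNReal.rpow_one]
    rw [e, ← e] at h
    nth_rw 1 [e] at h
    have hs0 : D ^ (1 / s) ≠ 0 := by simp [h0, hD]
    have hst : D ^ (1 / s) ≠ ∞ := by simp [h0, hD]
    exact (ENNReal.mul_le_mul_iff_left hs0 hst).1 h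
  calc D = (D ^ (1 / r)) ^ r := by
        rw [← ENNReal.rpow_mul, one_div_mul_cancel hr.ne', ENNReal.rpow_one]
    _ ≤ K ^ r := by gcongr

end Maximal

/-! ### Square function estimates for Gaussian averages. -/

section SquareGauss

open scoped NNReal

variable {E : Type*} [NormedAddCommGroup E] [InnerProductSpace ℝ E] [FiniteDimensional ℝ E]
  [MeasurableSpace E] [BorelSpace E]

variable (E) in
-- With `Q` the sum of squared averages and `r = p/2`, the weight `W = Q^(r-1)` satisfies `W^s =
-- Q^r` for the conjugate exponent `s`. Jensen, symmetry of the averages and the maximal inequality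
-- in `L^s` then bound `∫ Q^r` by a constant times its own power `1/s`.
theorem exists_lintegral_sum_sq_gaussAvg_le_of_two_lt {p : ℝ} (hp : 2 < p) :
    ∃ C : ℝ≥0, ∀ (n : ℕ) (b : Fin n → ℝ) (_ : ∀ k, 0 < b k) (F : Fin n → E → ℝ≥0∞)
      (_ : ∀ k, Measurable (F k)), ∫⁻ x, (∑ k, F k x ^ 2) ^ (p / 2) ≠ ∞ →
      ∫⁻ x, (∑ k, gaussAvg (b k) (F k) x ^ 2) ^ (p / 2) ≤
        C * ∫⁻ x, (∑ k, F k x ^ 2) ^ (p / 2) := by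
  set r := p / 2 with hr
  have hr1 : 1 < r := by rw [hr]; linarith
  have hr0 : 0 < r := by linarith
  have hrs := Real.HolderConjugate.conjExponent hr1
  set s := Real.conjExponent r
  have hs0 := hrs.symm.pos
  obtain ⟨C, hC⟩ := exists_lintegral_iSup_gaussAvg_le E hrs.symm.lt
  refine ⟨(C ^ (1 / s)) ^ r, fun n b hb F hF hfin => ?_⟩
  have hm : ∀ k, Measurable (gaussAvg (b k) (F k)) := fun k => measurable_gaussAvg (hF k)
  set Q : E → ℝ≥0∞ := fun x => ∑ k, gaussAvg (b k) (F k) x ^ 2 with hQ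
  have hQm : Measurable Q := by fun_prop
  set W : E → ℝ≥0∞ := fun x => Q x ^ (r - 1) with hW
  have hWm : Measurable W := by fun_prop
  have hD : ∫⁻ x, Q x ^ r ≠ ∞ := lintegral_sum_sq_gaussAvg_ne_top (by linarith) hb hF hfin
  have hWs : ∀ x, W x ^ s = Q x ^ r := by
    intro x
    rw [hW, ← ENNReal.rpow_mul, hrs.sub_one_mul_conj]
  have hsq : ∀ k x, gaussAvg (b k) (F k) x ^ 2 ≤ gaussAvg (b k) (fun y => F k y ^ 2) x := by
    intro k x
    have := gaussAvg_rpow_le (hb k) (r := 2) (by norm_num) (hF k) x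
    simpa using this
  have key : ∫⁻ x, Q x ^ r ≤ ((∫⁻ x, (∑ k, F k x ^ 2) ^ r) ^ (1 / r) * C ^ (1 / s)) *
      (∫⁻ x, Q x ^ r) ^ (1 / s) := by
    calc ∫⁻ x, Q x ^ r = ∫⁻ x, ∑ k, gaussAvg (b k) (F k) x ^ 2 * W x := by
          refine lintegral_congr fun x => ?_
          rw [← Finset.sum_mul]
          calc Q x ^ r = Q x ^ (1 + (r - 1)) := by congr 1; ring
            _ = _ := by
              rw [ENNReal.rpow_add_of_nonneg _ _ zero_le_one (by linarith), ENNReal.rpow_one]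
      _ ≤ ∫⁻ x, ∑ k, gaussAvg (b k) (fun y => F k y ^ 2) x * W x := by
          gcongr with x k
          exact hsq k x
      _ = ∑ k, ∫⁻ x, F k x ^ 2 * gaussAvg (b k) W x := by
          have hm' : ∀ k, Measurable fun x => gaussAvg (b k) (fun y => F k y ^ 2) x * W x :=
            fun k => (measurable_gaussAvg (by fun_prop)).mul hWm
          rw [lintegral_finsetSum _ fun k _ => hm' k]
          exact Finset.sum_congr rfl fun k _ => lintegral_gaussAvg_mul (by fun_prop) hWm
      _ ≤ ∫⁻ x, (∑ k, F k x ^ 2) * ⨆ k, gaussAvg (b k) W x := by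
          rw [← lintegral_finsetSum _ fun k _ => by fun_prop]
          refine lintegral_mono fun x => ?_
          rw [Finset.sum_mul]
          gcongr with k
          exact le_iSup (fun k => gaussAvg (b k) W x) k
      _ ≤ (∫⁻ x, (∑ k, F k x ^ 2) ^ r) ^ (1 / r) *
          (∫⁻ x, (⨆ k, gaussAvg (b k) W x) ^ s) ^ (1 / s) :=
          ENNReal.lintegral_mul_le_Lp_mul_Lq _ hrs (by fun_prop)
            (Measurable.iSup fun k => measurable_gaussAvg hWm).aemeasurable
      _ ≤ (∫⁻ x, (∑ k, F k x ^ 2) ^ r) ^ (1 / r) *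
          (C * ∫⁻ x, W x ^ s) ^ (1 / s) := by
          gcongr
          exact hC n b hb W hWm
      _ = _ := by
          simp_rw [hWs]
          rw [ENNReal.mul_rpow_of_nonneg _ _ (by positivity), mul_assoc]
  refine (le_rpow_of_le_mul_rpow hrs hD key).trans (le_of_eq ?_)
  rw [ENNReal.mul_rpow_of_nonneg _ _ hr0.le, ← ENNReal.rpow_mul, one_div_mul_cancel hr0.ne',
    ENNReal.rpow_one, mul_comm, ENNReal.coe_rpow_of_nonneg _ hr0.le,
    ENNReal.coe_rpow_of_nonneg _ (by positivity)]

variable (E) in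
-- Duality with the conjugate exponent `q > 2`: the averages are symmetric, and `H k = gaussAvg (b
-- k) (F k) * Q^(p/2-1)` is the extremal function in the pairing, up to normalisation.
theorem exists_lintegral_sum_sq_gaussAvg_le_of_lt_two {p : ℝ} (hp1 : 1 < p) (hp : p < 2) :
    ∃ C : ℝ≥0, ∀ (n : ℕ) (b : Fin n → ℝ) (_ : ∀ k, 0 < b k) (F : Fin n → E → ℝ≥0∞)
      (_ : ∀ k, Measurable (F k)), ∫⁻ x, (∑ k, F k x ^ 2) ^ (p / 2) ≠ ∞ →
      ∫⁻ x, (∑ k, gaussAvg (b k) (F k) x ^ 2) ^ (p / 2) ≤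
        C * ∫⁻ x, (∑ k, F k x ^ 2) ^ (p / 2) := by
  have hp0 : 0 < p := by linarith
  have hpq := Real.HolderConjugate.conjExponent hp1
  set q := Real.conjExponent p
  have hq0 := hpq.symm.pos
  have hq2 : 2 < q := by
    have h1 := hpq.inv_add_inv_eq_one
    have h2 : (2 : ℝ)⁻¹ < p⁻¹ := by gcongr
    by_contra! hc
    have : (2 : ℝ)⁻¹ ≤ q⁻¹ := by gcongr
    linarith [show (2 : ℝ)⁻¹ + 2⁻¹ = 1 by norm_num]
  obtain ⟨C, hC⟩ := exists_lintegral_sum_sq_gaussAvg_le_of_two_lt E hq2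
  refine ⟨(C ^ (1 / q)) ^ p, fun n b hb F hF hfin => ?_⟩
  have hm : ∀ k, Measurable (gaussAvg (b k) (F k)) := fun k => measurable_gaussAvg (hF k)
  set Q : E → ℝ≥0∞ := fun x => ∑ k, gaussAvg (b k) (F k) x ^ 2 with hQ
  have hQm : Measurable Q := by fun_prop
  have hD : ∫⁻ x, Q x ^ (p / 2) ≠ ∞ := lintegral_sum_sq_gaussAvg_ne_top hp1 hb hF hfin
  set H : Fin n → E → ℝ≥0∞ := fun k x => gaussAvg (b k) (F k) x * Q x ^ (p / 2 - 1) with hH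
  have hHm : ∀ k, Measurable (H k) := fun k => by fun_prop
  have hHq : ∀ x, (∑ k, H k x ^ 2) ^ (q / 2) ≤ Q x ^ (p / 2) := by
    intro x
    have e1 : ∑ k, H k x ^ 2 = Q x * Q x ^ (p - 2) := by
      simp_rw [hH, mul_pow, ← Finset.sum_mul]
      congr 1
      rw [← ENNReal.rpow_natCast, ← ENNReal.rpow_mul]; congr 1; push_cast; ring
    -- The exponent `p - 2` is negative, so the values 0 and `∞` of `Q` need separate treatment;
    -- there the left side vanishes.
    have e2 : Q x * Q x ^ (p - 2) ≤ Q x ^ (p - 1) := by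
      rcases eq_or_ne (Q x) 0 with h | h
      · rw [h, zero_mul]; exact zero_le
      rcases eq_or_ne (Q x) ∞ with h' | h'
      · rw [h', ENNReal.top_rpow_of_neg (by linarith), mul_zero]; exact zero_le
      · refine le_of_eq ?_
        calc _ = Q x ^ (1 : ℝ) * Q x ^ (p - 2) := by rw [ENNReal.rpow_one]
          _ = _ := by rw [← ENNReal.rpow_add _ _ h h']; congr 1; ring
    rw [e1]
    calc _ ≤ (Q x ^ (p - 1)) ^ (q / 2) := by gcongr
      _ = _ := by
        have := hpq.sub_one_mul_conj
        rw [← ENNReal.rpow_mul]; congr 1; linarith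
  have hHint : ∫⁻ x, (∑ k, H k x ^ 2) ^ (q / 2) ≤ ∫⁻ x, Q x ^ (p / 2) := lintegral_mono hHq
  have hPH := hC n b hb H hHm (ne_top_of_le_ne_top hD hHint)
  have hQfin : ∀ᵐ x, Q x ^ (p / 2) < ∞ := ae_lt_top (by fun_prop) hD
  have e : ∀ a : ℝ≥0∞, ∀ u : ℝ, (a ^ (1 / 2 : ℝ)) ^ u = a ^ (u / 2) := by
    intro a u
    rw [← ENNReal.rpow_mul]; congr 1; ring
  have key : ∫⁻ x, Q x ^ (p / 2) ≤
      ((∫⁻ x, (∑ k, F k x ^ 2) ^ (p / 2)) ^ (1 / p) * C ^ (1 / q)) *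
      (∫⁻ x, Q x ^ (p / 2)) ^ (1 / q) := by
    calc ∫⁻ x, Q x ^ (p / 2) ≤ ∫⁻ x, ∑ k, gaussAvg (b k) (F k) x * H k x := by
          refine lintegral_mono_ae ?_
          filter_upwards [hQfin] with x hx
          have hx' : Q x ≠ ∞ := by
            rintro h
            rw [h, ENNReal.top_rpow_of_pos (by linarith)] at hx
            exact hx.ne rfl
          simp_rw [hH, ← mul_assoc, ← sq, ← Finset.sum_mul]
          rcases eq_or_ne (Q x) 0 with h | h
          · rw [h, ENNReal.zero_rpow_of_pos (by linarith)]; exact zero_le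
          · refine le_of_eq ?_
            calc Q x ^ (p / 2) = Q x ^ (1 : ℝ) * Q x ^ (p / 2 - 1) := by
                  rw [← ENNReal.rpow_add _ _ h hx']; congr 1; ring
              _ = _ := by rw [ENNReal.rpow_one]
      _ = ∫⁻ x, ∑ k, F k x * gaussAvg (b k) (H k) x := by
          have hm' : ∀ k, Measurable fun x => F k x * gaussAvg (b k) (H k) x :=
            fun k => (hF k).mul (measurable_gaussAvg (hHm k))
          rw [lintegral_finsetSum _ fun k _ => by fun_prop, lintegral_finsetSum _ fun k _ => hm' k]
          exact Finset.sum_congr rfl fun k _ => lintegral_gaussAvg_mul (hF k) (hHm k)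
      _ ≤ ∫⁻ x, (∑ k, F k x ^ 2) ^ (1 / 2 : ℝ) *
            (∑ k, gaussAvg (b k) (H k) x ^ 2) ^ (1 / 2 : ℝ) := by
          refine lintegral_mono fun x => ?_
          have := ENNReal.inner_le_Lp_mul_Lq Finset.univ (fun k => F k x)
            (fun k => gaussAvg (b k) (H k) x) (Real.HolderConjugate.two_two)
          simpa using this
      _ ≤ (∫⁻ x, ((∑ k, F k x ^ 2) ^ (1 / 2 : ℝ)) ^ p) ^ (1 / p) *
          (∫⁻ x, ((∑ k, gaussAvg (b k) (H k) x ^ 2) ^ (1 / 2 : ℝ)) ^ q) ^ (1 / q) :=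
          ENNReal.lintegral_mul_le_Lp_mul_Lq _ hpq (by fun_prop)
            ((Finset.measurable_fun_sum _ fun k _ =>
              (measurable_gaussAvg (hHm k)).pow_const 2).pow_const _).aemeasurable
      _ ≤ (∫⁻ x, (∑ k, F k x ^ 2) ^ (p / 2)) ^ (1 / p) *
          (C * ∫⁻ x, Q x ^ (p / 2)) ^ (1 / q) := by
          simp_rw [e]
          gcongr
          exact hPH.trans (by gcongr)
      _ = _ := by
          rw [ENNReal.mul_rpow_of_nonneg _ _ (by positivity), mul_assoc]
  refine (le_rpow_of_le_mul_rpow hpq hD key).trans (le_of_eq ?_)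
  rw [ENNReal.mul_rpow_of_nonneg _ _ hp0.le, ← ENNReal.rpow_mul, one_div_mul_cancel hp0.ne',
    ENNReal.rpow_one, mul_comm, ENNReal.coe_rpow_of_nonneg _ hp0.le,
    ENNReal.coe_rpow_of_nonneg _ (by positivity)]

variable (E) in
/-- The square function estimate for Gaussian averages on `L^p`, `1 < p < ∞`. -/
theorem exists_lintegral_sum_sq_gaussAvg_le {p : ℝ} (hp1 : 1 < p) :
    ∃ C : ℝ≥0, ∀ (n : ℕ) (b : Fin n → ℝ) (_ : ∀ k, 0 < b k) (F : Fin n → E → ℝ≥0∞)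
      (_ : ∀ k, Measurable (F k)), ∫⁻ x, (∑ k, F k x ^ 2) ^ (p / 2) ≠ ∞ →
      ∫⁻ x, (∑ k, gaussAvg (b k) (F k) x ^ 2) ^ (p / 2) ≤
        C * ∫⁻ x, (∑ k, F k x ^ 2) ^ (p / 2) := by
  rcases lt_trichotomy p 2 with h | rfl | h
  · exact exists_lintegral_sum_sq_gaussAvg_le_of_lt_two E hp1 h
  · refine ⟨1, fun n b hb F hF _ => ?_⟩
    have hm : ∀ k, Measurable (gaussAvg (b k) (F k)) := fun k => measurable_gaussAvg (hF k)
    simp only [div_self (two_ne_zero' ℝ), ENNReal.rpow_one, ENNReal.coe_one, one_mul]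
    rw [lintegral_finsetSum _ fun k _ => by fun_prop, lintegral_finsetSum _ fun k _ => by fun_prop]
    refine Finset.sum_le_sum fun k _ => ?_
    have := lintegral_gaussAvg_rpow_le (hb k) (r := 2) (by norm_num) (hF k)
    simpa using this
  · exact exists_lintegral_sum_sq_gaussAvg_le_of_two_lt E h

end SquareGauss

/-! ### Operators dominated by Gaussian averages. -/

section GaussDomination

open scoped NNReal
open Metric

variable {E : Type*} [NormedAddCommGroup E] [InnerProductSpace ℝ E] [FiniteDimensional ℝ E]
  [MeasurableSpace E] [BorelSpace E] {Ω : Set E} {p : ℝ≥0∞}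

/-- The modulus of `f`, extended by zero. -/
def absExt (f : Lp ℂ p (volume.restrict Ω)) : E → ℝ≥0∞ := Ω.indicator fun y => ‖f y‖ₑ

theorem measurable_absExt (hΩ : MeasurableSet Ω) (f : Lp ℂ p (volume.restrict Ω)) :
    Measurable (absExt f) :=
  (Lp.stronglyMeasurable f).enorm.indicator hΩ

theorem lintegral_gauss_mul_absExt (hΩ : MeasurableSet Ω) (b : ℝ) (x : E)
    (f : Lp ℂ p (volume.restrict Ω)) :
    ∫⁻ y, gauss b (x - y) * absExt f y = ∫⁻ y in Ω, gauss b (x - y) * ‖f y‖ₑ := by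
  rw [← lintegral_indicator hΩ]
  refine lintegral_congr fun y => ?_
  by_cases hy : y ∈ Ω <;> simp [absExt, hy]

theorem lintegral_absExt (hΩ : MeasurableSet Ω) (f : Lp ℂ p (volume.restrict Ω)) :
    ∫⁻ y, absExt f y = ∫⁻ y in Ω, ‖f y‖ₑ := lintegral_indicator hΩ _

variable [Fact (1 ≤ p)]

theorem lintegral_absExt_rpow (hΩ : MeasurableSet Ω) (hp : p ≠ ∞)
    (f : Lp ℂ p (volume.restrict Ω)) :
    ∫⁻ y, absExt f y ^ p.toReal = ‖f‖ₑ ^ p.toReal := by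
  have hr : 0 < p.toReal :=
    ENNReal.toReal_pos (lt_of_lt_of_le one_pos Fact.out).ne' hp
  rw [enorm_rpow_toReal hp, ← lintegral_indicator hΩ]
  refine lintegral_congr fun y => ?_
  by_cases hy : y ∈ Ω <;> simp [absExt, hy, hr]

/-- `B` is dominated by `K` times the Gaussian average of parameter `b`. -/
def GaussDom (K : ℝ≥0) (b : ℝ)
    (B : Lp ℂ p (volume.restrict Ω) →L[ℂ] Lp ℂ p (volume.restrict Ω)) : Prop :=
  ∀ f, ∀ᵐ x ∂volume.restrict Ω, ‖B f x‖ₑ ≤ K * gaussAvg b (absExt f) x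

variable {K : ℝ≥0} {b : ℝ} {B : Lp ℂ p (volume.restrict Ω) →L[ℂ] Lp ℂ p (volume.restrict Ω)}

theorem GaussDom.smul (h : GaussDom K b B) {c : ℂ} {M : ℝ≥0} (hc : ‖c‖ ≤ M) :
    GaussDom (M * K) b (c • B) := by
  intro f
  filter_upwards [h f, Lp.coeFn_smul c (B f)] with x hx h2
  rw [smul_apply, h2, Pi.smul_apply, enorm_smul, ENNReal.coe_mul, mul_assoc]
  gcongr
  exact ENNReal.coe_le_coe.2 hc

theorem toReal_one_le (hp : p ≠ ∞) : 1 ≤ p.toReal := by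
  rw [← ENNReal.toReal_one]; exact ENNReal.toReal_mono hp Fact.out

theorem GaussDom.enorm_le (h : GaussDom K b B) (hΩ : MeasurableSet Ω) (hp : p ≠ ∞) (hb : 0 < b)
    (f : Lp ℂ p (volume.restrict Ω)) : ‖B f‖ₑ ≤ K * ‖f‖ₑ := by
  have hr1 : 1 ≤ p.toReal := toReal_one_le hp
  have hr : 0 < p.toReal := by linarith
  have hm := measurable_gaussAvg (b := b) (measurable_absExt hΩ f)
  rw [← ENNReal.rpow_le_rpow_iff hr, enorm_rpow_toReal hp,
    ENNReal.mul_rpow_of_nonneg _ _ hr.le, ← lintegral_absExt_rpow hΩ hp]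
  calc _ ≤ ∫⁻ x in Ω, (K : ℝ≥0∞) ^ p.toReal * gaussAvg b (absExt f) x ^ p.toReal := by
        refine lintegral_mono_ae ((h f).mono fun x hx => ?_)
        rw [← ENNReal.mul_rpow_of_nonneg _ _ hr.le]
        gcongr
    _ ≤ ∫⁻ x, (K : ℝ≥0∞) ^ p.toReal * gaussAvg b (absExt f) x ^ p.toReal :=
        setLIntegral_le_lintegral _ _
    _ = (K : ℝ≥0∞) ^ p.toReal * ∫⁻ x, gaussAvg b (absExt f) x ^ p.toReal :=
        lintegral_const_mul _ (hm.pow_const _)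
    _ ≤ _ := by
        refine mul_le_mul' le_rfl ?_
        exact lintegral_gaussAvg_rpow_le hb hr1 (measurable_absExt hΩ f)

theorem GaussDom.norm_le (h : GaussDom K b B) (hΩ : MeasurableSet Ω) (hp : p ≠ ∞) (hb : 0 < b) :
    ‖B‖ ≤ K := by
  refine ContinuousLinearMap.opNorm_le_bound _ K.2 fun f => ?_
  have := h.enorm_le hΩ hp hb f
  rw [← ofReal_norm, ← ofReal_norm, ← ENNReal.ofReal_coe_nnreal,
    ← ENNReal.ofReal_mul K.coe_nonneg, ENNReal.ofReal_le_ofReal_iff (by positivity)] at this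
  exact this

/-- Gaussian domination gives a bound from `L^p` to `L^∞`. -/
theorem GaussDom.enorm_apply_le (h : GaussDom K b B) (hΩ : MeasurableSet Ω) (hp : p ≠ ∞)
    (hb : 0 < b) (f : Lp ℂ p (volume.restrict Ω)) :
    ∀ᵐ x ∂volume.restrict Ω, ‖B f x‖ₑ ≤ K * gaussMass E b ^ (-(1 / p.toReal)) * ‖f‖ₑ := by
  have hr1 : 1 ≤ p.toReal := toReal_one_le hp
  have hr : 0 < p.toReal := by linarith
  filter_upwards [h f] with x hx
  refine hx.trans ?_
  rw [mul_assoc]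
  gcongr
  rw [← ENNReal.rpow_le_rpow_iff hr]
  refine (gaussAvg_rpow_le hb hr1 (measurable_absExt hΩ f) x).trans ?_
  rw [ENNReal.mul_rpow_of_nonneg _ _ hr.le, ← ENNReal.rpow_mul, neg_mul,
    one_div_mul_cancel hr.ne', ENNReal.rpow_neg_one, ← lintegral_absExt_rpow hΩ hp]
  unfold gaussAvg
  gcongr with y
  exact mul_le_of_le_one_left zero_le (gauss_le_one hb _)

/-- Gaussian domination gives a bound from `L¹` to `L^p`. -/
theorem GaussDom.enorm_le_lintegral (h : GaussDom K b B) (hΩ : MeasurableSet Ω) (hp : p ≠ ∞)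
    (hb : 0 < b) (f : Lp ℂ p (volume.restrict Ω)) :
    ‖B f‖ₑ ≤ K * gaussMass E b ^ (1 / p.toReal - 1) * ∫⁻ y in Ω, ‖f y‖ₑ := by
  have hr1 : 1 ≤ p.toReal := toReal_one_le hp
  have hr : 0 < p.toReal := by linarith
  have hr' : 0 ≤ p.toReal - 1 := by linarith
  have hm := measurable_gaussAvg (b := b) (measurable_absExt hΩ f)
  have hm0 := gaussMass_ne_zero E hb
  have hm1 := gaussMass_ne_top E hb
  set J := ∫⁻ y in Ω, ‖f y‖ₑ with hJ
  have hbd : ∀ x, gaussAvg b (absExt f) x ≤ (gaussMass E b)⁻¹ * J := by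
    intro x
    rw [hJ, ← lintegral_absExt hΩ]
    unfold gaussAvg
    gcongr with y
    exact mul_le_of_le_one_left zero_le (gauss_le_one hb _)
  have esplit : ∀ a : ℝ≥0∞, a ^ p.toReal = a * a ^ (p.toReal - 1) := by
    intro a
    calc a ^ p.toReal = a ^ (1 + (p.toReal - 1)) := by congr 1; ring
      _ = _ := by rw [ENNReal.rpow_add_of_nonneg _ _ zero_le_one hr', ENNReal.rpow_one]
  rw [← ENNReal.rpow_le_rpow_iff hr, enorm_rpow_toReal hp,
    ENNReal.mul_rpow_of_nonneg _ _ hr.le, ENNReal.mul_rpow_of_nonneg _ _ hr.le]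
  calc _ ≤ ∫⁻ x in Ω, (K : ℝ≥0∞) ^ p.toReal * gaussAvg b (absExt f) x ^ p.toReal := by
        refine lintegral_mono_ae ((h f).mono fun x hx => ?_)
        rw [← ENNReal.mul_rpow_of_nonneg _ _ hr.le]
        gcongr
    _ ≤ ∫⁻ x, (K : ℝ≥0∞) ^ p.toReal * gaussAvg b (absExt f) x ^ p.toReal :=
        setLIntegral_le_lintegral _ _
    _ = (K : ℝ≥0∞) ^ p.toReal * ∫⁻ x, gaussAvg b (absExt f) x ^ p.toReal :=
        lintegral_const_mul _ (hm.pow_const _)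
    _ ≤ (K : ℝ≥0∞) ^ p.toReal * ∫⁻ x, gaussAvg b (absExt f) x *
          ((gaussMass E b)⁻¹ * J) ^ (p.toReal - 1) := by
        gcongr with x
        rw [esplit]
        gcongr
        exact hbd x
    _ = (K : ℝ≥0∞) ^ p.toReal * (J * ((gaussMass E b)⁻¹ * J) ^ (p.toReal - 1)) := by
        rw [lintegral_mul_const _ hm, lintegral_gaussAvg hb (measurable_absExt hΩ f),
          lintegral_absExt hΩ]
    _ = _ := by
        rw [ENNReal.mul_rpow_of_nonneg _ _ hr', esplit J, ENNReal.inv_rpow, ← ENNReal.rpow_neg,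
          ← ENNReal.rpow_mul]
        have : (1 / p.toReal - 1) * p.toReal = -(p.toReal - 1) := by field_simp; ring
        rw [this]; ring

/-- A bounded operator sandwiched between dominated operators maps `L¹` to `L^∞`. -/
theorem GaussDom.enorm_comp_comp_le {B' : Lp ℂ p (volume.restrict Ω) →L[ℂ] Lp ℂ p (volume.restrict Ω)}
    (h : GaussDom K b B) (h' : GaussDom K b B') (hΩ : MeasurableSet Ω) (hp : p ≠ ∞)
    (hb : 0 < b) (D : Lp ℂ p (volume.restrict Ω) →L[ℂ] Lp ℂ p (volume.restrict Ω)) {δ : ℝ≥0}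
    (hD : ‖D‖ ≤ δ) (f : Lp ℂ p (volume.restrict Ω)) :
    ∀ᵐ x ∂volume.restrict Ω, ‖B (D (B' f)) x‖ₑ ≤
      K ^ 2 * δ * ((gaussMass E b)⁻¹ * ∫⁻ y in Ω, ‖f y‖ₑ) := by
  have hm0 := gaussMass_ne_zero E hb
  have hm1 := gaussMass_ne_top E hb
  have hDf : ‖D (B' f)‖ₑ ≤ δ * ‖B' f‖ₑ := by
    have h1 : ‖D (B' f)‖₊ ≤ δ * ‖B' f‖₊ := (D.le_opNNNorm _).trans (by gcongr; exact hD)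
    rw [enorm_eq_nnnorm, enorm_eq_nnnorm]
    exact_mod_cast h1
  filter_upwards [h.enorm_apply_le hΩ hp hb (D (B' f))] with x hx
  calc _ ≤ _ := hx
    _ ≤ K * gaussMass E b ^ (-(1 / p.toReal)) * (δ * (K * gaussMass E b ^ (1 / p.toReal - 1) *
          ∫⁻ y in Ω, ‖f y‖ₑ)) := by
        gcongr
        exact hDf.trans (by gcongr; exact h'.enorm_le_lintegral hΩ hp hb f)
    _ = K ^ 2 * δ * ((gaussMass E b ^ (-(1 / p.toReal)) * gaussMass E b ^ (1 / p.toReal - 1)) *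
          ∫⁻ y in Ω, ‖f y‖ₑ) := by ring
    _ = _ := by
        -- The exponents of the mass from `L^p → L^∞` and from `L¹ → L^p` add up to `-1` whatever
        -- `p` is, which is the scaling of a kernel.
        rw [← ENNReal.rpow_add _ _ hm0 hm1]
        have : -(1 / p.toReal) + (1 / p.toReal - 1) = -1 := by ring
        rw [this, ENNReal.rpow_neg_one]

variable (Ω p) in
/-- The operators dominated by `K` times some Gaussian average. -/
def gaussClass (K : ℝ≥0) : Set (Lp ℂ p (volume.restrict Ω) →L[ℂ] Lp ℂ p (volume.restrict Ω)) :=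
  {B | ∃ b > 0, GaussDom K b B}

/-- Operators dominated by Gaussian averages are `𝓡`-bounded. -/
theorem isRBounded_gaussClass (hΩ : MeasurableSet Ω) (hp1 : 1 < p) (hp : p ≠ ∞) (K : ℝ≥0) :
    IsRBounded (gaussClass Ω p K) := by
  have hr1 : 1 < p.toReal := by
    rw [← ENNReal.toReal_one]; exact (ENNReal.toReal_lt_toReal (by simp) hp).2 hp1
  have hr : 0 < p.toReal := by linarith
  obtain ⟨C₁, hC₁⟩ := exists_rademacherMean_le_sqNorm hp (volume.restrict Ω)
  obtain ⟨C₂, hC₂⟩ := exists_sqNorm_le_rademacherMean hp (volume.restrict Ω)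
  obtain ⟨C₃, hC₃⟩ := exists_lintegral_sum_sq_gaussAvg_le E hr1
  refine ⟨C₁ * (K * C₃ ^ (1 / p.toReal) * C₂), by positivity, fun n T x hT => ?_⟩
  choose b hb hdom using hT
  have hm : ∀ k, Measurable (gaussAvg (b k) (absExt (x k))) :=
    fun k => measurable_gaussAvg (measurable_absExt hΩ (x k))
  have hint : ∫⁻ y, (∑ k, absExt (x k) y ^ 2) ^ (p.toReal / 2) =
      ∫⁻ y in Ω, (∑ k, ‖x k y‖ₑ ^ 2) ^ (p.toReal / 2) := by
    rw [← lintegral_indicator hΩ]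
    refine lintegral_congr fun y => ?_
    by_cases hy : y ∈ Ω <;> simp [absExt, hy, hr]
  have hlow := hC₂ n x
  -- The lower Khintchine bound controls this integral by the finite Rademacher mean of the given
  -- `L^p` functions.
  have hfin : ∫⁻ y, (∑ k, absExt (x k) y ^ 2) ^ (p.toReal / 2) ≠ ∞ := by
    intro hc
    rw [sqNorm, ← hint, hc, ENNReal.top_rpow_of_pos (by positivity), top_le_iff] at hlow
    exact ENNReal.mul_ne_top ENNReal.coe_ne_top ENNReal.ofReal_ne_top hlow
  have hsq : sqNorm p (volume.restrict Ω) (fun k y => ‖T k (x k) y‖ₑ) ≤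
      K * C₃ ^ (1 / p.toReal) * sqNorm p (volume.restrict Ω) (fun k y => ‖x k y‖ₑ) := by
    rw [sqNorm, ← ENNReal.rpow_le_rpow_iff hr, ENNReal.mul_rpow_of_nonneg _ _ hr.le,
      ENNReal.mul_rpow_of_nonneg _ _ hr.le, sqNorm, ← ENNReal.rpow_mul, ← ENNReal.rpow_mul,
      ← ENNReal.rpow_mul, one_div_mul_cancel hr.ne', ENNReal.rpow_one, ENNReal.rpow_one,
      ENNReal.rpow_one, mul_assoc, ← hint]
    calc _ ≤ ∫⁻ y in Ω, (K : ℝ≥0∞) ^ p.toReal *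
          (∑ k, gaussAvg (b k) (absExt (x k)) y ^ 2) ^ (p.toReal / 2) := by
          refine lintegral_mono_ae ?_
          filter_upwards [eventually_all.2 fun k => hdom k (x k)] with y hy
          have e : (K : ℝ≥0∞) ^ p.toReal = ((K : ℝ≥0∞) ^ 2) ^ (p.toReal / 2) := by
            rw [← ENNReal.rpow_natCast, ← ENNReal.rpow_mul]; congr 1; push_cast; ring
          rw [e, ← ENNReal.mul_rpow_of_nonneg _ _ (by positivity), Finset.mul_sum]
          simp_rw [← mul_pow]
          gcongr with k
          exact hy k
      _ ≤ ∫⁻ y, (K : ℝ≥0∞) ^ p.toReal *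
          (∑ k, gaussAvg (b k) (absExt (x k)) y ^ 2) ^ (p.toReal / 2) :=
          setLIntegral_le_lintegral _ _
      _ = (K : ℝ≥0∞) ^ p.toReal *
          ∫⁻ y, (∑ k, gaussAvg (b k) (absExt (x k)) y ^ 2) ^ (p.toReal / 2) :=
          lintegral_const_mul _ (by fun_prop)
      _ ≤ _ := by
          gcongr
          exact hC₃ n b hb _ (fun k => measurable_absExt hΩ (x k)) hfin
  have hfinal := (hC₁ n fun k => T k (x k)).trans
    ((mul_le_mul' le_rfl hsq).trans (mul_le_mul' le_rfl (mul_le_mul' le_rfl hlow)))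
  have hpos : 0 ≤ rademacherMean fun ε => ‖∑ k, (ε k : ℤ) • x k‖ :=
    rademacherMean_nonneg fun _ => norm_nonneg _
  rw [← ENNReal.ofReal_le_ofReal_iff (by positivity), ENNReal.ofReal_mul (by positivity)]
  refine hfinal.trans (le_of_eq ?_)
  rw [← mul_assoc, ← mul_assoc, ← NNReal.coe_rpow, ← NNReal.coe_mul, ← NNReal.coe_mul,
    ← NNReal.coe_mul, ENNReal.ofReal_coe_nnreal, ENNReal.coe_mul, ENNReal.coe_mul,
    ENNReal.coe_mul, ENNReal.coe_rpow_of_nonneg _ (by positivity)]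
  ring

end GaussDomination

/-! ### Localisation of Gaussian domination. -/

section Local

open scoped NNReal
open Metric

variable {E : Type*} [NormedAddCommGroup E] [InnerProductSpace ℝ E] [FiniteDimensional ℝ E]
  [MeasurableSpace E] [BorelSpace E] {Ω : Set E} {p : ℝ≥0∞}

/-- The restriction of `f ∈ L^p` to a measurable set. -/
def cutOff {s : Set E} (hs : MeasurableSet s) (f : Lp ℂ p (volume.restrict Ω)) :
    Lp ℂ p (volume.restrict Ω) :=
  ((Lp.memLp f).indicator hs).toLp

theorem coeFn_cutOff {s : Set E} (hs : MeasurableSet s) (f : Lp ℂ p (volume.restrict Ω)) :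
    cutOff hs f =ᵐ[volume.restrict Ω] s.indicator f := MemLp.coeFn_toLp _

theorem absExt_cutOff {s : Set E} (hΩ : MeasurableSet Ω) (hs : MeasurableSet s)
    (f : Lp ℂ p (volume.restrict Ω)) : absExt (cutOff hs f) =ᵐ[volume] s.indicator (absExt f) := by
  have h := (ae_restrict_iff' hΩ).1 (coeFn_cutOff hs f)
  filter_upwards [h] with y hy
  by_cases hyΩ : y ∈ Ω
  · rw [absExt, indicator_of_mem hyΩ, hy hyΩ]
    by_cases hys : y ∈ s <;> simp [hys, absExt, hyΩ]
  · rw [absExt, indicator_of_notMem hyΩ]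
    by_cases hys : y ∈ s <;> simp [hys, absExt, hyΩ]

theorem gaussAvg_congr_ae {b : ℝ} {F G : E → ℝ≥0∞} (h : F =ᵐ[volume] G) (x : E) :
    gaussAvg b F x = gaussAvg b G x := by
  unfold gaussAvg
  congr 1
  exact lintegral_congr_ae (h.mono fun y hy => by simp only [hy])

variable [Fact (1 ≤ p)]

theorem tendsto_cutOff (hp : p ≠ ∞) {s : ℕ → Set E} (hs : ∀ n, MeasurableSet (s n))
    (hmono : Monotone s) (huniv : ⋃ n, s n = univ) (f : Lp ℂ p (volume.restrict Ω)) :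
    Tendsto (fun n => cutOff (hs n) f) atTop (𝓝 f) := by
  have hr : 0 < p.toReal :=
    ENNReal.toReal_pos (lt_of_lt_of_le one_pos Fact.out).ne' hp
  rw [tendsto_iff_edist_tendsto_0]
  have h1 : ∀ n, edist (cutOff (hs n) f) f =
      (∫⁻ y in Ω, (s n)ᶜ.indicator (fun y => ‖f y‖ₑ ^ p.toReal) y) ^ (1 / p.toReal) := by
    intro n
    rw [edist_eq_enorm_sub, ← (ENNReal.rpow_left_injective hr.ne').eq_iff, enorm_rpow_toReal hp,
      ← ENNReal.rpow_mul, one_div_mul_cancel hr.ne', ENNReal.rpow_one]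
    refine lintegral_congr_ae ?_
    filter_upwards [Lp.coeFn_sub (cutOff (hs n) f) f, coeFn_cutOff (hs n) f] with y h1 h2
    rw [h1, Pi.sub_apply, h2]
    by_cases hy : y ∈ s n <;> simp [hy, hr]
  simp_rw [h1]
  have h2 : Tendsto (fun n => ∫⁻ y in Ω, (s n)ᶜ.indicator (fun y => ‖f y‖ₑ ^ p.toReal) y) atTop
      (𝓝 (∫⁻ _ in Ω, 0)) := by
    refine tendsto_lintegral_of_dominated_convergence' (fun y => ‖f y‖ₑ ^ p.toReal)
      (fun n => ((Lp.aestronglyMeasurable f).enorm.pow_const _).indicator (hs n).compl)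
      (fun n => ae_of_all _ fun y => indicator_le_self _ _ _) ?_ (ae_of_all _ fun y => ?_)
    · rw [← enorm_rpow_toReal hp]
      exact ENNReal.rpow_ne_top_of_nonneg hr.le enorm_ne_top
    · obtain ⟨n, hn⟩ := mem_iUnion.1 (huniv ▸ mem_univ y : y ∈ ⋃ n, s n)
      refine tendsto_const_nhds.congr' ?_
      filter_upwards [eventually_ge_atTop n] with m hm
      simp [hmono hm hn]
  rw [lintegral_zero] at h2
  have h3 := h2.ennrpow_const (1 / p.toReal)
  rwa [ENNReal.zero_rpow_of_pos (by positivity)] at h3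

/-- Gaussian domination can be checked on functions supported in balls of a fixed radius. -/
theorem gaussDom_of_local (hΩ : MeasurableSet Ω) (hp : p ≠ ∞)
    {B : Lp ℂ p (volume.restrict Ω) →L[ℂ] Lp ℂ p (volume.restrict Ω)} {K : ℝ≥0} {b ρ : ℝ}
    (hρ : 0 < ρ)
    (h : ∀ (z : E) (f : Lp ℂ p (volume.restrict Ω)), (∀ᵐ y, y ∉ ball z ρ → absExt f y = 0) →
      ∀ᵐ x ∂volume.restrict Ω, ‖B f x‖ₑ ≤ K * gaussAvg b (absExt f) x) : GaussDom K b B := by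
  intro f
  set d := TopologicalSpace.denseSeq E
  set t : ℕ → Set E := fun n => ball (d n) ρ
  have ht : ∀ n, MeasurableSet (t n) := fun n => measurableSet_ball
  have hQ : ∀ n, MeasurableSet (disjointed t n) := MeasurableSet.disjointed ht
  have hs : ∀ n, MeasurableSet (partialSups t n) := fun n => by
    rw [partialSups_eq_biUnion_range]
    exact Finset.measurableSet_biUnion _ fun k _ => ht k
  have huniv : ⋃ n, partialSups t n = univ := by
    rw [← iSup_eq_iUnion, iSup_partialSups_eq, iSup_eq_iUnion, eq_univ_iff_forall]
    intro x
    obtain ⟨n, hn⟩ := (TopologicalSpace.denseRange_denseSeq E).exists_mem_open isOpen_ball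
      ⟨x, mem_ball_self hρ⟩
    exact mem_iUnion.2 ⟨n, mem_ball_comm.1 hn⟩
  have hlim := tendsto_cutOff hp hs (partialSups t).monotone huniv f
  have hlimB : Tendsto (fun n => B (cutOff (hs n) f)) atTop (𝓝 (B f)) :=
    (B.continuous.tendsto f).comp hlim
  -- `L^p` convergence gives pointwise convergence along a subsequence only. This suffices, since
  -- the bound for the partial sums is uniform: the averages are additive over the disjoint pieces.
  obtain ⟨φ, hφ, hae⟩ := (tendstoInMeasure_of_tendsto_Lp hlimB).exists_seq_tendsto_ae
  have hsum : ∀ n, cutOff (hs n) f = ∑ k ∈ Finset.range (n + 1), cutOff (hQ k) f := by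
    intro n
    refine Lp.ext ?_
    have h2 := Lp.coeFn_finsetSum (Finset.range (n + 1)) (fun k => cutOff (hQ k) f)
    filter_upwards [coeFn_cutOff (hs n) f, h2, ae_all_iff.2 fun k => coeFn_cutOff (hQ k) f]
      with y h1 h2 h3
    rw [h1, h2, Finset.sum_apply]
    simp_rw [h3]
    rw [← partialSups_disjointed, partialSups_eq_biUnion_range,
      Finset.indicator_biUnion_apply _ _ fun i _ j _ hij => disjoint_disjointed t hij]
  have hloc : ∀ k, ∀ᵐ x ∂volume.restrict Ω, ‖B (cutOff (hQ k) f) x‖ₑ ≤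
      K * gaussAvg b ((disjointed t k).indicator (absExt f)) x := by
    intro k
    have h1 := h (d k) (cutOff (hQ k) f) (by
      filter_upwards [absExt_cutOff hΩ (hQ k) f] with y hy hyt
      rw [hy, indicator_of_notMem fun hc => hyt (disjointed_subset t k hc)])
    filter_upwards [h1] with x hx
    rwa [gaussAvg_congr_ae (absExt_cutOff hΩ (hQ k) f)] at hx
  have hBsum : ∀ n, ∀ᵐ x ∂volume.restrict Ω, B (cutOff (hs n) f) x =
      ∑ k ∈ Finset.range (n + 1), B (cutOff (hQ k) f) x := by
    intro n
    rw [hsum, map_sum]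
    filter_upwards [Lp.coeFn_finsetSum (Finset.range (n + 1)) (fun k => B (cutOff (hQ k) f))]
      with x hx
    rw [hx, Finset.sum_apply]
  filter_upwards [hae, ae_all_iff.2 hloc, ae_all_iff.2 hBsum] with x hx1 hx2 hx3
  refine le_of_tendsto' (continuous_enorm.continuousAt.tendsto.comp hx1) fun n => ?_
  simp only [Function.comp_apply, hx3]
  calc _ ≤ ∑ k ∈ Finset.range (φ n + 1), ‖B (cutOff (hQ k) f) x‖ₑ := enorm_sum_le _ _
    _ ≤ ∑ k ∈ Finset.range (φ n + 1), K * gaussAvg b ((disjointed t k).indicator (absExt f)) x :=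
        Finset.sum_le_sum fun k _ => hx2 k
    _ = K * gaussAvg b (∑ k ∈ Finset.range (φ n + 1), (disjointed t k).indicator (absExt f)) x := by
        rw [← Finset.mul_sum]
        congr 1
        unfold gaussAvg
        have hm : ∀ k, Measurable fun y =>
            gauss b (x - y) * (disjointed t k).indicator (absExt f) y := fun k =>
          (by fun_prop : Measurable fun y => gauss b (x - y)).mul
            ((measurable_absExt hΩ f).indicator (hQ k))
        simp_rw [Finset.sum_apply, Finset.mul_sum]
        rw [lintegral_finsetSum _ fun k _ => hm k, Finset.mul_sum]
    _ ≤ _ := by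
        gcongr
        refine gaussAvg_mono (fun y => ?_) x
        rw [Finset.sum_apply,
          ← Finset.indicator_biUnion_apply _ _ fun i _ j _ hij => disjoint_disjointed t hij]
        exact indicator_le_self _ _ _

end Local

/-! ### From norm bounds to Gaussian domination: a Landau inequality. -/

section Landau

open scoped NNReal
open Metric

variable {E : Type*} [NormedAddCommGroup E]

/-- On a ball of radius `√b` the Gaussian in `x - y` may be replaced by one in `x - z`. The bound is
written as the square of a number `h₀`, which becomes the step size in the Landau argument. -/
theorem gauss_le_of_mem_ball {b : ℝ} (hb : 0 < b) {x y z : E} (hy : y ∈ ball z √b) :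
    gauss (2 * b) (x - y) ≤ ENNReal.ofReal (Real.exp (1 / 2)) *
      ENNReal.ofReal (Real.exp (-(‖x - z‖ ^ 2 / (8 * b)))) ^ 2 := by
  rw [gauss, ← ENNReal.ofReal_pow (Real.exp_pos _).le, ← ENNReal.ofReal_mul (Real.exp_pos _).le,
    ← Real.exp_nat_mul, ← Real.exp_add]
  refine ENNReal.ofReal_le_ofReal (Real.exp_le_exp.2 ?_)
  rw [mem_ball, dist_eq_norm, Real.lt_sqrt (norm_nonneg _)] at hy
  have h1 : ‖x - z‖ ≤ ‖x - y‖ + ‖y - z‖ := norm_sub_le_norm_sub_add_norm_sub _ _ _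
  have h2 : ‖x - z‖ ^ 2 ≤ 2 * ‖x - y‖ ^ 2 + 2 * b := by
    nlinarith [norm_nonneg (x - z), norm_nonneg (x - y), norm_nonneg (y - z),
      sq_nonneg (‖x - y‖ - ‖y - z‖)]
  have h3 : ‖x - z‖ ^ 2 / (4 * b) ≤ ‖x - y‖ ^ 2 / (2 * b) + 1 / 2 := by
    rw [div_add_div _ _ (by positivity) (by positivity), div_le_div_iff₀ (by positivity)
      (by positivity)]
    nlinarith
  have h4 : ‖x - z‖ ^ 2 / (4 * b) = 2 * (‖x - z‖ ^ 2 / (8 * b)) := by field_simp; ring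
  push_cast
  linarith

/-- The way back from the centre `z` to `y`, paid for by widening the Gaussian from `8 b` to `16 b`.
-/
theorem le_gauss_of_mem_ball {b : ℝ} (hb : 0 < b) {x y z : E} (hy : y ∈ ball z √b) :
    ENNReal.ofReal (Real.exp (-(‖x - z‖ ^ 2 / (8 * b)))) ≤
      ENNReal.ofReal (Real.exp (1 / 8)) * gauss (16 * b) (x - y) := by
  rw [gauss, ← ENNReal.ofReal_mul (Real.exp_pos _).le, ← Real.exp_add]
  refine ENNReal.ofReal_le_ofReal (Real.exp_le_exp.2 ?_)
  rw [mem_ball, dist_eq_norm, Real.lt_sqrt (norm_nonneg _)] at hy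
  have h1 : ‖x - y‖ ≤ ‖x - z‖ + ‖z - y‖ := norm_sub_le_norm_sub_add_norm_sub _ _ _
  rw [norm_sub_rev z y] at h1
  have h2 : ‖x - y‖ ^ 2 ≤ 2 * ‖x - z‖ ^ 2 + 2 * b := by
    nlinarith [norm_nonneg (x - z), norm_nonneg (x - y), norm_nonneg (y - z),
      sq_nonneg (‖x - z‖ - ‖y - z‖)]
  have h3 : ‖x - y‖ ^ 2 / (16 * b) ≤ ‖x - z‖ ^ 2 / (8 * b) + 1 / 8 := by
    rw [div_add_div _ _ (by positivity) (by positivity), div_le_div_iff₀ (by positivity)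
      (by positivity)]
    nlinarith
  linarith

variable [InnerProductSpace ℝ E] [FiniteDimensional ℝ E]
  [MeasurableSpace E] [BorelSpace E] {Ω : Set E} {p : ℝ≥0∞} [Fact (1 ≤ p)]

theorem gaussMass_mono {b c : ℝ} (hb : 0 < b) (hbc : b ≤ c) : gaussMass E b ≤ gaussMass E c :=
  lintegral_mono fun x => gauss_mono hb hbc x

variable (E) in
theorem gaussMass_mul {a b : ℝ} (ha : 0 < a) (hb : 0 < b) :
    gaussMass E (a * b) =
      ENNReal.ofReal (a ^ (Module.finrank ℝ E / 2 : ℝ)) * gaussMass E b := by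
  rw [gaussMass_eq E (by positivity), gaussMass_eq E hb, ← ENNReal.ofReal_mul (by positivity),
    ← Real.mul_rpow ha.le (by positivity)]
  congr 2; ring

variable (E) in
theorem inv_gaussMass_le {a b c : ℝ} (ha : 0 < a) (hb : 0 < b) (hbc : c ≤ a * b) (hc : 0 < c) :
    (gaussMass E b)⁻¹ ≤
      ENNReal.ofReal (a ^ (Module.finrank ℝ E / 2 : ℝ)) * (gaussMass E c)⁻¹ := by
  have h0 : ENNReal.ofReal (a ^ (Module.finrank ℝ E / 2 : ℝ)) ≠ 0 := by
    rw [ENNReal.ofReal_ne_zero_iff]; positivity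
  calc (gaussMass E b)⁻¹ = ENNReal.ofReal (a ^ (Module.finrank ℝ E / 2 : ℝ)) *
        (gaussMass E (a * b))⁻¹ := by
        rw [gaussMass_mul E ha hb, ENNReal.mul_inv (Or.inl h0) (Or.inl ENNReal.ofReal_ne_top),
          ← mul_assoc, ENNReal.mul_inv_cancel h0 ENNReal.ofReal_ne_top, one_mul]
    _ ≤ _ := by
        gcongr
        exact gaussMass_mono hc hbc

variable (E) in
/-- The constant in `gaussDom_of_second_order`. -/
def landauConst (K δ : ℝ≥0) : ℝ≥0 :=
  ((48 : ℝ) ^ (Module.finrank ℝ E / 2 : ℝ)).toNNReal *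
    (4 * K * (Real.exp (1 / 2)).toNNReal + K ^ 2 * δ) * (Real.exp (1 / 8)).toNNReal

/-- If `h B` is, up to `O(h²)`, a difference of operators with Gaussian domination, then `B` has
Gaussian domination: a kernel version of the Landau inequality. -/
theorem gaussDom_of_second_order (hΩ : MeasurableSet Ω) (hp : p ≠ ∞) {K δ : ℝ≥0} {c s : ℝ}
    (hc : 0 < c) (hs : 0 < s)
    {B : Lp ℂ p (volume.restrict Ω) →L[ℂ] Lp ℂ p (volume.restrict Ω)}
    (T D : ℝ → Lp ℂ p (volume.restrict Ω) →L[ℂ] Lp ℂ p (volume.restrict Ω))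
    (hT : ∀ τ > 0, GaussDom K (c * τ) (T τ)) (hD : ∀ h ∈ Ioc (0 : ℝ) 1, ‖D h‖ ≤ δ * h ^ 2)
    (hB : ∀ h ∈ Ioc (0 : ℝ) 1, ∀ f,
      (h : ℂ) • B f = T s f - T (s + h * s) f - T (s / 3) (D h (T (s / 3) f))) :
    GaussDom (landauConst E K δ) (16 * (c * s)) B := by
  set b := c * s with hbdef
  have hb : 0 < b := by positivity
  have hsb : 0 < √b := Real.sqrt_pos.2 hb
  refine gaussDom_of_local hΩ hp hsb fun z f hf => ?_
  set Λ := ENNReal.ofReal ((48 : ℝ) ^ (Module.finrank ℝ E / 2 : ℝ)) with hΛ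
  set I := gaussMass E (16 * b) with hI
  set J := ∫⁻ y, absExt f y with hJ
  -- The narrowest width is `b / 3`, from `T (s / 3)`, and the target width is `16 b`; their ratio
  -- is the 48 in `landauConst`.
  have hIle : ∀ b' : ℝ, b / 3 ≤ b' → (gaussMass E b')⁻¹ ≤ Λ * I⁻¹ := fun b' hb' =>
    inv_gaussMass_le E (by norm_num) (by linarith) (by linarith) (by positivity)
  have hmain : ∀ h ∈ Ioc (0 : ℝ) 1, ∀ᵐ x ∂volume.restrict Ω,
      ENNReal.ofReal h * ‖B f x‖ₑ ≤
        2 * K * (Λ * I⁻¹) * (∫⁻ y, gauss (2 * b) (x - y) * absExt f y) +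
        K ^ 2 * (δ * ENNReal.ofReal h ^ 2) * (Λ * I⁻¹) * J := by
    intro h hh
    have hh0 : 0 < h := hh.1
    have hDh : ‖D h‖ ≤ ((δ * (h ^ 2).toNNReal : ℝ≥0) : ℝ) := by
      rw [NNReal.coe_mul, Real.coe_toNNReal _ (by positivity)]
      exact hD h hh
    have h3 := (hT (s / 3) (by positivity)).enorm_comp_comp_le (hT (s / 3) (by positivity)) hΩ hp
      (by positivity) (D h) hDh f
    have hbound : ∀ τ, s ≤ τ → τ ≤ 2 * s → ∀ x, (K : ℝ≥0∞) * gaussAvg (c * τ) (absExt f) x ≤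
        K * ((Λ * I⁻¹) * ∫⁻ y, gauss (2 * b) (x - y) * absExt f y) := by
      intro τ h1 h2 x
      have hle : b ≤ c * τ := by rw [hbdef]; gcongr
      have hle2 : c * τ ≤ 2 * b := by rw [hbdef]; nlinarith
      unfold gaussAvg
      gcongr with y
      · exact hIle _ (by linarith)
      · exact gauss_mono (by linarith) hle2 _
    filter_upwards [hT s hs f, hT (s + h * s) (by positivity) f, h3,
      Lp.coeFn_smul (h : ℂ) (B f), Lp.coeFn_sub (T s f - T (s + h * s) f)
        (T (s / 3) (D h (T (s / 3) f))), Lp.coeFn_sub (T s f) (T (s + h * s) f)]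
      with x h1 h2 h3 h4 h5 h6
    have e : ENNReal.ofReal h * ‖B f x‖ₑ = ‖(h : ℂ) • B f x‖ₑ := by
      rw [enorm_smul, ← ofReal_norm (h : ℂ), Complex.norm_real, Real.norm_of_nonneg hh0.le]
    have h1' := h1.trans (hbound s le_rfl (by linarith) x)
    have h2' := h2.trans (hbound (s + h * s) (by nlinarith) (by nlinarith [hh.2]) x)
    rw [e, ← Pi.smul_apply, ← h4, hB h hh, h5, Pi.sub_apply, h6, Pi.sub_apply]
    refine (enorm_sub_le.trans (add_le_add_left enorm_sub_le _)).trans ?_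
    refine (add_le_add (add_le_add h1' h2') h3).trans ?_
    rw [← lintegral_absExt hΩ, ENNReal.coe_mul, show (((h ^ 2).toNNReal : ℝ≥0) : ℝ≥0∞) =
      ENNReal.ofReal h ^ 2 from ENNReal.ofReal_pow hh0.le 2]
    refine add_le_add (le_of_eq (by ring)) ?_
    calc _ ≤ (K : ℝ≥0∞) ^ 2 * (δ * ENNReal.ofReal h ^ 2) * (Λ * I⁻¹ * J) := by
          gcongr
          exact hIle _ (by rw [hbdef]; linarith)
      _ = _ := by ring
  -- The step `h` will depend on `x`, whereas the exceptional null set depends on `h`; restricting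
  -- to dyadic `h` keeps the null sets countable in number.
  have hseq : ∀ᵐ x ∂volume.restrict Ω, ∀ j : ℕ, ENNReal.ofReal ((1 / 2 : ℝ) ^ j) * ‖B f x‖ₑ ≤
        2 * K * (Λ * I⁻¹) * (∫⁻ y, gauss (2 * b) (x - y) * absExt f y) +
        K ^ 2 * (δ * ENNReal.ofReal ((1 / 2 : ℝ) ^ j) ^ 2) * (Λ * I⁻¹) * J :=
    ae_all_iff.2 fun j => hmain _ ⟨by positivity, pow_le_one₀ (by norm_num) (by norm_num)⟩
  filter_upwards [hseq] with x hx
  set h₀ := Real.exp (-(‖x - z‖ ^ 2 / (8 * b))) with hh₀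
  have hh₀1 : h₀ ≤ 1 := by
    rw [hh₀, Real.exp_le_one_iff]
    have : 0 ≤ ‖x - z‖ ^ 2 / (8 * b) := by positivity
    linarith
  -- After division by `h` the two terms are of size `h₀² / h` and `h`, which balance at `h ≈ h₀`.
  -- The dyadic value `η = 2^{-(j+1)}` satisfies `η ≤ h₀ ≤ 2 η`.
  obtain ⟨j, hj1, hj2⟩ := exists_nat_pow_near_of_lt_one (Real.exp_pos _) hh₀1
    (by norm_num : (0 : ℝ) < 1 / 2) (by norm_num)
  set η := ENNReal.ofReal ((1 / 2 : ℝ) ^ (j + 1)) with hη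
  have hη0 : η ≠ 0 := by rw [hη, ENNReal.ofReal_ne_zero_iff]; positivity
  have hη1 : η ≤ ENNReal.ofReal h₀ := ENNReal.ofReal_le_ofReal hj1.le
  have hη2 : ENNReal.ofReal h₀ ≤ 2 * η := by
    rw [hη, ← ENNReal.ofReal_ofNat 2, ← ENNReal.ofReal_mul (by norm_num)]
    refine ENNReal.ofReal_le_ofReal (hj2.trans (le_of_eq ?_))
    rw [pow_succ]; ring
  have hA : ∫⁻ y, gauss (2 * b) (x - y) * absExt f y ≤
      ENNReal.ofReal (Real.exp (1 / 2)) * ENNReal.ofReal h₀ ^ 2 * J := by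
    rw [hJ, ← lintegral_const_mul _ (measurable_absExt hΩ f)]
    refine lintegral_mono_ae ?_
    filter_upwards [hf] with y hy
    by_cases hyz : y ∈ ball z √b
    · gcongr
      exact gauss_le_of_mem_ball hb hyz
    · simp [hy hyz]
  have hB' : ENNReal.ofReal h₀ * J ≤ ENNReal.ofReal (Real.exp (1 / 8)) *
      ∫⁻ y, gauss (16 * b) (x - y) * absExt f y := by
    rw [hJ, ← lintegral_const_mul _ (measurable_absExt hΩ f), ← lintegral_const_mul' _ _
      ENNReal.ofReal_ne_top]
    refine lintegral_mono_ae ?_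
    filter_upwards [hf] with y hy
    by_cases hyz : y ∈ ball z √b
    · rw [← mul_assoc]
      gcongr
      exact le_gauss_of_mem_ball hb hyz
    · simp [hy hyz]
  have hfin : η * ‖B f x‖ₑ ≤ η * ((4 * K * ENNReal.ofReal (Real.exp (1 / 2)) + K ^ 2 * δ) *
      (Λ * I⁻¹) * (ENNReal.ofReal h₀ * J)) := by
    refine (hx (j + 1)).trans ?_
    calc _ ≤ 2 * K * (Λ * I⁻¹) * (ENNReal.ofReal (Real.exp (1 / 2)) *
          (ENNReal.ofReal h₀ * (2 * η)) * J) +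
          K ^ 2 * (δ * (η * ENNReal.ofReal h₀)) * (Λ * I⁻¹) * J := by
          gcongr
          · refine hA.trans ?_
            rw [sq]
            gcongr
          · rw [← hη, sq]
            gcongr
      _ = _ := by ring
  have hcancel := (ENNReal.mul_le_mul_iff_right hη0 ENNReal.ofReal_ne_top).1 hfin
  refine hcancel.trans ?_
  calc _ ≤ (4 * K * ENNReal.ofReal (Real.exp (1 / 2)) + K ^ 2 * δ) *
      (Λ * I⁻¹) * (ENNReal.ofReal (Real.exp (1 / 8)) *
      ∫⁻ y, gauss (16 * b) (x - y) * absExt f y) := by gcongr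
    _ = _ := by
      rw [landauConst, gaussAvg, ENNReal.coe_mul, ENNReal.coe_mul, ENNReal.coe_add,
        ENNReal.coe_mul, ENNReal.coe_mul, ENNReal.coe_mul, ENNReal.coe_pow, hΛ]
      simp only [ENNReal.ofReal]
      push_cast
      ring

end Landau

/-! ### Bounded semigroups, generators and the Laplace transform. -/

section Semigroup

variable {X : Type*} [NormedAddCommGroup X] [NormedSpace ℂ X]

/-- `Q` is the inverse of `z + A`. -/
structure IsShiftInv (A : X →ₗ.[ℂ] X) (z : ℂ) (Q : X →L[ℂ] X) : Prop where
  mem_graph : ∀ x, (Q x, x - z • Q x) ∈ A.graph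
  apply_eq : ∀ {y w : X}, (y, w) ∈ A.graph → Q (z • y + w) = y

theorem IsResolventAt.isShiftInv {A : X →ₗ.[ℂ] X} {z : ℂ} {R : X →L[ℂ] X}
    (h : IsResolventAt A z R) : IsShiftInv A (-z) (-R) where
  mem_graph x := by
    obtain ⟨hx, h1⟩ := h.1 x
    have h2 : (R x, z • R x - x) ∈ A.graph := by
      rw [LinearPMap.mem_graph_iff]
      exact ⟨⟨R x, hx⟩, rfl, by rw [eq_sub_iff_add_eq, ← eq_sub_iff_add_eq', h1]⟩
    have h3 := A.graph.neg_mem h2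
    simpa [neg_sub, sub_eq_add_neg, add_comm] using h3
  apply_eq {y w} hyw := by
    obtain ⟨y', rfl, rfl⟩ := (LinearPMap.mem_graph_iff _).1 hyw
    have := h.2 y'
    rw [neg_apply, ← map_neg]
    convert this using 2
    simp [sub_eq_add_neg, add_comm]

/-- A bounded `C₀`-semigroup, extended continuously to negative times, with generator `-A`. -/
structure IsBddSemigroup (A : X →ₗ.[ℂ] X) (U : ℝ → X →L[ℂ] X) (K : ℝ) : Prop where
  zero : ∀ x, U 0 x = x
  add : ∀ s r : ℝ, 0 ≤ s → 0 ≤ r → ∀ x, U (s + r) x = U s (U r x)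
  cont : ∀ x, Continuous fun s => U s x
  bound : ∀ s x, ‖U s x‖ ≤ K * ‖x‖
  gen : ∀ x y, (x, y) ∈ A.graph ↔
    Tendsto (fun s : ℝ => (s : ℂ)⁻¹ • (U s x - x)) (𝓝[>] 0) (𝓝 (-y))

theorem graph_unique {A : X →ₗ.[ℂ] X} {x y z : X} (h : (x, y) ∈ A.graph) (h' : (x, z) ∈ A.graph) :
    y = z :=
  A.mem_graph_snd_inj h h' rfl

variable {A : X →ₗ.[ℂ] X} {U : ℝ → X →L[ℂ] X} {K : ℝ}

theorem IsBddSemigroup.map_graph (h : IsBddSemigroup A U K) {s : ℝ} (hs : 0 ≤ s) {x y : X}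
    (hxy : (x, y) ∈ A.graph) : (U s x, U s y) ∈ A.graph := by
  rw [h.gen] at hxy ⊢
  have h1 := ((U s).continuous.tendsto _).comp hxy
  rw [map_neg] at h1
  refine h1.congr' ?_
  filter_upwards [self_mem_nhdsWithin] with k (hk : 0 < k)
  simp only [Function.comp_apply, map_smul, map_sub]
  rw [← h.add s k hs hk.le, ← h.add k s hk.le hs, add_comm]

theorem IsBddSemigroup.continuous_exp_smul (h : IsBddSemigroup A U K) (z : ℂ) (x : X) :
    Continuous fun s : ℝ => Complex.exp (-z * s) • U s x :=
  (by fun_prop : Continuous fun s : ℝ => Complex.exp (-z * s)).smul (h.cont x)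

theorem IsBddSemigroup.integrableOn (h : IsBddSemigroup A U K) {z : ℂ} (hz : 0 < z.re) (x : X) :
    IntegrableOn (fun s : ℝ => Complex.exp (-z * s) • U s x) (Ioi 0) := by
  have h1 : IntegrableOn (fun s : ℝ => (K * ‖x‖) * Real.exp (-z.re * s)) (Ioi 0) :=
    (exp_neg_integrableOn_Ioi 0 hz).const_mul _
  refine h1.mono' (h.continuous_exp_smul z x).aestronglyMeasurable (ae_of_all _ fun s => ?_)
  rw [norm_smul, Complex.norm_exp, mul_comm]
  have : (-z * (s : ℂ)).re = -z.re * s := by simp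
  rw [this]
  gcongr
  exact h.bound s x

variable [CompleteSpace X]

/-- The truncated Laplace transform lies in the domain of `A`. -/
theorem IsBddSemigroup.integral_mem_graph (h : IsBddSemigroup A U K) (z : ℂ) {t : ℝ} (ht : 0 ≤ t)
    (x : X) : (∫ s in 0..t, Complex.exp (-z * s) • U s x,
      x - Complex.exp (-z * t) • U t x -
        z • ∫ s in 0..t, Complex.exp (-z * s) • U s x) ∈ A.graph := by
  set g : ℝ → X := fun s => Complex.exp (-z * s) • U s x with hg
  have hgc : Continuous g := h.continuous_exp_smul z x
  set G : ℝ → X := fun r => ∫ s in 0..r, g s with hG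
  have hGd : ∀ r, HasDerivAt G (g r) r := fun r =>
    intervalIntegral.integral_hasDerivAt_right (hgc.intervalIntegrable _ _)
      (hgc.stronglyMeasurableAtFilter _ _) hgc.continuousAt
  rw [h.gen]
  -- For `k > 0` this equals `U k (G t)` by the semigroup law and a translation of the integral, and
  -- in this form it is visibly differentiable at 0.
  set φ : ℝ → X := fun k => Complex.exp (z * k) • (G (t + k) - G k) with hφ
  have hφd : HasDerivAt φ (z • G t + (g t - x)) 0 := by
    have h1 : HasDerivAt (fun k : ℝ => Complex.exp (z * k)) (Complex.exp (z * (0 : ℝ)) * z) 0 := by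
      have := ((hasDerivAt_id (0 : ℝ)).ofReal_comp.const_mul z).cexp
      simpa using this
    have h2 : HasDerivAt (fun k => G (t + k) - G k) (g (t + 0) - g 0) 0 := by
      refine HasDerivAt.sub ?_ (hGd 0)
      have := hGd (t + 0)
      exact this.comp_const_add t 0
    have h3 := h1.smul h2
    have hg0 : g 0 = x := by simp [hg, h.zero]
    have hG0 : G 0 = 0 := by simp [hG]
    convert! h3 using 1
    simp [hg0, hG0, add_comm]
  have hslope := hφd.tendsto_slope_zero_right
  have hφ0 : φ 0 = G t := by simp [hφ, hG]
  have hneg : -(x - Complex.exp (-z * t) • U t x - z • G t) = z • G t + (g t - x) := by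
    simp only [hg]; abel
  rw [hneg]
  refine hslope.congr' ?_
  filter_upwards [self_mem_nhdsWithin] with k (hk : 0 < k)
  have hUk : U k (G t) = φ k := by
    have h1 : U k (G t) = ∫ s in 0..t, Complex.exp (z * k) • g (s + k) := by
      rw [hG]
      simp only
      rw [← (U k).intervalIntegral_comp_comm (hgc.intervalIntegrable _ _)]
      refine intervalIntegral.integral_congr fun s hs => ?_
      rw [uIcc_of_le ht] at hs
      simp only [hg, map_smul]
      rw [← h.add k s hk.le hs.1, smul_smul, ← Complex.exp_add, add_comm k s]
      congr 2
      push_cast; ring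
    rw [h1, intervalIntegral.integral_smul, intervalIntegral.integral_comp_add_right, zero_add]
    simp only [hφ, hG]
    rw [intervalIntegral.integral_interval_sub_left (hgc.intervalIntegrable _ _)
      (hgc.intervalIntegrable _ _)]
  rw [zero_add, hφ0, hUk, ← Complex.ofReal_inv, Complex.coe_smul]

/-- The inverse of `z + A` is the Laplace transform of the semigroup. -/
theorem IsBddSemigroup.laplace (h : IsBddSemigroup A U K) {z : ℂ} (hz : 0 < z.re)
    {Q : X →L[ℂ] X} (hQ : IsShiftInv A z Q) (x : X) :
    ∫ s in Ioi (0 : ℝ), Complex.exp (-z * s) • U s x = Q x := by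
  have h1 := intervalIntegral_tendsto_integral_Ioi 0 (h.integrableOn hz x) tendsto_id
  refine tendsto_nhds_unique h1 ?_
  have h2 : Tendsto (fun t : ℝ => Complex.exp (-z * t) • U t x) atTop (𝓝 0) := by
    have h3 : Tendsto (fun t : ℝ => (K * ‖x‖) * Real.exp (-z.re * t)) atTop (𝓝 ((K * ‖x‖) * 0)) := by
      refine Tendsto.const_mul _ (Real.tendsto_exp_atBot.comp ?_)
      exact tendsto_id.const_mul_atTop_of_neg (by linarith)
    rw [mul_zero] at h3
    refine squeeze_zero_norm (fun t => ?_) h3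
    rw [norm_smul, Complex.norm_exp, mul_comm]
    have : (-z * (t : ℂ)).re = -z.re * t := by simp
    rw [this]
    gcongr
    exact h.bound t x
  have h3 : Tendsto (fun t : ℝ => Q x - Q (Complex.exp (-z * t) • U t x)) atTop (𝓝 (Q x)) := by
    have := ((Q.continuous.tendsto _).comp h2).const_sub (Q x)
    simpa using this
  refine h3.congr' ?_
  filter_upwards [eventually_ge_atTop 0] with t ht
  have h4 := hQ.apply_eq (h.integral_mem_graph z ht x)
  rw [add_sub_cancel, map_sub] at h4
  exact h4

/-- The graph of `A` is described through the bounded operator `Q`, which commutes with Bochner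
integrals. -/
theorem IsShiftInv.integral_mem_graph {z : ℂ} {Q : X →L[ℂ] X} (hQ : IsShiftInv A z Q)
    {α : Type*} [MeasurableSpace α] {μ : Measure α} {f g : α → X} (hf : Integrable f μ)
    (hg : Integrable g μ) (hfg : ∀ᵐ a ∂μ, (f a, g a) ∈ A.graph) :
    (∫ a, f a ∂μ, ∫ a, g a ∂μ) ∈ A.graph := by
  have h1 : Q (z • ∫ a, f a ∂μ + ∫ a, g a ∂μ) = ∫ a, f a ∂μ := by
    have hfz : Integrable (fun a => z • f a) μ := hf.smul z
    have e := Q.integral_comp_comm (hfz.add hg)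
    simp only [Pi.add_apply] at e
    rw [← integral_smul, ← integral_add hfz hg, ← e]
    exact integral_congr_ae (hfg.mono fun a ha => hQ.apply_eq ha)
  have h2 := hQ.mem_graph (z • ∫ a, f a ∂μ + ∫ a, g a ∂μ)
  rwa [h1, add_sub_cancel_left] at h2

end Semigroup

/-! ### Fourier transforms of weighted orbits along vertical lines. -/

section Inversion

open scoped FourierTransform

variable {X : Type*} [NormedAddCommGroup X] [NormedSpace ℂ X]
  {A : X →ₗ.[ℂ] X} {U : ℝ → X →L[ℂ] X} {K M : ℝ}

theorem IsShiftInv.resolvent_identity {z w : ℂ} {Q R : X →L[ℂ] X} (hQ : IsShiftInv A z Q)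
    (hR : IsShiftInv A w R) : R - Q = (z - w) • Q.comp R := by
  ext x
  have h1 := hQ.apply_eq (hR.mem_graph x)
  have h2 : z • R x + (x - w • R x) = (z - w) • R x + x := by rw [sub_smul]; abel
  rw [h2, map_add, map_smul] at h1
  simp only [sub_apply, smul_apply, ContinuousLinearMap.comp_apply]
  nth_rw 1 [← h1]
  abel

/-- The point `a + 2πiξ` of the vertical line through `a`. -/
def linePt (a ξ : ℝ) : ℂ := a + 2 * π * Complex.I * ξ

theorem linePt_re (a ξ : ℝ) : (linePt a ξ).re = a := by simp [linePt]

theorem norm_linePt_sq (a ξ : ℝ) : ‖linePt a ξ‖ ^ 2 = a ^ 2 + (2 * π * ξ) ^ 2 := by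
  rw [Complex.sq_norm, Complex.normSq_apply]
  simp [linePt]
  ring

theorem le_norm_linePt (a ξ : ℝ) : a ≤ ‖linePt a ξ‖ := by
  have := Complex.re_le_norm (linePt a ξ)
  rwa [linePt_re] at this

theorem linePt_sub (a ξ η : ℝ) :
    linePt a ξ - linePt a η = (2 * π * Complex.I) * ((ξ - η : ℝ) : ℂ) := by
  simp only [linePt]; push_cast; ring

variable {Q : ℂ → X →L[ℂ] X}

theorem continuous_shiftInv_line (hQ : ∀ z : ℂ, 0 < z.re → IsShiftInv A z (Q z))
    (hM : ∀ z : ℂ, 0 < z.re → ‖z • Q z‖ ≤ M) {a : ℝ} (ha : 0 < a) :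
    Continuous fun ξ => Q (linePt a ξ) := by
  have hM0 : 0 ≤ M := (norm_nonneg _).trans (hM 1 (by simp))
  have hb : ∀ ξ, ‖Q (linePt a ξ)‖ ≤ M / a := by
    intro ξ
    have h1 := hM (linePt a ξ) (by rwa [linePt_re])
    rw [norm_smul] at h1
    rw [le_div_iff₀ ha, mul_comm]
    exact (mul_le_mul_of_nonneg_right (le_norm_linePt a ξ) (norm_nonneg _)).trans h1
  have hlip : LipschitzWith (2 * π * (M / a) ^ 2).toNNReal fun ξ => Q (linePt a ξ) := by
    refine LipschitzWith.of_dist_le_mul fun ξ η => ?_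
    rw [dist_eq_norm, (hQ (linePt a η) (by rwa [linePt_re])).resolvent_identity
      (hQ (linePt a ξ) (by rwa [linePt_re])), linePt_sub, norm_smul, dist_eq_norm,
      Real.coe_toNNReal _ (by positivity)]
    have h1 : ‖2 * ↑π * Complex.I * ((η - ξ : ℝ) : ℂ)‖ = 2 * π * ‖ξ - η‖ := by
      rw [norm_mul, Complex.norm_real, norm_sub_rev]
      simp [abs_of_pos Real.pi_pos]
    rw [h1]
    calc _ ≤ 2 * π * ‖ξ - η‖ * ((M / a) * (M / a)) := by
          gcongr
          exact (ContinuousLinearMap.opNorm_comp_le _ _).trans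
            (mul_le_mul (hb _) (hb _) (norm_nonneg _) (by positivity))
      _ = _ := by ring
  exact hlip.continuous

theorem hasDerivAt_apply {q : ℝ → X →L[ℂ] X} {q' : X →L[ℂ] X} {v : ℝ → X} {v' : X} {ξ : ℝ}
    (hq : HasDerivAt q q' ξ) (hv : HasDerivAt v v' ξ) :
    HasDerivAt (fun η => q η (v η)) (q' (v ξ) + q ξ v') ξ :=
  ((ContinuousLinearMap.restrictScalarsL ℂ X X ℝ ℝ).hasFDerivAt.comp_hasDerivAt ξ hq).clm_apply hv

theorem hasDerivAt_shiftInv_line (hQ : ∀ z : ℂ, 0 < z.re → IsShiftInv A z (Q z))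
    (hM : ∀ z : ℂ, 0 < z.re → ‖z • Q z‖ ≤ M) {a : ℝ} (ha : 0 < a) (ξ : ℝ) :
    HasDerivAt (fun ξ => Q (linePt a ξ))
      ((-2 * π * Complex.I : ℂ) • (Q (linePt a ξ)).comp (Q (linePt a ξ))) ξ := by
  rw [hasDerivAt_iff_tendsto_slope]
  have hc := continuous_shiftInv_line hQ hM ha
  have h1 : Tendsto (fun η => (-2 * π * Complex.I : ℂ) • (Q (linePt a ξ)).comp (Q (linePt a η)))
      (𝓝[≠] ξ) (𝓝 ((-2 * π * Complex.I : ℂ) • (Q (linePt a ξ)).comp (Q (linePt a ξ)))) := by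
    have h2 : Continuous fun η =>
        (-2 * π * Complex.I : ℂ) • (Q (linePt a ξ)).comp (Q (linePt a η)) := by
      have h3 : Continuous fun η => (Q (linePt a ξ)).comp (Q (linePt a η)) :=
        continuous_const.clm_comp hc
      exact h3.const_smul (-2 * π * Complex.I : ℂ)
    exact (h2.tendsto ξ).mono_left nhdsWithin_le_nhds
  refine h1.congr' ?_
  filter_upwards [self_mem_nhdsWithin] with η (hη : η ≠ ξ)
  have hne : ((η - ξ : ℝ) : ℂ) ≠ 0 := by exact_mod_cast sub_ne_zero.2 hη
  rw [slope_def_module, (hQ (linePt a ξ) (by rwa [linePt_re])).resolvent_identity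
      (hQ (linePt a η) (by rwa [linePt_re])), linePt_sub, ← Complex.coe_smul, smul_smul]
  congr 1
  rw [show ξ - η = -(η - ξ) by ring]
  rw [Complex.ofReal_inv, Complex.ofReal_neg]
  field_simp

theorem integrableOn_pow_mul_exp {a : ℝ} (ha : 0 < a) (n : ℕ) :
    IntegrableOn (fun s : ℝ => s ^ n * Real.exp (-a * s)) (Ioi 0) := by
  have h := integrableOn_rpow_mul_exp_neg_mul_rpow (p := 1) (s := n) (b := a)
    (by have : (0 : ℝ) ≤ n := Nat.cast_nonneg n
        linarith) one_pos ha
  refine h.congr_fun (fun s _ => ?_) measurableSet_Ioi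
  simp

/-- The weighted orbit `sⁿ e^{-as} U(s) x`, `s > 0`. -/
def orbit (U : ℝ → X →L[ℂ] X) (a : ℝ) (n : ℕ) (x : X) : ℝ → X :=
  (Ioi 0).indicator fun s => (s ^ n * Real.exp (-a * s)) • U s x

theorem IsBddSemigroup.integrable_orbit (h : IsBddSemigroup A U K) {a : ℝ} (ha : 0 < a) (n : ℕ)
    (x : X) : Integrable (orbit U a n x) := by
  rw [orbit, integrable_indicator_iff measurableSet_Ioi]
  refine ((integrableOn_pow_mul_exp ha n).mul_const (K * ‖x‖)).mono'
    ((by fun_prop : Continuous fun s : ℝ => s ^ n * Real.exp (-a * s)).smul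
      (h.cont x)).aestronglyMeasurable ?_
  refine ae_restrict_of_forall_mem measurableSet_Ioi fun s (hs : 0 < s) => ?_
  rw [norm_smul, Real.norm_of_nonneg (by positivity)]
  gcongr
  exact h.bound s x

/-- Multiplying the orbit by `s` corresponds to differentiating its transform in `ξ` and dividing by
`-2πi`. -/
theorem fourier_orbit_succ (h : IsBddSemigroup A U K) {a : ℝ} (ha : 0 < a) (n : ℕ) (x : X)
    {g : ℝ → X} (hg : 𝓕 (orbit U a n x) = fun ξ => g ξ) {g' : X} {ξ : ℝ}
    (hgd : HasDerivAt g ((-2 * π * Complex.I : ℂ) • g') ξ) :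
    𝓕 (orbit U a (n + 1) x) ξ = g' := by
  have e : (fun s : ℝ => s • orbit U a n x s) = orbit U a (n + 1) x := by
    ext s
    by_cases hs : s ∈ Ioi (0 : ℝ)
    · simp only [orbit, indicator_of_mem hs, smul_smul]
      congr 1; ring
    · simp [orbit, indicator_of_notMem hs]
  have h1 := Real.hasDerivAt_fourier (h.integrable_orbit ha n x)
    (by rw [e]; exact h.integrable_orbit ha (n + 1) x) ξ
  rw [hg] at h1
  have h2 := h1.unique hgd
  have e2 : (fun s : ℝ => (-2 * π * Complex.I * s : ℂ) • orbit U a n x s) =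
      fun s => (-2 * π * Complex.I : ℂ) • orbit U a (n + 1) x s := by
    ext s
    rw [← e, mul_smul, Complex.coe_smul]
  have h3 : 𝓕 (fun s => (-2 * π * Complex.I : ℂ) • orbit U a (n + 1) x s) ξ =
      (-2 * π * Complex.I : ℂ) • 𝓕 (orbit U a (n + 1) x) ξ := by
    rw [Real.fourier_real_eq, Real.fourier_real_eq, ← integral_smul]
    refine integral_congr_ae (ae_of_all _ fun s => ?_)
    exact smul_comm _ _ _
  rw [e2, h3] at h2
  exact smul_right_injective X (by simp [Real.pi_ne_zero]) h2

variable [CompleteSpace X]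

theorem fourier_orbit_zero (h : IsBddSemigroup A U K)
    (hQ : ∀ z : ℂ, 0 < z.re → IsShiftInv A z (Q z)) {a : ℝ} (ha : 0 < a) (x : X) :
    𝓕 (orbit U a 0 x) = fun ξ => Q (linePt a ξ) x := by
  ext ξ
  rw [← h.laplace (by rwa [linePt_re]) (hQ _ (by rwa [linePt_re])) x,
    Real.fourier_real_eq_integral_exp_smul, ← integral_indicator measurableSet_Ioi]
  refine integral_congr_ae (ae_of_all _ fun s => ?_)
  by_cases hs : s ∈ Ioi (0 : ℝ)
  · simp only [orbit, indicator_of_mem hs]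
    rw [← Complex.coe_smul, smul_smul, pow_zero, one_mul, Complex.ofReal_exp, ← Complex.exp_add]
    congr 2
    simp only [linePt]
    push_cast; ring
  · simp [orbit, indicator_of_notMem hs]

/-- Two powers of `s` are used because then both the transform `2 Q³ x` and its image `2 (Q² x - z
Q³ x)` under `A` are `O(|z|⁻²)`, hence integrable on the line. -/
theorem fourier_orbit_two (h : IsBddSemigroup A U K)
    (hQ : ∀ z : ℂ, 0 < z.re → IsShiftInv A z (Q z))
    (hM : ∀ z : ℂ, 0 < z.re → ‖z • Q z‖ ≤ M) {a : ℝ} (ha : 0 < a) (x : X) :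
    𝓕 (orbit U a 2 x) = fun ξ =>
      (2 : ℂ) • Q (linePt a ξ) (Q (linePt a ξ) (Q (linePt a ξ) x)) := by
  have hd := hasDerivAt_shiftInv_line hQ hM ha
  have h1 : 𝓕 (orbit U a 1 x) = fun ξ => Q (linePt a ξ) (Q (linePt a ξ) x) := by
    ext ξ
    refine fourier_orbit_succ h ha 0 x (fourier_orbit_zero h hQ ha x) ?_
    have := hasDerivAt_apply (hd ξ) (hasDerivAt_const ξ x)
    simpa using this
  ext ξ
  refine fourier_orbit_succ h ha 1 x h1 ?_
  have h2 := hasDerivAt_apply (hd ξ) (hasDerivAt_const ξ x)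
  have h3 := hasDerivAt_apply (hd ξ) h2
  convert! h3 using 1
  simp only [smul_apply, ContinuousLinearMap.comp_apply, map_zero, add_zero, map_smul]
  module

end Inversion

/-! ### Analyticity, Taylor estimates and the resolvent formula. -/

section Analytic

open scoped FourierTransform

variable {X : Type*} [NormedAddCommGroup X] [NormedSpace ℂ X]
  {A : X →ₗ.[ℂ] X} {U : ℝ → X →L[ℂ] X} {K M : ℝ} {Q : ℂ → X →L[ℂ] X}

theorem integrable_inv_norm_linePt_sq {a : ℝ} (ha : 0 < a) :
    Integrable fun ξ => (‖linePt a ξ‖ ^ 2)⁻¹ := by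
  have h := (integrable_inv_one_add_sq.comp_mul_left' (R := 2 * π / a)
    (by positivity)).const_mul (a ^ 2)⁻¹
  refine h.congr (ae_of_all _ fun ξ => ?_)
  simp only [norm_linePt_sq]
  rw [← mul_inv]
  congr 1
  field_simp

theorem integral_inv_norm_linePt_sq {a : ℝ} (ha : 0 < a) :
    ∫ ξ, (‖linePt a ξ‖ ^ 2)⁻¹ = (2 * a)⁻¹ := by
  have h : ∀ ξ, (‖linePt a ξ‖ ^ 2)⁻¹ = (a ^ 2)⁻¹ * (1 + (2 * π / a * ξ) ^ 2)⁻¹ := by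
    intro ξ
    rw [norm_linePt_sq, ← mul_inv]
    congr 1
    field_simp
  simp_rw [h]
  rw [integral_const_mul, Measure.integral_comp_mul_left (fun y : ℝ => (1 + y ^ 2)⁻¹),
    integral_univ_inv_one_add_sq, abs_of_pos (by positivity), smul_eq_mul]
  field_simp

/-- The operators `A U(s)`, `s > 0`, of an analytic semigroup. -/
structure IsDerivOf (A : X →ₗ.[ℂ] X) (U V : ℝ → X →L[ℂ] X) (C : ℝ) : Prop where
  mem_graph : ∀ s > 0, ∀ x, (U s x, V s x) ∈ A.graph
  bound : ∀ s > 0, ∀ x, ‖V s x‖ ≤ C / s * ‖x‖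

variable {V : ℝ → X →L[ℂ] X} {C : ℝ}

theorem IsDerivOf.add_apply (hV : IsDerivOf A U V C) (h : IsBddSemigroup A U K) {s r : ℝ}
    (hs : 0 ≤ s) (hr : 0 < r) (x : X) : V (s + r) x = U s (V r x) := by
  have h1 := h.map_graph hs (hV.mem_graph r hr x)
  rw [← h.add s r hs hr.le] at h1
  exact graph_unique (hV.mem_graph _ (by linarith) x) h1

theorem IsDerivOf.continuousOn (hV : IsDerivOf A U V C) (h : IsBddSemigroup A U K) {s : ℝ}
    (hs : 0 < s) (x : X) : ContinuousOn (fun r => V r x) (Ici s) := by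
  have h1 : Continuous fun r => U (r - s) (V s x) := (h.cont (V s x)).comp (by fun_prop)
  refine h1.continuousOn.congr fun r (hr : s ≤ r) => ?_
  have := hV.add_apply h (sub_nonneg.2 hr) hs x
  rwa [sub_add_cancel] at this

theorem IsDerivOf.intervalIntegrable (hV : IsDerivOf A U V C) (h : IsBddSemigroup A U K)
    {s t : ℝ} (hs : 0 < s) (hst : s ≤ t) (x : X) :
    IntervalIntegrable (fun r => V r x) volume s t :=
  ((hV.continuousOn h hs x).mono (by rw [uIcc_of_le hst]; exact Icc_subset_Ici_self)).intervalIntegrable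

variable [CompleteSpace X]

/-- Bounds on `z (z + A)⁻¹` in the right half-plane give the analyticity estimate
`‖s A U(s)‖ ≤ C`. -/
theorem exists_graph_norm_le (h : IsBddSemigroup A U K)
    (hQ : ∀ z : ℂ, 0 < z.re → IsShiftInv A z (Q z))
    (hM : ∀ z : ℂ, 0 < z.re → ‖z • Q z‖ ≤ M) {s : ℝ} (hs : 0 < s) (x : X) :
    ∃ y, (U s x, y) ∈ A.graph ∧ ‖y‖ ≤ Real.exp 1 * (M ^ 2 + M ^ 3) / s * ‖x‖ := by
  have hM0 : 0 ≤ M := (norm_nonneg _).trans (hM 1 (by simp))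
  -- The abscissa `1/s` makes `e^{-as}` a constant and the integral of `|z|⁻²` over the line equal
  -- to `s/2`, which produces the rate `1/s`.
  set a := s⁻¹ with ha_def
  have ha : 0 < a := by positivity
  set q : ℝ → X →L[ℂ] X := fun ξ => Q (linePt a ξ) with hq
  have hqc : Continuous q := continuous_shiftInv_line hQ hM ha
  have hre : ∀ ξ, 0 < (linePt a ξ).re := fun ξ => by rwa [linePt_re]
  have hpos : ∀ ξ, 0 < ‖linePt a ξ‖ := fun ξ => ha.trans_le (le_norm_linePt a ξ)
  have hqb : ∀ ξ y, ‖q ξ y‖ ≤ M / ‖linePt a ξ‖ * ‖y‖ := by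
    intro ξ y
    have h1 := hM (linePt a ξ) (hre ξ)
    rw [norm_smul, mul_comm, ← le_div_iff₀ (hpos ξ)] at h1
    exact ((q ξ).le_opNorm y).trans (by gcongr)
  set f : ℝ → X := fun ξ => (2 : ℂ) • q ξ (q ξ (q ξ x)) with hf
  -- This is `A` applied to `f`, so the inversion integral of `g` is `A` applied to that of `f`.
  set g : ℝ → X := fun ξ => (2 : ℂ) • (q ξ (q ξ x) - linePt a ξ • q ξ (q ξ (q ξ x))) with hg
  have hlc : Continuous (linePt a) := by unfold linePt; fun_prop
  have hc1 : Continuous fun ξ => q ξ x := hqc.clm_apply continuous_const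
  have hc2 : Continuous fun ξ => q ξ (q ξ x) := hqc.clm_apply hc1
  have hc3 : Continuous fun ξ => q ξ (q ξ (q ξ x)) := hqc.clm_apply hc2
  have hfc : Continuous f := hc3.const_smul _
  have hgc : Continuous g := (hc2.sub (hlc.smul hc3)).const_smul _
  have hb2 : ∀ ξ, ‖q ξ (q ξ x)‖ ≤ M ^ 2 * ‖x‖ * (‖linePt a ξ‖ ^ 2)⁻¹ := by
    intro ξ
    calc _ ≤ M / ‖linePt a ξ‖ * (M / ‖linePt a ξ‖ * ‖x‖) :=
          (hqb ξ _).trans (by gcongr; exact hqb ξ _)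
      _ = _ := by have := hpos ξ; field_simp
  have hb3 : ∀ ξ, ‖q ξ (q ξ (q ξ x))‖ ≤
      M / ‖linePt a ξ‖ * (M ^ 2 * ‖x‖ * (‖linePt a ξ‖ ^ 2)⁻¹) := fun ξ =>
    (hqb ξ _).trans (by gcongr; exact hb2 ξ)
  have hfb : ∀ ξ, ‖f ξ‖ ≤ 2 * (M / a) * (M ^ 2 * ‖x‖) * (‖linePt a ξ‖ ^ 2)⁻¹ := by
    intro ξ
    have h1 : M / ‖linePt a ξ‖ ≤ M / a := by gcongr; exact le_norm_linePt a ξ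
    calc ‖f ξ‖ = 2 * ‖q ξ (q ξ (q ξ x))‖ := by simp [hf, norm_smul]
      _ ≤ 2 * (M / a * (M ^ 2 * ‖x‖ * (‖linePt a ξ‖ ^ 2)⁻¹)) := by
          gcongr
          exact (hb3 ξ).trans (by gcongr)
      _ = _ := by ring
  have hgb : ∀ ξ, ‖g ξ‖ ≤ 2 * ((M ^ 2 + M ^ 3) * ‖x‖) * (‖linePt a ξ‖ ^ 2)⁻¹ := by
    intro ξ
    calc ‖g ξ‖ = 2 * ‖q ξ (q ξ x) - linePt a ξ • q ξ (q ξ (q ξ x))‖ := by simp [hg, norm_smul]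
      _ ≤ 2 * (M ^ 2 * ‖x‖ * (‖linePt a ξ‖ ^ 2)⁻¹ + ‖linePt a ξ‖ *
          (M / ‖linePt a ξ‖ * (M ^ 2 * ‖x‖ * (‖linePt a ξ‖ ^ 2)⁻¹))) := by
          gcongr
          refine (norm_sub_le _ _).trans (add_le_add (hb2 ξ) ?_)
          rw [norm_smul]
          gcongr
          exact hb3 ξ
      _ = _ := by have := hpos ξ; field_simp
  have hI := integrable_inv_norm_linePt_sq ha
  have hfi : Integrable f := (hI.const_mul _).mono' hfc.aestronglyMeasurable (ae_of_all _ hfb)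
  have hgi : Integrable g := (hI.const_mul _).mono' hgc.aestronglyMeasurable (ae_of_all _ hgb)
  set e : ℝ → ℂ := fun ξ => Complex.exp (↑(2 * π * inner ℝ ξ s) * Complex.I) with he
  have hen : ∀ ξ, ‖e ξ‖ = 1 := fun ξ => Complex.norm_exp_ofReal_mul_I _
  have hec : Continuous e := by rw [he]; fun_prop
  have hef : Integrable fun ξ => e ξ • f ξ :=
    hfi.norm.mono' (hec.smul hfc).aestronglyMeasurable
      (ae_of_all _ fun ξ => by rw [norm_smul, hen, one_mul])
  have heg : Integrable fun ξ => e ξ • g ξ :=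
    hgi.norm.mono' (hec.smul hgc).aestronglyMeasurable
      (ae_of_all _ fun ξ => by rw [norm_smul, hen, one_mul])
  have hgraph : (∫ ξ, e ξ • f ξ, ∫ ξ, e ξ • g ξ) ∈ A.graph := by
    refine (hQ 1 (by simp)).integral_mem_graph hef heg (ae_of_all _ fun ξ => ?_)
    have h1 := (hQ (linePt a ξ) (hre ξ)).mem_graph (q ξ (q ξ x))
    exact A.graph.smul_mem (e ξ) (A.graph.smul_mem (2 : ℂ) h1)
  have hfour := fourier_orbit_two h hQ hM ha x
  have hinv : 𝓕⁻ (𝓕 (orbit U a 2 x)) s = orbit U a 2 x s := by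
    refine (h.integrable_orbit ha 2 x).fourierInv_fourier_eq (by rw [hfour]; exact hfi) ?_
    have hcont : ContinuousAt (fun r : ℝ => (r ^ 2 * Real.exp (-a * r)) • U r x) s :=
      ((by fun_prop : Continuous fun r : ℝ => r ^ 2 * Real.exp (-a * r)).smul
        (h.cont x)).continuousAt
    refine hcont.congr ?_
    filter_upwards [Ioi_mem_nhds hs] with r hr
    rw [orbit, indicator_of_mem hr]
  have hval : ∫ ξ, e ξ • f ξ = (s ^ 2 * Real.exp (-1)) • U s x := by
    rw [hfour, Real.fourierInv_eq', orbit, indicator_of_mem (show s ∈ Ioi (0 : ℝ) from hs)] at hinv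
    have h1 : -a * s = -1 := by rw [ha_def]; field_simp
    rw [h1] at hinv
    exact hinv
  have hc : s ^ 2 * Real.exp (-1) ≠ 0 := by positivity
  refine ⟨(((s ^ 2 * Real.exp (-1))⁻¹ : ℝ) : ℂ) • ∫ ξ, e ξ • g ξ, ?_, ?_⟩
  · have h1 := A.graph.smul_mem (((s ^ 2 * Real.exp (-1))⁻¹ : ℝ) : ℂ) hgraph
    rw [hval, Prod.smul_mk, Complex.coe_smul, smul_smul, inv_mul_cancel₀ hc, one_smul] at h1
    exact h1
  · have h1 : ‖∫ ξ, e ξ • g ξ‖ ≤ 2 * ((M ^ 2 + M ^ 3) * ‖x‖) * (2 * a)⁻¹ := by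
      rw [← integral_inv_norm_linePt_sq ha, ← integral_const_mul]
      refine norm_integral_le_of_norm_le (hI.const_mul _) (ae_of_all _ fun ξ => ?_)
      rw [norm_smul, hen, one_mul]
      exact hgb ξ
    rw [norm_smul, Complex.norm_real, Real.norm_of_nonneg (by positivity)]
    calc _ ≤ (s ^ 2 * Real.exp (-1))⁻¹ * (2 * ((M ^ 2 + M ^ 3) * ‖x‖) * (2 * a)⁻¹) := by gcongr
      _ = _ := by
        rw [ha_def, Real.exp_neg]
        field_simp

theorem exists_isDerivOf (h : IsBddSemigroup A U K)
    (hQ : ∀ z : ℂ, 0 < z.re → IsShiftInv A z (Q z))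
    (hM : ∀ z : ℂ, 0 < z.re → ‖z • Q z‖ ≤ M) :
    ∃ V, IsDerivOf A U V (Real.exp 1 * (M ^ 2 + M ^ 3)) := by
  have hex : ∀ s : ℝ, ∃ Vs : X →L[ℂ] X, 0 < s → ∀ x, (U s x, Vs x) ∈ A.graph ∧
      ‖Vs x‖ ≤ Real.exp 1 * (M ^ 2 + M ^ 3) / s * ‖x‖ := by
    intro s
    by_cases hs : 0 < s
    · choose v hv hb using fun x => exists_graph_norm_le h hQ hM hs x
      refine ⟨LinearMap.mkContinuous ⟨⟨v, fun x y => ?_⟩, fun c x => ?_⟩ _ hb,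
        fun _ x => ⟨hv x, hb x⟩⟩
      · have h1 := A.graph.add_mem (hv x) (hv y)
        rw [Prod.mk_add_mk, ← map_add] at h1
        exact graph_unique (hv _) h1
      · have h1 := A.graph.smul_mem c (hv x)
        rw [Prod.smul_mk, ← map_smul] at h1
        exact graph_unique (hv _) h1
    · exact ⟨0, fun h => absurd h hs⟩
  choose V hV using hex
  exact ⟨V, fun s hs x => (hV s hs x).1, fun s hs x => (hV s hs x).2⟩

theorem IsDerivOf.sub_eq_integral (hV : IsDerivOf A U V C) (h : IsBddSemigroup A U K)
    {z : ℂ} {R : X →L[ℂ] X} (hR : IsShiftInv A z R) {s t : ℝ} (hs : 0 < s) (hst : s ≤ t) (x : X) :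
    U s x - U t x = ∫ r in s..t, V r x := by
  have h1 := h.integral_mem_graph 0 (sub_nonneg.2 hst) (U s x)
  simp only [neg_zero, zero_mul, Complex.exp_zero, one_smul, zero_smul, sub_zero] at h1
  rw [← h.add _ _ (sub_nonneg.2 hst) hs.le, sub_add_cancel] at h1
  have h2 : ∫ r in 0..t - s, U r (U s x) = ∫ r in s..t, U r x := by
    have e : ∀ r ∈ uIcc 0 (t - s), U r (U s x) = U (r + s) x := by
      intro r hr
      rw [uIcc_of_le (sub_nonneg.2 hst)] at hr
      rw [h.add _ _ hr.1 hs.le]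
    rw [intervalIntegral.integral_congr e,
      intervalIntegral.integral_comp_add_right (fun r => U r x)]
    simp
  rw [h2] at h1
  refine graph_unique h1 ?_
  rw [intervalIntegral.integral_of_le hst, intervalIntegral.integral_of_le hst]
  refine hR.integral_mem_graph ?_ ?_ ?_
  · exact (intervalIntegrable_iff_integrableOn_Ioc_of_le hst).1 ((h.cont x).intervalIntegrable _ _)
  · exact (intervalIntegrable_iff_integrableOn_Ioc_of_le hst).1 (hV.intervalIntegrable h hs hst x)
  · exact ae_restrict_of_forall_mem measurableSet_Ioc fun r hr =>
      hV.mem_graph r (hs.trans hr.1) x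

theorem IsDerivOf.norm_sub_le (hV : IsDerivOf A U V C) (h : IsBddSemigroup A U K) (hC : 0 ≤ C)
    {z : ℂ} {R : X →L[ℂ] X} (hR : IsShiftInv A z R) {s t : ℝ} (hs : 0 < s) (hst : s ≤ t) (x : X) :
    ‖U s x - U t x‖ ≤ C / s * ‖x‖ * (t - s) := by
  rw [hV.sub_eq_integral h hR hs hst, ← abs_of_nonneg (sub_nonneg.2 hst)]
  refine intervalIntegral.norm_integral_le_of_norm_le_const fun r hr => ?_
  rw [uIoc_of_le hst] at hr
  exact (hV.bound r (hs.trans hr.1) x).trans (by gcongr; exact hr.1.le)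

/-- Second order Taylor estimate for the semigroup. -/
theorem IsDerivOf.norm_taylor_le (hV : IsDerivOf A U V C) (h : IsBddSemigroup A U K) (hC : 0 ≤ C)
    {z : ℂ} {R : X →L[ℂ] X} (hR : IsShiftInv A z R) {s t : ℝ} (hs : 0 < s) (hst : s ≤ t) (x : X) :
    ‖U s x - U t x - (t - s) • V s x‖ ≤ (2 * C / s) ^ 2 * ‖x‖ * (t - s) ^ 2 := by
  have hd : ∀ r ∈ Ioc s t, ‖V r x - V s x‖ ≤ (2 * C / s) ^ 2 * ‖x‖ * (t - s) := by
    intro r hr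
    -- Half of the time is spent on one factor `A`, the other half on the Lipschitz bound for `U`;
    -- this replaces an estimate of `A² U`.
    have e1 : V r x = U (r - s / 2) (V (s / 2) x) := by
      rw [← hV.add_apply h (by linarith [hr.1]) (by positivity), sub_add_cancel]
    have e2 : V s x = U (s / 2) (V (s / 2) x) := by
      rw [← hV.add_apply h (by positivity) (by positivity), add_halves]
    rw [e1, e2, norm_sub_rev]
    refine (hV.norm_sub_le h hC hR (by positivity) (by linarith [hr.1]) _).trans ?_
    calc _ ≤ C / (s / 2) * (C / (s / 2) * ‖x‖) * (t - s) := by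
          exact mul_le_mul (mul_le_mul_of_nonneg_left (hV.bound _ (by positivity) x)
            (by positivity)) (by linarith [hr.2]) (by linarith [hr.1]) (by positivity)
      _ = _ := by field_simp
  have hc : ∫ _ in s..t, V s x = (t - s) • V s x := intervalIntegral.integral_const _
  rw [hV.sub_eq_integral h hR hs hst, ← hc, ← intervalIntegral.integral_sub
    (hV.intervalIntegrable h hs hst x) intervalIntegrable_const]
  refine (intervalIntegral.norm_integral_le_of_norm_le_const fun r hr => hd r ?_).trans
    (le_of_eq ?_)
  · rwa [uIoc_of_le hst] at hr
  · rw [abs_of_nonneg (sub_nonneg.2 hst)]; ring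

/-- The representation of the resolvent used for the final absorption argument. -/
theorem IsDerivOf.smul_shiftInv_eq (hV : IsDerivOf A U V C) (h : IsBddSemigroup A U K)
    {z : ℂ} (hz : z ≠ 0) {R : X →L[ℂ] X} (hR : IsShiftInv A z R) {t : ℝ} (ht : 0 < t) (x : X) :
    z • R x = z • (∫ s in 0..t, Complex.exp (-z * s) • U s x) + Complex.exp (-z * t) • U t x -
      (Complex.exp (-z * t) * z⁻¹) • V t (z • R x) := by
  -- Working with the integral over `[0, t]` makes sense for every `z`, including `Re z ≤ 0`, where
  -- the full Laplace integral need not converge.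
  have h1 := hR.apply_eq (h.integral_mem_graph z ht.le x)
  rw [add_sub_cancel, map_sub, map_smul] at h1
  have h2 := h.map_graph ht.le (hR.mem_graph x)
  have h3 := graph_unique (hV.mem_graph t ht (R x)) h2
  have h4 := hR.apply_eq h2
  simp only [map_sub, map_smul] at h3 h4
  rw [add_sub_cancel] at h4
  rw [map_smul, h3, ← h1, h4, smul_smul, mul_assoc, inv_mul_cancel₀ hz, mul_one]
  module

end Analytic

/-! ### Sectors as cones `|Im z| cos φ ≤ sin φ Re z`. -/

section Sector

theorem sector_subset_cone {φ : ℝ} (hφ : φ ∈ Ioo 0 (π / 2)) :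
    sector φ ⊆ {z : ℂ | |z.im| * Real.cos φ ≤ Real.sin φ * z.re} := by
  rintro z ⟨-, hz⟩
  have h1 : |z.im| = ‖z‖ * Real.sin |z.arg| := by
    rw [← Complex.norm_mul_sin_arg, abs_mul, abs_of_nonneg (norm_nonneg z),
      Real.abs_sin_eq_sin_abs_of_abs_le_pi (Complex.abs_arg_le_pi z)]
  have h2 : z.re = ‖z‖ * Real.cos |z.arg| := by
    rw [Real.cos_abs, Complex.norm_mul_cos_arg]
  have h3 : 0 ≤ Real.sin (φ - |z.arg|) :=
    Real.sin_nonneg_of_nonneg_of_le_pi (by linarith)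
      (by linarith [abs_nonneg z.arg, hφ.2, Real.pi_pos])
  rw [Real.sin_sub] at h3
  rw [mem_ofPred_eq, h1, h2]
  nlinarith [norm_nonneg z]

theorem closure_sector_subset_cone {φ : ℝ} (hφ : φ ∈ Ioo 0 (π / 2)) {z : ℂ}
    (hz : z ∈ closure (sector φ)) : |z.im| * Real.cos φ ≤ Real.sin φ * z.re :=
  closure_minimal (sector_subset_cone hφ) (isClosed_le (by fun_prop) (by fun_prop)) hz

theorem mem_sector_of_lt {θ : ℝ} (hθ : θ ∈ Ioo 0 (π / 2)) {z : ℂ}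
    (hz : |z.im| * Real.cos θ < Real.sin θ * z.re) : z ∈ sector θ := by
  have hs : 0 < Real.sin θ := Real.sin_pos_of_pos_of_lt_pi hθ.1 (by linarith [hθ.2, Real.pi_pos])
  have hc : 0 < Real.cos θ := Real.cos_pos_of_mem_Ioo ⟨by linarith [hθ.1, Real.pi_pos], hθ.2⟩
  have hre : 0 < z.re := by
    have : 0 < Real.sin θ * z.re := (mul_nonneg (abs_nonneg _) hc.le).trans_lt hz
    exact (mul_pos_iff_of_pos_left hs).1 this
  have hz0 : z ≠ 0 := by rintro rfl; simp at hre
  have harg : |z.arg| < π / 2 := Complex.abs_arg_lt_pi_div_two_iff.2 (Or.inl hre)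
  refine ⟨hz0, ?_⟩
  have h1 : |z.im| = ‖z‖ * Real.sin |z.arg| := by
    rw [← Complex.norm_mul_sin_arg, abs_mul, abs_of_nonneg (norm_nonneg z),
      Real.abs_sin_eq_sin_abs_of_abs_le_pi (Complex.abs_arg_le_pi z)]
  have h2 : z.re = ‖z‖ * Real.cos |z.arg| := by
    rw [Real.cos_abs, Complex.norm_mul_cos_arg]
  by_contra! hcon
  have h3 : 0 ≤ Real.sin (|z.arg| - θ) :=
    Real.sin_nonneg_of_nonneg_of_le_pi (by linarith) (by linarith [hθ.1, Real.pi_pos])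
  rw [Real.sin_sub] at h3
  rw [h1, h2] at hz
  nlinarith [norm_nonneg z]

/-- Moving `z` to the right by any `ε > 0` makes the inequality strict. -/
theorem mem_closure_sector_of_le {θ : ℝ} (hθ : θ ∈ Ioo 0 (π / 2)) {z : ℂ}
    (hz : |z.im| * Real.cos θ ≤ Real.sin θ * z.re) : z ∈ closure (sector θ) := by
  have hs : 0 < Real.sin θ := Real.sin_pos_of_pos_of_lt_pi hθ.1 (by linarith [hθ.2, Real.pi_pos])
  have h1 : Tendsto (fun ε : ℝ => z + (ε : ℂ)) (𝓝[>] 0) (𝓝 z) := by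
    have : Continuous fun ε : ℝ => z + (ε : ℂ) := by fun_prop
    have h2 := this.tendsto 0
    simp only [Complex.ofReal_zero, add_zero] at h2
    exact h2.mono_left nhdsWithin_le_nhds
  refine mem_closure_of_tendsto h1 ?_
  filter_upwards [self_mem_nhdsWithin] with ε (hε : 0 < ε)
  refine mem_sector_of_lt hθ ?_
  simp only [Complex.add_im, Complex.ofReal_im, add_zero, Complex.add_re, Complex.ofReal_re]
  nlinarith

theorem mem_closure_sector_of_sub {φ θ ω : ℝ} (hφ : φ ∈ Ioo 0 (π / 2)) (hθ : θ ∈ Ioo φ (π / 2))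
    (hω : 0 ≤ ω) {z : ℂ} (hz : z - ω ∈ closure (sector φ)) : z ∈ closure (sector θ) := by
  have h := closure_sector_subset_cone hφ hz
  simp only [Complex.sub_im, Complex.ofReal_im, sub_zero, Complex.sub_re, Complex.ofReal_re] at h
  have hs : 0 < Real.sin φ := Real.sin_pos_of_pos_of_lt_pi hφ.1 (by linarith [hφ.2, Real.pi_pos])
  have hc : 0 < Real.cos φ := Real.cos_pos_of_mem_Ioo ⟨by linarith [hφ.1, Real.pi_pos], hφ.2⟩
  have hc' : 0 < Real.cos θ := Real.cos_pos_of_mem_Ioo ⟨by linarith [hφ.1, hθ.1, Real.pi_pos], hθ.2⟩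
  have h2 : |z.im| * Real.cos φ ≤ Real.sin φ * z.re := by nlinarith
  have hre : 0 ≤ z.re := by
    have : 0 ≤ Real.sin φ * z.re := (mul_nonneg (abs_nonneg _) hc.le).trans h2
    exact (mul_nonneg_iff_of_pos_left hs).1 this
  have h3 : 0 ≤ Real.sin (θ - φ) :=
    Real.sin_nonneg_of_nonneg_of_le_pi (by linarith [hθ.1]) (by linarith [hφ.1, hθ.2, Real.pi_pos])
  rw [Real.sin_sub] at h3
  refine mem_closure_sector_of_le ⟨hφ.1.trans hθ.1, hθ.2⟩ ?_
  have h4 : Real.cos φ * (|z.im| * Real.cos θ) ≤ Real.cos φ * (Real.sin θ * z.re) := by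
    nlinarith [mul_le_mul_of_nonneg_right h2 hc'.le, mul_nonneg h3 hre]
  exact le_of_mul_le_mul_left h4 hc

theorem notMem_closure_sector_of_re_neg {φ : ℝ} (hφ : φ ∈ Ioo 0 (π / 2)) {z : ℂ}
    (hz : z.re < 0) : z ∉ closure (sector φ) := by
  intro h
  have h1 := closure_sector_subset_cone hφ h
  have hs : 0 < Real.sin φ := Real.sin_pos_of_pos_of_lt_pi hφ.1 (by linarith [hφ.2, Real.pi_pos])
  have hc : 0 < Real.cos φ := Real.cos_pos_of_mem_Ioo ⟨by linarith [hφ.1, Real.pi_pos], hφ.2⟩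
  nlinarith [abs_nonneg z.im, mul_nonneg (abs_nonneg z.im) hc.le]

theorem re_le_of_notMem_closure_sector {θ : ℝ} (hθ : θ ∈ Ioo 0 (π / 2)) {z : ℂ}
    (hz : z ∉ closure (sector θ)) : z.re ≤ ‖z‖ * Real.cos θ := by
  by_contra! hcon
  refine hz (mem_closure_sector_of_le hθ ?_)
  have hs : 0 < Real.sin θ := Real.sin_pos_of_pos_of_lt_pi hθ.1 (by linarith [hθ.2, Real.pi_pos])
  have hc : 0 < Real.cos θ := Real.cos_pos_of_mem_Ioo ⟨by linarith [hθ.1, Real.pi_pos], hθ.2⟩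
  have hre : 0 ≤ z.re := (mul_nonneg (norm_nonneg _) hc.le).trans hcon.le
  refine abs_le_of_sq_le_sq' ?_ (by positivity) |>.2
  have h1 : ‖z‖ ^ 2 = z.re ^ 2 + z.im ^ 2 := by
    rw [Complex.sq_norm, Complex.normSq_apply]; ring
  have h2 : (‖z‖ * Real.cos θ) ^ 2 ≤ z.re ^ 2 := by gcongr
  have h3 := Real.sin_sq_add_cos_sq θ
  rw [mul_pow, mul_pow, sq_abs]
  rw [mul_pow, h1] at h2
  have h4 : Real.sin θ ^ 2 = 1 - Real.cos θ ^ 2 := by linarith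
  rw [h4]
  linarith

theorem ne_zero_of_notMem_closure_sector {θ : ℝ} (hθ : θ ∈ Ioo 0 (π / 2)) {z : ℂ}
    (hz : z ∉ closure (sector θ)) : z ≠ 0 := by
  rintro rfl
  exact hz (mem_closure_sector_of_le hθ (by simp))

end Sector

/-! ### The shifted operator `A + ω` and its rescaled semigroup. -/

section Shift

variable {X : Type*} [NormedAddCommGroup X] [NormedSpace ℂ X] {A : X →ₗ.[ℂ] X}

theorem isResolventAt_resolvent {z : ℂ} (hz : z ∈ resolventSet A) :
    IsResolventAt A z (resolvent A z) := by
  have hz' : ∃ R : X →L[ℂ] X, IsResolventAt A z R := hz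
  rw [resolvent, dif_pos hz']
  exact hz'.choose_spec

theorem IsResolventAt.unique {z : ℂ} {R R' : X →L[ℂ] X} (h : IsResolventAt A z R)
    (h' : IsResolventAt A z R') : R = R' := by
  ext x
  obtain ⟨hx, h1⟩ := h'.1 x
  have := h.2 ⟨R' x, hx⟩
  rw [h1] at this
  exact this

theorem isResolventAt_addScalar_iff {ω : ℝ} {z : ℂ} {R : X →L[ℂ] X} :
    IsResolventAt (addScalar A ω) z R ↔ IsResolventAt A (z - ω) R := by
  have e : ∀ y : A.domain, z • (y : X) - addScalar A ω y = (z - ω) • (y : X) - A y := by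
    intro y
    have : addScalar A ω y = (ω : ℂ) • (y : X) + A y := rfl
    rw [this, sub_smul]; abel
  constructor
  · rintro ⟨h1, h2⟩
    refine ⟨fun x => ?_, fun y => ?_⟩
    · obtain ⟨h, hx⟩ := h1 x
      exact ⟨h, (e ⟨R x, h⟩).symm.trans hx⟩
    · rw [← e y]; exact h2 y
  · rintro ⟨h1, h2⟩
    refine ⟨fun x => ?_, fun y => ?_⟩
    · obtain ⟨h, hx⟩ := h1 x
      exact ⟨h, (e ⟨R x, h⟩).trans hx⟩
    · exact (congrArg R (e y)).trans (h2 y)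

theorem mem_graph_addScalar_iff {ω : ℝ} {x y : X} :
    (x, y) ∈ (addScalar A ω).graph ↔ (x, y - (ω : ℂ) • x) ∈ A.graph := by
  rw [LinearPMap.mem_graph_iff, LinearPMap.mem_graph_iff]
  constructor
  · rintro ⟨w, hw, h⟩
    refine ⟨w, hw, ?_⟩
    have : addScalar A ω w = (ω : ℂ) • (w : X) + A w := rfl
    simp only at h hw ⊢
    rw [← h, ← hw, this, add_sub_cancel_left]
  · rintro ⟨w, hw, h⟩
    refine ⟨w, hw, ?_⟩
    have : addScalar A ω w = (ω : ℂ) • (w : X) + A w := rfl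
    simp only at h hw ⊢
    rw [this, h, hw, add_sub_cancel]

theorem resolventSet_addScalar {ω : ℝ} {z : ℂ} :
    z ∈ resolventSet (addScalar A ω) ↔ z - ω ∈ resolventSet A :=
  exists_congr fun _ => isResolventAt_addScalar_iff

theorem resolvent_addScalar {ω : ℝ} {z : ℂ} (hz : z - ω ∈ resolventSet A) :
    resolvent (addScalar A ω) z = resolvent A (z - ω) :=
  IsResolventAt.unique (isResolventAt_resolvent (resolventSet_addScalar.2 hz))
    (isResolventAt_addScalar_iff.2 (isResolventAt_resolvent hz))

/-- The rescaled semigroup `e^{-ωs} S(s)`, extended by the identity to negative times. -/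
def rescale (S : ℝ → X →L[ℂ] X) (ω : ℝ) (s : ℝ) : X →L[ℂ] X :=
  ((Real.exp (-ω * max s 0) : ℝ) : ℂ) • S (max s 0)

theorem rescale_of_nonneg (S : ℝ → X →L[ℂ] X) (ω : ℝ) {s : ℝ} (hs : 0 ≤ s) :
    rescale S ω s = ((Real.exp (-ω * s) : ℝ) : ℂ) • S s := by
  rw [rescale, max_eq_left hs]

theorem rescale_max (S : ℝ → X →L[ℂ] X) (ω s : ℝ) : rescale S ω (max s 0) = rescale S ω s := by
  rw [rescale, rescale, max_eq_left (le_max_right s 0)]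

variable {S : ℝ → X →L[ℂ] X} {ω K : ℝ}

theorem tendsto_rescale (hS : IsC0Semigroup S) (x : X) :
    Tendsto (fun s => rescale S ω s x) (𝓝[>] 0) (𝓝 x) := by
  have h1 : Tendsto (fun s : ℝ => ((Real.exp (-ω * s) : ℝ) : ℂ)) (𝓝[>] 0) (𝓝 1) := by
    have : Continuous fun s : ℝ => ((Real.exp (-ω * s) : ℝ) : ℂ) := by fun_prop
    have h2 := this.tendsto 0
    simp only [mul_zero, Real.exp_zero, Complex.ofReal_one] at h2
    exact h2.mono_left nhdsWithin_le_nhds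
  have h2 := h1.smul (hS.2.2 x)
  rw [one_smul] at h2
  refine h2.congr' ?_
  filter_upwards [self_mem_nhdsWithin] with s (hs : 0 < s)
  rw [rescale_of_nonneg S ω hs.le, smul_apply]

theorem rescale_zero (hS : IsC0Semigroup S) (x : X) : rescale S ω 0 x = x := by
  rw [rescale_of_nonneg S ω le_rfl, hS.1]
  simp

theorem rescale_add (hS : IsC0Semigroup S) {s r : ℝ} (hs : 0 ≤ s) (hr : 0 ≤ r) (x : X) :
    rescale S ω (s + r) x = rescale S ω s (rescale S ω r x) := by
  rw [rescale_of_nonneg S ω hs, rescale_of_nonneg S ω hr, rescale_of_nonneg S ω (add_nonneg hs hr),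
    hS.2.1 s r hs hr]
  simp only [smul_apply, ContinuousLinearMap.comp_apply, map_smul, smul_smul]
  rw [← Complex.ofReal_mul, ← Real.exp_add, mul_add, add_comm]

theorem norm_rescale_le (hS : IsC0Semigroup S) (hK : ∀ s > 0, ‖rescale S ω s‖ ≤ K) (s : ℝ) (x : X) :
    ‖rescale S ω s x‖ ≤ K * ‖x‖ := by
  have h1 : ∀ r > 0, ‖rescale S ω r x‖ ≤ K * ‖x‖ := fun r hr =>
    ((rescale S ω r).le_opNorm x).trans (by gcongr; exact hK r hr)
  rcases lt_or_ge 0 s with hs | hs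
  · exact h1 s hs
  · rw [← rescale_max, max_eq_right hs, rescale_zero hS]
    -- At time 0 the bound `‖x‖ ≤ K ‖x‖` is a limit of the bounds at positive times; `1 ≤ K` is not
    -- assumed, and can fail when `X` is trivial.
    refine le_of_tendsto (tendsto_rescale (ω := ω) hS x).norm ?_
    filter_upwards [self_mem_nhdsWithin] with r hr
    exact h1 r hr

/-- The semigroup law and the uniform bound reduce every increment to one starting at time 0, so
continuity from the right at 0 is enough. -/
theorem continuous_rescale (hS : IsC0Semigroup S) (hK : ∀ s > 0, ‖rescale S ω s‖ ≤ K) (x : X) :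
    Continuous fun s => rescale S ω s x := by
  have hψ : Tendsto (fun d : ℝ => K * ‖rescale S ω |d| x - x‖) (𝓝 0) (𝓝 0) := by
    have h1 : Tendsto (fun d => rescale S ω d x) (𝓝[≥] 0) (𝓝 x) := by
      rw [← Ioi_insert, nhdsWithin_insert, tendsto_sup]
      refine ⟨?_, tendsto_rescale hS x⟩
      rw [tendsto_pure_left]
      intro s hs
      rw [rescale_zero hS]
      exact mem_of_mem_nhds hs
    have h2 : Tendsto (fun d : ℝ => |d|) (𝓝 0) (𝓝[≥] 0) :=
      tendsto_nhdsWithin_iff.2 ⟨by simpa using (continuous_abs : Continuous fun d : ℝ => |d|).tendsto 0,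
        Eventually.of_forall fun d => abs_nonneg d⟩
    have h3 := ((h1.comp h2).sub_const x).norm.const_mul K
    simpa using h3
  have hle : ∀ r s, 0 ≤ r → r ≤ s →
      ‖rescale S ω s x - rescale S ω r x‖ ≤ K * ‖rescale S ω |s - r| x - x‖ := by
    intro r s hr hrs
    rw [abs_of_nonneg (sub_nonneg.2 hrs)]
    have : rescale S ω s x = rescale S ω r (rescale S ω (s - r) x) := by
      rw [← rescale_add hS hr (sub_nonneg.2 hrs), add_sub_cancel]
    rw [this, ← map_sub]
    exact norm_rescale_le hS hK r _
  rw [continuous_iff_continuousAt]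
  intro r
  rw [ContinuousAt, tendsto_iff_norm_sub_tendsto_zero]
  have h4 : Tendsto (fun s : ℝ => max s 0 - max r 0) (𝓝 r) (𝓝 0) := by
    have : Continuous fun s : ℝ => max s 0 - max r 0 := by fun_prop
    simpa using this.tendsto r
  refine squeeze_zero (fun _ => norm_nonneg _) (fun s => ?_) (hψ.comp h4)
  simp only [Function.comp_apply]
  rw [← rescale_max S ω s, ← rescale_max S ω r]
  rcases le_total (max r 0) (max s 0) with h | h
  · exact hle _ _ (le_max_right _ _) h
  · rw [norm_sub_rev, abs_sub_comm]
    exact hle _ _ (le_max_right _ _) h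

theorem isBddSemigroup_rescale (hS : IsC0Semigroup S) (hgen : IsGeneratorOf (-A) S)
    (hK : ∀ s > 0, ‖rescale S ω s‖ ≤ K) : IsBddSemigroup (addScalar A ω) (rescale S ω) K where
  zero := rescale_zero hS
  add _ _ hs hr x := rescale_add hS hs hr x
  cont := continuous_rescale hS hK
  bound := norm_rescale_le hS hK
  gen x y := by
    have hneg : (x, y - (ω : ℂ) • x) ∈ A.graph ↔ (x, (ω : ℂ) • x - y) ∈ (-A).graph := by
      rw [LinearPMap.mem_graph_iff, LinearPMap.mem_graph_iff]
      constructor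
      · rintro ⟨w, hw, h⟩
        refine ⟨w, hw, ?_⟩
        have : (-A) w = -(A w) := rfl
        simp only at h ⊢
        rw [this, h, neg_sub]
      · rintro ⟨w, hw, h⟩
        refine ⟨w, hw, ?_⟩
        have : (-A) w = -(A w) := rfl
        simp only at h ⊢
        rw [this] at h
        rw [← neg_sub, ← h, neg_neg]
    rw [mem_graph_addScalar_iff, hneg, hgen]
    have hd : Tendsto (fun s : ℝ => (s : ℂ)⁻¹ * (((Real.exp (-ω * s) : ℝ) : ℂ) - 1)) (𝓝[>] 0)
        (𝓝 (-ω : ℂ)) := by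
      have h1 : HasDerivAt (fun s : ℝ => ((Real.exp (-ω * s) : ℝ) : ℂ)) ((-ω : ℝ) : ℂ) 0 := by
        have := (((hasDerivAt_id (0 : ℝ)).const_mul (-ω)).exp).ofReal_comp
        simpa using this
      have h2 := h1.tendsto_slope_zero_right
      simp only [zero_add, mul_zero, Real.exp_zero, Complex.ofReal_one] at h2
      rw [Complex.ofReal_neg] at h2
      refine h2.congr fun s => ?_
      rw [Complex.real_smul, Complex.ofReal_inv]
    have he : ∀ c : ℝ, Tendsto (fun s : ℝ => ((Real.exp (c * s) : ℝ) : ℂ)) (𝓝[>] 0) (𝓝 1) := by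
      intro c
      have : Continuous fun s : ℝ => ((Real.exp (c * s) : ℝ) : ℂ) := by fun_prop
      have h2 := this.tendsto 0
      simp only [mul_zero, Real.exp_zero, Complex.ofReal_one] at h2
      exact h2.mono_left nhdsWithin_le_nhds
    have hdx := hd.smul (tendsto_const_nhds (x := x) (f := 𝓝[>] (0 : ℝ)))
    constructor
    · intro h
      have h1 := ((he (-ω)).smul h).add hdx
      have e1 : (1 : ℂ) • ((ω : ℂ) • x - y) + (-ω : ℂ) • x = -y := by
        rw [one_smul, neg_smul]; abel
      rw [e1] at h1
      refine h1.congr' ?_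
      filter_upwards [self_mem_nhdsWithin] with s (hs : 0 < s)
      rw [rescale_of_nonneg S ω hs.le, smul_apply]
      module
    · intro h
      have h1 := (he ω).smul (h.sub hdx)
      have e1 : (1 : ℂ) • (-y - (-ω : ℂ) • x) = (ω : ℂ) • x - y := by
        rw [one_smul, neg_smul]; abel
      rw [e1] at h1
      refine h1.congr' ?_
      filter_upwards [self_mem_nhdsWithin] with s (hs : 0 < s)
      rw [rescale_of_nonneg S ω hs.le, smul_apply]
      have e2 : ((Real.exp (ω * s) : ℝ) : ℂ) * ((Real.exp (-ω * s) : ℝ) : ℂ) = 1 := by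
        rw [← Complex.ofReal_mul, ← Real.exp_add]; simp
      have e3 : (s : ℂ)⁻¹ • (((Real.exp (-ω * s) : ℝ) : ℂ) • S s x - x) -
          ((s : ℂ)⁻¹ * (((Real.exp (-ω * s) : ℝ) : ℂ) - 1)) • x =
          ((Real.exp (-ω * s) : ℝ) : ℂ) • ((s : ℂ)⁻¹ • (S s x - x)) := by module
      rw [e3, smul_smul, e2, one_smul]

end Shift

/-! ### Assembling the resolvent estimate. -/

section Main

open scoped NNReal

/-- The mass of a Gaussian of width `4βs` is `(4πβs)^(N/2)`, which cancels `s^(-N/2)`, while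
`e^{-ωs}` beats `e^{ω₁s}`. The resulting constant depends on neither `s` nor `ω`. -/
theorem gaussDom_rescale {N : ℕ} {Ω : Set (EuclideanSpace ℝ (Fin N))} (hΩ : MeasurableSet Ω)
    {p : ℝ≥0∞} [Fact (1 ≤ p)]
    {S : ℝ → Lp ℂ p (volume.restrict Ω) →L[ℂ] Lp ℂ p (volume.restrict Ω)}
    {κ : EuclideanSpace ℝ (Fin N) → EuclideanSpace ℝ (Fin N) → ℂ} {C β ω₁ ω s : ℝ} (hC : 0 ≤ C)
    (hβ : 0 < β) (hs : 0 < s) (hω : ω₁ ≤ ω) (hκ : IsGivenByKernel (S s) κ)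
    (hG : ∀ᵐ z ∂((volume.restrict Ω).prod (volume.restrict Ω)),
      ‖κ z.1 z.2‖ ≤ C * s ^ (-(N : ℝ) / 2) * Real.exp (ω₁ * s) *
        Real.exp (-(‖z.1 - z.2‖ ^ 2 / (4 * β * s)))) :
    GaussDom (C * (4 * π * β) ^ (N / 2 : ℝ)).toNNReal (4 * β * s) (rescale S ω s) := by
  intro f
  rw [rescale_of_nonneg S ω hs.le]
  filter_upwards [hκ.2 f, Measure.ae_ae_of_ae_prod hG,
    Lp.coeFn_smul ((Real.exp (-ω * s) : ℝ) : ℂ) (S s f)] with x hx hGx hsm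
  set a := C * s ^ (-(N : ℝ) / 2) * Real.exp (ω₁ * s) with ha
  have ha0 : 0 ≤ a := by positivity
  have hb : 0 < 4 * β * s := by positivity
  have hmass : ENNReal.ofReal (Real.exp (-ω * s)) * ENNReal.ofReal a ≤
      (C * (4 * π * β) ^ (N / 2 : ℝ)).toNNReal *
        (gaussMass (EuclideanSpace ℝ (Fin N)) (4 * β * s))⁻¹ := by
    rw [gaussMass_eq _ hb, finrank_euclideanSpace, Fintype.card_fin,
      ← ENNReal.ofReal_inv_of_pos (by positivity), ← ENNReal.ofReal,
      ← ENNReal.ofReal_mul (by positivity), ← ENNReal.ofReal_mul (by positivity)]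
    refine ENNReal.ofReal_le_ofReal ?_
    have e1 : (π * (4 * β * s)) ^ (N / 2 : ℝ) = (4 * π * β) ^ (N / 2 : ℝ) * s ^ (N / 2 : ℝ) := by
      rw [← Real.mul_rpow (by positivity) hs.le]; congr 1; ring
    have e2 : s ^ (-(N : ℝ) / 2) = (s ^ (N / 2 : ℝ))⁻¹ := by
      rw [neg_div, Real.rpow_neg hs.le]
    have e3 : Real.exp (-ω * s) * Real.exp (ω₁ * s) ≤ 1 := by
      rw [← Real.exp_add, Real.exp_le_one_iff]
      nlinarith
    have e4 : 0 < (4 * π * β) ^ (N / 2 : ℝ) := by positivity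
    have e5 : 0 < s ^ (N / 2 : ℝ) := by positivity
    rw [ha, e1, e2]
    calc _ = C * (s ^ (N / 2 : ℝ))⁻¹ * (Real.exp (-ω * s) * Real.exp (ω₁ * s)) := by ring
      _ ≤ C * (s ^ (N / 2 : ℝ))⁻¹ * 1 := by gcongr
      _ = _ := by field_simp
  have hint : ‖S s f x‖ₑ ≤ ENNReal.ofReal a * ∫⁻ y in Ω, gauss (4 * β * s) (x - y) * ‖f y‖ₑ := by
    rw [hx.2, ← lintegral_const_mul' _ _ ENNReal.ofReal_ne_top]
    refine (enorm_integral_le_lintegral_enorm _).trans (lintegral_mono_ae ?_)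
    filter_upwards [hGx] with y hy
    rw [enorm_mul, ← mul_assoc, gauss, ← ENNReal.ofReal_mul ha0, ← ofReal_norm]
    gcongr
  rw [smul_apply, hsm, Pi.smul_apply, enorm_smul, gaussAvg, lintegral_gauss_mul_absExt hΩ,
    ← ofReal_norm, Complex.norm_real, Real.norm_of_nonneg (Real.exp_pos _).le]
  calc _ ≤ ENNReal.ofReal (Real.exp (-ω * s)) *
        (ENNReal.ofReal a * ∫⁻ y in Ω, gauss (4 * β * s) (x - y) * ‖f y‖ₑ) := by gcongr
    _ ≤ _ := by
      rw [← mul_assoc, ← mul_assoc]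
      gcongr

/-! ### Decomposing the resolvent on a Banach space. -/

section Abstract

variable {X : Type*} [NormedAddCommGroup X] [NormedSpace ℂ X] {A : X →ₗ.[ℂ] X}
  {U V : ℝ → X →L[ℂ] X} {φ ω K M C : ℝ}

theorem isShiftInv_addScalar (hσ : spectrum A ⊆ closure (sector φ))
    {z : ℂ} (hz : -z - ω ∉ closure (sector φ)) :
    IsShiftInv (addScalar A ω) z (-resolvent (addScalar A ω) (-z)) := by
  have h1 : -z - ω ∈ resolventSet A := not_not.1 fun h => hz (hσ h)
  have := (isResolventAt_resolvent (resolventSet_addScalar.2 h1)).isShiftInv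
  rwa [neg_neg] at this

/-- For `Re z > 0` and `ω ≥ 0` one has `|z| ≤ |-z - ω|`, so the resolvent bound of `A` carries over
to `A + ω` with the same `M`. -/
theorem exists_isDerivOf_addScalar [CompleteSpace X] (hφ : φ ∈ Ioo 0 (π / 2))
    (hσ : spectrum A ⊆ closure (sector φ)) (hM : ∀ z ∉ closure (sector φ), ‖z • resolvent A z‖ ≤ M)
    (hω : 0 ≤ ω) (h : IsBddSemigroup (addScalar A ω) U K) :
    ∃ V, IsDerivOf (addScalar A ω) U V (Real.exp 1 * (M ^ 2 + M ^ 3)) := by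
  have hz : ∀ z : ℂ, 0 < z.re → -z - ω ∉ closure (sector φ) := fun z hz =>
    notMem_closure_sector_of_re_neg hφ (by simp; linarith)
  refine exists_isDerivOf (Q := fun z => -resolvent (addScalar A ω) (-z)) h
    (fun z hre => isShiftInv_addScalar hσ (hz z hre)) fun z hre => ?_
  have h1 : -z - ω ∈ resolventSet A := not_not.1 fun h => hz z hre (hσ h)
  refine le_trans ?_ (hM _ (hz z hre))
  rw [resolvent_addScalar h1, smul_neg, norm_neg, norm_smul, norm_smul]
  gcongr
  rw [← abs_of_nonneg (norm_nonneg z), ← abs_of_nonneg (norm_nonneg (-z - (ω : ℂ))), ← sq_le_sq,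
    Complex.sq_norm, Complex.sq_norm, Complex.normSq_apply, Complex.normSq_apply]
  simp
  nlinarith

/-- The integral is the average over `(0, t]` of `t z e^{-zs} U(s) x`, and averages stay in the
closed convex hull. -/
theorem IsBddSemigroup.smul_integral_mem_closure_convexHull [CompleteSpace X]
    (h : IsBddSemigroup A U K) {𝒜 : Set (X →L[ℂ] X)} {z : ℂ} {t : ℝ} (ht : 0 < t)
    (h𝒜 : ∀ s ∈ Ioc 0 t, ((t : ℂ) * z * Complex.exp (-z * s)) • U s ∈ 𝒜) (x : X) :
    z • (∫ s in (0 : ℝ)..t, Complex.exp (-z * s) • U s x) ∈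
      closure (convexHull ℝ ((fun B => B x) '' 𝒜)) := by
  have e : z • (∫ s in (0 : ℝ)..t, Complex.exp (-z * s) • U s x) =
      ⨍ s in Ioc 0 t, ((t : ℂ) * z * Complex.exp (-z * s)) • U s x := by
    rw [setAverage_eq, ← intervalIntegral.integral_of_le ht.le, Measure.real, Real.volume_Ioc,
      sub_zero, ENNReal.toReal_ofReal ht.le]
    simp_rw [mul_smul]
    rw [intervalIntegral.integral_smul, intervalIntegral.integral_smul, Complex.coe_smul,
      inv_smul_smul₀ ht.ne']
  rw [e]
  refine (convex_convexHull ℝ _).set_average_mem_closure (by simp [ht]) (by simp) ?_ ?_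
  · refine ae_restrict_of_forall_mem measurableSet_Ioc fun s hs => subset_convexHull ℝ _ ?_
    exact ⟨_, h𝒜 s hs, rfl⟩
  · have : Continuous fun s : ℝ => ((t : ℂ) * z * Complex.exp (-z * s)) • U s x :=
      (by fun_prop : Continuous fun s : ℝ => (t : ℂ) * z * Complex.exp (-z * s)).smul (h.cont x)
    exact this.integrableOn_Ioc

/-- Decomposition of `z (z + A)⁻¹ x` in terms of the operators `U s` and `s A U s`. -/
theorem IsDerivOf.exists_decomposition [CompleteSpace X] (hV : IsDerivOf A U V C)
    (h : IsBddSemigroup A U K) {m : ℝ} (hm : 0 < m) {𝒜 ℬ 𝒯 : Set (X →L[ℂ] X)}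
    (h𝒜 : ∀ (c : ℂ) (s : ℝ), 0 < s → ‖c‖ ≤ m * Real.exp 1 → c • U s ∈ 𝒜)
    (hℬ : ∀ (c : ℂ) (s : ℝ), 0 < s → ‖c‖ ≤ Real.exp 1 → c • U s ∈ ℬ)
    (h𝒯 : ∀ (c : ℂ) (s : ℝ), 0 < s → ‖c‖ ≤ 1 → c • (s : ℂ) • V s ∈ 𝒯) {z : ℂ}
    (hz : z ≠ 0) (hre : -(‖z‖ / m) ≤ z.re) {R : X →L[ℂ] X} (hR : IsShiftInv A z R) (x : X) :
    ∃ a ∈ closure (convexHull ℝ ((fun B => B x) '' 𝒜)), ∃ B ∈ ℬ, ∃ T ∈ 𝒯,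
      z • R x = a + B x - (Real.exp 1 / m) • T (z • R x) := by
  have hz0 : 0 < ‖z‖ := norm_pos_iff.2 hz
  -- Then `|t z| = m`, and `Re z ≥ -|z| / m` keeps `|e^{-zs}| ≤ e` on `[0, t]`; the third term gets
  -- the small factor `e / m`.
  set t := m / ‖z‖ with ht
  have ht0 : 0 < t := by positivity
  have hexp : ∀ s ∈ Icc 0 t, ‖Complex.exp (-z * s)‖ ≤ Real.exp 1 := by
    intro s hs
    rw [Complex.norm_exp, Real.exp_le_exp]
    have : (-z * s).re = -z.re * s := by simp
    rw [this]
    calc -z.re * s ≤ ‖z‖ / m * s := mul_le_mul_of_nonneg_right (by linarith) hs.1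
      _ ≤ ‖z‖ / m * t := mul_le_mul_of_nonneg_left hs.2 (by positivity)
      _ = 1 := by rw [ht]; field_simp
  have htz : ‖(t : ℂ) * z‖ = m := by
    rw [norm_mul, Complex.norm_real, Real.norm_of_nonneg ht0.le, ht]; field_simp
  refine ⟨_, h.smul_integral_mem_closure_convexHull (z := z) ht0 (fun s hs => h𝒜 _ s hs.1 ?_) x,
    Complex.exp (-z * t) • U t, hℬ _ t ht0 (hexp t ⟨ht0.le, le_rfl⟩),
    (Complex.exp (-z * t) * ((t : ℂ) * z)⁻¹ * (m / Real.exp 1 : ℝ)) • ((t : ℂ) • V t),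
    h𝒯 _ t ht0 ?_, ?_⟩
  · rw [norm_mul, htz]
    gcongr
    exact hexp s ⟨hs.1.le, hs.2⟩
  · rw [norm_mul, norm_mul, norm_inv, htz, Complex.norm_real, Real.norm_of_nonneg (by positivity)]
    calc _ ≤ Real.exp 1 * m⁻¹ * (m / Real.exp 1) := by
          gcongr
          exact hexp t ⟨ht0.le, le_rfl⟩
      _ = _ := by
          have := Real.exp_pos 1
          field_simp
  · refine (hV.smul_shiftInv_eq h hz hR ht0 x).trans ?_
    congr 1
    rw [smul_apply, smul_apply, smul_smul, ← Complex.coe_smul, smul_smul]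
    congr 1
    have h1 : (t : ℂ) ≠ 0 := by exact_mod_cast ht0.ne'
    have h2 : (m : ℂ) ≠ 0 := by exact_mod_cast hm.ne'
    push_cast
    field_simp

end Abstract

/-! ### Absorption and the choice of the angle. -/

section Absorb

variable {X : Type*} [NormedAddCommGroup X] [NormedSpace ℂ X]

/-- The error term acts on `y k = P k (x k)` itself, so its Rademacher norm is at most half that of
`y`, a finite number, and can be subtracted. The data `w`, `B`, `T` may depend on `x`. -/
theorem isRBounded_of_absorb {𝒜 ℬ 𝒯 𝒮 : Set (X →L[ℂ] X)} {d r : ℝ} (hr : 0 ≤ r)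
    (hrd : r * d ≤ 1 / 2) (h𝒜 : IsRBounded 𝒜) (hℬ : IsRBounded ℬ)
    (h𝒯 : ∀ (n : ℕ) (T : Fin n → X →L[ℂ] X) (x : Fin n → X), (∀ k, T k ∈ 𝒯) →
      radNorm (fun k => T k (x k)) ≤ d * radNorm x)
    (h𝒮 : ∀ P ∈ 𝒮, ∀ x, ∃ w ∈ closure (convexHull ℝ ((fun B => B x) '' 𝒜)), ∃ B ∈ ℬ, ∃ T ∈ 𝒯,
      P x = w + B x - r • T (P x)) :
    IsRBounded 𝒮 := by
  obtain ⟨a, ha0, h𝒜⟩ := h𝒜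
  obtain ⟨b, hb0, hℬ⟩ := hℬ
  refine ⟨2 * (a + b), by positivity, fun n P x hP => ?_⟩
  have hxy := fun k => h𝒮 (P k) (hP k) (x k)
  change radNorm (fun k => P k (x k)) ≤ _ * radNorm x
  set y : Fin n → X := fun k => P k (x k) with hydef
  choose w hw B hB T hT hy using hxy
  have h1 : radNorm w ≤ a * radNorm x := by
    refine radNorm_le_of_mem_closure_convexHull (fun u hu => ?_) hw
    choose Q hQ hPu using hu
    have h0 : radNorm (fun k => Q k (x k)) ≤ a * radNorm x := h𝒜 n Q x hQ
    rwa [funext hPu] at h0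
  have h2 : radNorm (fun k => B k (x k)) ≤ b * radNorm x := hℬ n B x hB
  have h3 := h𝒯 n T y hT
  have e : y = (w + fun k => B k (x k)) + (-r) • fun k => T k (y k) := by
    funext k
    rw [Pi.add_apply, Pi.add_apply, Pi.smul_apply, neg_smul, ← sub_eq_add_neg]
    exact hy k
  have h4 : radNorm y ≤ radNorm w + radNorm (fun k => B k (x k)) +
      r * radNorm (fun k => T k (y k)) := by
    conv_lhs => rw [e]
    refine (radNorm_add_le _ _).trans ?_
    rw [radNorm_smul, abs_neg, abs_of_nonneg hr]
    gcongr
    exact radNorm_add_le _ _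
  have h5 : r * radNorm (fun k => T k (y k)) ≤ 1 / 2 * radNorm y := by
    calc _ ≤ r * (d * radNorm y) := by gcongr
      _ = r * d * radNorm y := by ring
      _ ≤ _ := mul_le_mul_of_nonneg_right hrd (radNorm_nonneg y)
  linarith

theorem exists_cos_le {φ m : ℝ} (hφ : φ ∈ Ioo 0 (π / 2)) (hm : 0 < m) :
    ∃ θ ∈ Ioo φ (π / 2), Real.cos θ ≤ 1 / m := by
  have hcos : 0 < Real.cos φ := Real.cos_pos_of_mem_Ioo ⟨by linarith [hφ.1, Real.pi_pos], hφ.2⟩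
  have hc1 := Real.cos_le_one φ
  set c := min (1 / m) (Real.cos φ / 2) with hc
  have hc0 : 0 < c := lt_min (by positivity) (by positivity)
  have hcφ : c < Real.cos φ := (min_le_right _ _).trans_lt (by linarith)
  refine ⟨Real.arccos c, ⟨?_, Real.arccos_lt_pi_div_two.2 hc0⟩, ?_⟩
  · have := Real.arccos_lt_arccos (by linarith) hcφ hc1
    rwa [Real.arccos_cos hφ.1.le (by linarith [hφ.2, Real.pi_pos])] at this
  · rw [Real.cos_arccos (by linarith) (by linarith)]
    exact min_le_left _ _

end Absorb

/-! ### Gaussian domination of `s A U(s)` and the resolvent bound. -/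

section Gauss

variable {E : Type*} [NormedAddCommGroup E] [InnerProductSpace ℝ E] [FiniteDimensional ℝ E]
  [MeasurableSpace E] [BorelSpace E] {Ω : Set E} {p : ℝ≥0∞} [Fact (1 ≤ p)]
  {A : Lp ℂ p (volume.restrict Ω) →ₗ.[ℂ] Lp ℂ p (volume.restrict Ω)}
  {U V : ℝ → Lp ℂ p (volume.restrict Ω) →L[ℂ] Lp ℂ p (volume.restrict Ω)} {K₀ : ℝ≥0}
  {K c C : ℝ}

/-- Splitting `s` into thirds puts the Taylor remainder at time `s/3` between two copies of `U
(s/3)`. The Taylor estimate there, with increment `hs`, gives `(6C/s)² (hs)² = 36 C² h²`. -/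
theorem IsDerivOf.gaussDom (hV : IsDerivOf A U V C) (h : IsBddSemigroup A U K) (hC : 0 ≤ C)
    {z : ℂ} {R : Lp ℂ p (volume.restrict Ω) →L[ℂ] Lp ℂ p (volume.restrict Ω)}
    (hR : IsShiftInv A z R) (hΩ : MeasurableSet Ω) (hp : p ≠ ∞) (hc : 0 < c)
    (hU : ∀ τ > 0, GaussDom K₀ (c * τ) (U τ)) {s : ℝ} (hs : 0 < s) :
    GaussDom (landauConst E K₀ (36 * C ^ 2).toNNReal) (16 * (c * s)) ((s : ℂ) • V s) := by
  have hs3 : 0 < s / 3 := by positivity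
  refine gaussDom_of_second_order hΩ hp hc hs U
    (fun r => U (s / 3) - U (s / 3 + r * s) - ((r * s : ℝ) : ℂ) • V (s / 3)) hU ?_ ?_
  · intro r hr
    refine ContinuousLinearMap.opNorm_le_bound _ (by positivity) fun x => ?_
    have h1 := hV.norm_taylor_le h hC hR hs3 (t := s / 3 + r * s)
      (by have := hr.1; have : 0 < r * s := by positivity
          linarith) x
    rw [add_sub_cancel_left] at h1
    refine h1.trans (le_of_eq ?_)
    rw [Real.coe_toNNReal _ (by positivity)]
    field_simp
    ring
  · intro r hr f
    have hrs : 0 ≤ r * s := mul_nonneg hr.1.le hs.le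
    have e1 : U s f = U (s / 3) (U (s / 3) (U (s / 3) f)) := by
      rw [← h.add (s / 3) (s / 3) hs3.le hs3.le f, ← h.add _ _ hs3.le (by positivity)]
      congr 2; ring
    have e2 : U (s + r * s) f = U (s / 3) (U (s / 3 + r * s) (U (s / 3) f)) := by
      rw [← h.add _ _ (by positivity) hs3.le, ← h.add _ _ hs3.le (by positivity)]
      congr 2; ring
    have e3 : V s f = U (s / 3) (V (s / 3) (U (s / 3) f)) := by
      have h1 := hV.mem_graph _ hs3 (U (s / 3) f)
      rw [← h.add _ _ hs3.le hs3.le] at h1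
      rw [graph_unique h1 (hV.mem_graph _ (by positivity) f),
        ← hV.add_apply h hs3.le (by positivity)]
      congr 2; ring
    simp only [sub_apply, smul_apply, map_sub, map_smul]
    rw [← e1, ← e2, ← e3, smul_smul, Complex.ofReal_mul]
    abel

/-- If the semigroups generated by uniformly sectorial operators are uniformly dominated by
Gaussian averages, then their resolvents are `𝓡`-bounded. -/
theorem exists_isRBounded_resolvent {ι : Type*} (hΩ : MeasurableSet Ω) (hp1 : 1 < p) (hp : p ≠ ∞)
    {A : ι → Lp ℂ p (volume.restrict Ω) →ₗ.[ℂ] Lp ℂ p (volume.restrict Ω)} {φ M : ℝ}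
    (hφ : φ ∈ Ioo 0 (π / 2)) (hσ : ∀ i, spectrum (A i) ⊆ closure (sector φ)) (hM0 : 0 ≤ M)
    (hM : ∀ i, ∀ z ∉ closure (sector φ), ‖z • resolvent (A i) z‖ ≤ M)
    {S : ι → ℝ → Lp ℂ p (volume.restrict Ω) →L[ℂ] Lp ℂ p (volume.restrict Ω)}
    (hS : ∀ i, IsC0Semigroup (S i)) (hgen : ∀ i, IsGeneratorOf (-(A i)) (S i)) (hc : 0 < c)
    (K₀ : ℝ≥0) :
    ∃ θ ∈ Ioo φ (π / 2), ∀ ω : ℝ, 0 ≤ ω →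
      (∀ i, ∀ s > 0, GaussDom K₀ (c * s) (rescale (S i) ω s)) →
      IsRBounded {B | ∃ i, ∃ z ∉ closure (sector θ), B = z • resolvent (addScalar (A i) ω) z} := by
  set Cd := Real.exp 1 * (M ^ 2 + M ^ 3) with hCd
  have hCd0 : 0 ≤ Cd := by positivity
  set K₁ := landauConst E K₀ (36 * Cd ^ 2).toNNReal with hK₁
  obtain ⟨d, hd0, hd⟩ := isRBounded_gaussClass hΩ hp1 hp (1 * K₁)
  -- Ensures `(e / m) d ≤ 1/2`. Since `d` depends only on `K₀`, `M` and the space, `m` and hence `θ`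
  -- are fixed before `ω`.
  set m := 2 * Real.exp 1 * d + 1 with hm
  have hm0 : 0 < m := by positivity
  obtain ⟨θ, hθ, hθm⟩ := exists_cos_le hφ hm0
  have hθ' : θ ∈ Ioo 0 (π / 2) := ⟨hφ.1.trans hθ.1, hθ.2⟩
  refine ⟨θ, hθ, fun ω hω0 hU => ?_⟩
  refine isRBounded_of_absorb (r := Real.exp 1 / m) (by positivity) ?_
    (isRBounded_gaussClass hΩ hp1 hp ((m * Real.exp 1).toNNReal * K₀))
    (isRBounded_gaussClass hΩ hp1 hp ((Real.exp 1).toNNReal * K₀)) hd ?_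
  · rw [div_mul_eq_mul_div, div_le_iff₀ hm0, hm]
    linarith
  rintro B ⟨i, z, hz, rfl⟩ x
  have hsg := isBddSemigroup_rescale (hS i) (hgen i)
    fun s hs => (hU i s hs).norm_le hΩ hp (mul_pos hc hs)
  obtain ⟨V, hV⟩ := exists_isDerivOf_addScalar hφ (hσ i) (hM i) hω0 hsg
  have hz0 := ne_zero_of_notMem_closure_sector hθ' hz
  have hQ : IsShiftInv (addScalar (A i) ω) (-z)
      (-resolvent (addScalar (A i) ω) z) := by
    have := isShiftInv_addScalar (A := A i) (ω := ω) (z := -z) (hσ i) (by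
      rw [neg_neg]
      exact fun h => hz (mem_closure_sector_of_sub hφ hθ hω0 h))
    rwa [neg_neg] at this
  have hre : -(‖-z‖ / m) ≤ (-z).re := by
    have h1 := re_le_of_notMem_closure_sector hθ' hz
    have h2 : ‖z‖ * Real.cos θ ≤ ‖z‖ * (1 / m) := by gcongr
    rw [norm_neg, Complex.neg_re, neg_le_neg_iff, div_eq_mul_one_div]
    exact h1.trans h2
  have hV' := fun s (hs : 0 < s) => hV.gaussDom hsg hCd0 hQ hΩ hp hc (hU i) hs
  have hdec := hV.exists_decomposition hsg hm0
    (𝒜 := gaussClass Ω p ((m * Real.exp 1).toNNReal * K₀))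
    (ℬ := gaussClass Ω p ((Real.exp 1).toNNReal * K₀))
    (𝒯 := gaussClass Ω p (1 * K₁))
    (fun w s hs hw => ⟨_, mul_pos hc hs, (hU i s hs).smul (hw.trans (Real.le_coe_toNNReal _))⟩)
    (fun w s hs hw => ⟨_, mul_pos hc hs, (hU i s hs).smul (hw.trans (Real.le_coe_toNNReal _))⟩)
    (fun w s hs hw => ⟨_, by positivity, (hV' s hs).smul (hw.trans_eq NNReal.coe_one.symm)⟩)
    (neg_ne_zero.2 hz0) hre hQ x
  rw [neg_apply, neg_smul, smul_neg, neg_neg] at hdec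
  exact hdec

end Gauss

end Main

end KernelRBound

end

theorem mainTheorem8 (N : ℕ) (Ω : Set (EuclideanSpace ℝ (Fin N))) (hΩ : MeasurableSet Ω)
    (p : ℝ≥0∞) [Fact (1 ≤ p)] (hp1 : 1 < p) (hp : p ≠ ∞) (T : ℝ)
    (A : ℝ → Lp ℂ p (volume.restrict Ω) →ₗ.[ℂ] Lp ℂ p (volume.restrict Ω))
    (hA : ∀ t ∈ Icc 0 T, KernelRBound.IsSectorial (A t))
    -- uniform sectoriality
    (φ : ℝ) (hφ : φ ∈ Ioo 0 (π / 2))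
    (hσ : ∀ t ∈ Icc 0 T, KernelRBound.spectrum (A t) ⊆ closure (KernelRBound.sector φ))
    (hR : ∃ M : ℝ, ∀ t ∈ Icc 0 T, ∀ z ∉ closure (KernelRBound.sector φ),
      ‖z • KernelRBound.resolvent (A t) z‖ ≤ M)
    -- `S t s = exp (-s A(t))`, the semigroup generated by `-A(t)`
    (S : ℝ → ℝ → Lp ℂ p (volume.restrict Ω) →L[ℂ] Lp ℂ p (volume.restrict Ω))
    (hS : ∀ t ∈ Icc 0 T,
      KernelRBound.IsC0Semigroup (S t) ∧ KernelRBound.IsGeneratorOf (-(A t)) (S t))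
    -- uniform Gaussian estimates
    (k : ℝ → ℝ → EuclideanSpace ℝ (Fin N) → EuclideanSpace ℝ (Fin N) → ℂ)
    (hk : ∀ t ∈ Icc 0 T, ∀ s : ℝ, 0 < s → KernelRBound.IsGivenByKernel (S t s) (k t s))
    (C β ω₁ : ℝ) (hC : 0 ≤ C) (hβ : 0 < β)
    (hGauss : ∀ t ∈ Icc 0 T, ∀ s : ℝ, 0 < s →
      ∀ᵐ z ∂((volume.restrict Ω).prod (volume.restrict Ω)),
        ‖k t s z.1 z.2‖ ≤ C * s ^ (-(N : ℝ) / 2) * Real.exp (ω₁ * s) *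
          Real.exp (-(‖z.1 - z.2‖ ^ 2 / (4 * β * s)))) :
    ∃ θ ∈ Ioo φ (π / 2), ∀ ω : ℝ, max ω₁ 0 ≤ ω →
      (∀ t ∈ Icc 0 T,
        KernelRBound.spectrum (KernelRBound.addScalar (A t) ω) ⊆
          closure (KernelRBound.sector θ)) ∧
      KernelRBound.IsRBounded
        {B | ∃ t ∈ Icc 0 T, ∃ z ∉ closure (KernelRBound.sector θ),
          B = z • KernelRBound.resolvent (KernelRBound.addScalar (A t) ω) z} := by
  obtain ⟨M, hM⟩ := hR
  -- `M` is replaced by `max M 0`, because for `T < 0` the index set is empty and `M` may be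
  -- negative.
  obtain ⟨θ, hθ, h⟩ := KernelRBound.exists_isRBounded_resolvent (ι := Icc 0 T) hΩ hp1 hp
    (A := fun t => A t) (S := fun t => S t) hφ (fun t => hσ t t.2) (le_max_right M 0)
    (fun t z hz => (hM t t.2 z hz).trans (le_max_left M 0)) (fun t => (hS t t.2).1)
    (fun t => (hS t t.2).2) (by positivity : 0 < 4 * β) (C * (4 * π * β) ^ (N / 2 : ℝ)).toNNReal
  refine ⟨θ, hθ, fun ω hω => ?_⟩
  have hω0 : 0 ≤ ω := (le_max_right _ _).trans hω
  refine ⟨fun t ht z hz => ?_, ?_⟩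
  · refine KernelRBound.mem_closure_sector_of_sub hφ hθ hω0 (hσ t ht fun h => hz ?_)
    exact KernelRBound.resolventSet_addScalar.2 h
  · have h1 := h ω hω0 fun t s hs => KernelRBound.gaussDom_rescale hΩ hC hβ hs
      ((le_max_left _ _).trans hω) (hk t t.2 s hs) (hGauss t t.2 s hs)
    have e : {B | ∃ t ∈ Icc 0 T, ∃ z ∉ closure (KernelRBound.sector θ),
        B = z • KernelRBound.resolvent (KernelRBound.addScalar (A t) ω) z} =
        {B | ∃ t : Icc 0 T, ∃ z ∉ closure (KernelRBound.sector θ),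
          B = z • KernelRBound.resolvent (KernelRBound.addScalar (A t) ω) z} := by
      ext B
      simp only [mem_ofPred_eq, Subtype.exists, exists_prop]
    rw [e]
    exact h1
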